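/- **Conventions.** An object $U$ of a category $\mathcal C$ is subterminal if every object has at most one morphism to $U$. A *filter of subterminal objects* $\Phi$ on $\mathcal C$ is a non-empty, upward closed and downward directed family of subterminal objects, where $U\le V$ means that there is a morphism $U\to V$. If $\mathcal C$ has finite products, the *filter quotient* $\mathcal C_\Phi$ has the objects of $\mathcal C$, and its morphisms $X\to Y$ are classes of morphisms $X\times U\to Y$ of $\mathcal C$ with $U\in\Phi$, two of which are identified if they agree on $X\times W$ for some $W\in\Phi$ below both stages. For a class $S$ of morphisms of $\mathcal C$, $S_\Phi$ is the class of morphisms $f$ of $\mathcal C_\Phi$ such that $f\times U\in S$ for some $U\in\Phi$ at which $f$ is represented. A *propositional coherent theory* $\mathbb T$ consists of a category $\mathbb T_0$ with finite products and a fibration in posets $\mathbb T_1\to\mathbb T_0$, whose fibres $\mathbb T_1(X)$ are bounded distributive lattices with operations stable under reindexing, and which has equality predicates $(\equiv_X)\in\mathbb T_1(X\times X)$ (reflexive and satisfying the substitution rule). A *model* of $\mathbb T$ in a coherent category $\mathcal V$ is a functor $m_0:\mathbb T_0\to\mathcal V$ preserving finite products, together with a functor $m_1:\mathbb T_1\to\mathrm{Mono}(\mathcal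 V)$ over $m_0$ which preserves cartesian morphisms and, fibrewise, finite meets and joins. A *strict interval* in $\mathbb T$ is an object $I$ of $\mathbb T_0$ with points $0,1:1\to I$ and a relation $(\le)\in\mathbb T_1(I\times I)$ for which $\mathbb T$ proves: $x\le x$; $x\le y\wedge y\le z\vdash x\le z$; $x\le y\wedge y\le x\vdash x\equiv y$; $\vdash x\le y\vee y\le x$; $0\le x$; $x\le 1$; $0\equiv 1\vdash\bot$. The filter quotient $\mathbb T_\Phi$ by a filter $\Phi$ on $\mathbb T_0$ has category of contexts $(\mathbb T_0)_\Phi$, and its fibre over $X$ is the filtered colimit of the posets $\mathbb T_1(X\times U)$, $U\in\Phi$. A *finitary model category with $\mathbb T$-shapes* $(\mathcal M,\mathcal V,\mathbb T,\overline\omega)$ consists of 1. an elementary topos $\mathcal M$ with a right proper model structure (only finite limits and colimits are required) whose cofibrations are monomorphisms; 2. a propositional coherent theory $\mathbb T$ and a model $(m_0,m_1)$ of it in a coherent category $\mathcal V$; 3. a coherent functor $\overline\omega:\mathcal V\to\mathcal M$, that is, one preserving finite limits, regular epimorphisms and finite unions of subobjects; 4. such that for every $U\in\mathcal V$ the functor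 $\overline\omega(U)\times-:\mathcal M\to\mathcal M$ preserves acyclic cofibrations. A *model filter for $\mathbb T$-shapes* is a triple $(\Phi_{\mathbb T},\Phi_{\mathcal V},\Phi_{\mathcal M})$ of filters of subterminal objects on $\mathbb T_0$, $\mathcal V$, $\mathcal M$ such that $m_0$ maps $\Phi_{\mathbb T}$ to $\Phi_{\mathcal V}$, $\overline\omega$ maps $\Phi_{\mathcal V}$ to $\Phi_{\mathcal M}$, every $U\in\Phi_{\mathcal M}$ is fibrant, and the classes of cofibrations and of weak equivalences of $\mathcal M$ are stable under $-\times U$ for every $U\in\Phi_{\mathcal M}$. **Theorem.** Let $(\mathcal M,\mathcal V,\mathbb T,\overline\omega)$ be a finitary model category with $\mathbb T$-shapes and $(\Phi_{\mathbb T},\Phi_{\mathcal V},\Phi_{\mathcal M})$ a model filter for $\mathbb T$-shapes. Equip $\mathcal M_{\Phi_{\mathcal M}}$ with the classes $\mathcal F_{\Phi_{\mathcal M}},\mathcal C_{\Phi_{\mathcal M}},\mathcal W_{\Phi_{\mathcal M}}$ obtained from the fibrations, cofibrations and weak equivalences of $\mathcal M$, and take the functors and the interpretation induced by $m_0$, $m_1$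 and $\overline\omega$ on the filter quotients. Then $(\mathcal M_{\Phi_{\mathcal M}},\mathcal V_{\Phi_{\mathcal V}},\mathbb T_{\Phi_{\mathbb T}},\overline\omega)$ is a finitary model category with $\mathbb T_{\Phi_{\mathbb T}}$-shapes. If $\mathbb T$ has a strict interval, then so does $\mathbb T_{\Phi_{\mathbb T}}$. Moreover, if the given model interprets the equality predicates as the diagonals, then so does the induced one; and if the cofibrations of $\mathcal M$ are exactly the monomorphisms, then the same holds in $\mathcal M_{\Phi_{\mathcal M}}$. -/

import Mathlib

open CategoryTheory CategoryTheory.Limits Opposite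

-- With all of Mathlib imported, this instance would give `X ⟶ Y` an unusual elaboration.
attribute [-instance] CategoryTheory.catToReflQuiver

attribute [local simp] CategoryTheory.Limits.prod.lift_fst CategoryTheory.Limits.prod.lift_snd
  CategoryTheory.Limits.prod.lift_fst_assoc CategoryTheory.Limits.prod.lift_snd_assoc

universe v₁ v₂ v₃ u₁ u₂ u₃ w

set_option linter.unusedSectionVars false

noncomputable section

/-! ## Filters of subterminal objects -/

/-- A filter of subterminal objects of `C`: a filter on the poset of (isomorphism classes of)
subterminal objects, where `U ≤ V` means that there is a morphism `U ⟶ V`. -/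
structure SubterminalFilter (C : Type u₁) [Category.{v₁} C] where
  /-- the objects which belong to the filter -/
  mem : C → Prop
  subterminal : ∀ U : C, mem U → IsSubterminal U
  nonempty : ∃ U : C, mem U
  upward : ∀ (U V : C), mem U → IsSubterminal V → (U ⟶ V) → mem V
  directed : ∀ (U V : C), mem U → mem V → ∃ W : C, mem W ∧ Nonempty (W ⟶ U) ∧ Nonempty (W ⟶ V)

namespace SubterminalFilter

variable {C : Type u₁} [Category.{v₁} C] [HasFiniteProducts C] (Φ : SubterminalFilter C)

lemma mem_terminal : Φ.mem (⊤_ C) := by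
  obtain ⟨U, hU⟩ := Φ.nonempty
  exact Φ.upward U _ hU isSubterminal_of_terminal (terminal.from U)

lemma mem_prod {U V : C} (hU : Φ.mem U) (hV : Φ.mem V) : Φ.mem (U ⨯ V) := by
  obtain ⟨W, hW, ⟨a⟩, ⟨b⟩⟩ := Φ.directed U V hU hV
  refine Φ.upward W _ hW ?_ (prod.lift a b)
  intro Z f g
  exact Limits.prod.hom_ext (Φ.subterminal U hU _ _) (Φ.subterminal V hV _ _)

/-! ## The filter quotient of a category -/

/-- Representatives `X ⨯ U ⟶ Y`, with `U` in the filter, of morphisms of the filter quotient. -/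
structure Rep (X Y : C) where
  /-- the stage at which the representative is defined -/
  stage : C
  mem : Φ.mem stage
  /-- the representing morphism -/
  hom : X ⨯ stage ⟶ Y

variable {Φ}

/-- Two representatives are equivalent if they agree after restriction to a smaller stage. -/
def Rep.Rel {X Y : C} (f g : Φ.Rep X Y) : Prop :=
  ∃ (W : C) (_ : Φ.mem W) (a : W ⟶ f.stage) (b : W ⟶ g.stage),
    prod.map (𝟙 X) a ≫ f.hom = prod.map (𝟙 X) b ≫ g.hom

lemma map_id_comp {X A B D : C} (p : A ⟶ B) (q : B ⟶ D) :
    prod.map (𝟙 X) (p ≫ q) = prod.map (𝟙 X) p ≫ prod.map (𝟙 X) q := by simp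

variable (Φ) in
/-- The setoid on representatives. -/
@[reducible]
def repSetoid (X Y : C) : Setoid (Φ.Rep X Y) where
  r := Rep.Rel
  iseqv :=
    { refl := fun f => ⟨f.stage, f.mem, 𝟙 _, 𝟙 _, rfl⟩
      symm := fun ⟨W, hW, a, b, h⟩ => ⟨W, hW, b, a, h.symm⟩
      trans := by
        rintro f g k ⟨W, hW, a, b, h⟩ ⟨W', hW', a', b', h'⟩
        refine ⟨W ⨯ W', Φ.mem_prod hW hW', prod.fst ≫ a, prod.snd ≫ b', ?_⟩
        have e : (prod.fst ≫ b : W ⨯ W' ⟶ _) = prod.snd ≫ a' := Φ.subterminal _ g.mem _ _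
        rw [map_id_comp, Category.assoc, h, ← Category.assoc, ← map_id_comp, e, map_id_comp,
          Category.assoc, h', ← Category.assoc, ← map_id_comp] }

variable (Φ) in
/-- The morphisms from `X` to `Y` in the filter quotient: the equivalence classes of morphisms
`X ⨯ U ⟶ Y` with `U` in the filter. -/
def Mor (X Y : C) := Quotient (Φ.repSetoid X Y)

/-- The morphism of the filter quotient represented by `f : X ⨯ U ⟶ Y`. -/
def homMk {X Y : C} (U : C) (hU : Φ.mem U) (f : X ⨯ U ⟶ Y) : Φ.Mor X Y :=
  Quotient.mk (Φ.repSetoid X Y) ⟨U, hU, f⟩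

lemma homMk_eq_iff {X Y : C} {U V : C} (hU : Φ.mem U) (hV : Φ.mem V)
    (f : X ⨯ U ⟶ Y) (g : X ⨯ V ⟶ Y) :
    homMk U hU f = homMk V hV g ↔ ∃ (W : C) (_ : Φ.mem W) (a : W ⟶ U) (b : W ⟶ V),
      prod.map (𝟙 _) a ≫ f = prod.map (𝟙 _) b ≫ g :=
  Quotient.eq (r := Φ.repSetoid X Y)

lemma homMk_restrict {X Y : C} {U W : C} (hU : Φ.mem U) (hW : Φ.mem W)
    (a : W ⟶ U) (f : X ⨯ U ⟶ Y) :
    homMk W hW (prod.map (𝟙 _) a ≫ f) = homMk U hU f :=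
  (homMk_eq_iff _ _ _ _).2 ⟨W, hW, 𝟙 _, a, by simp⟩

lemma hom_exists_rep {X Y : C} (f : Φ.Mor X Y) :
    ∃ (U : C) (hU : Φ.mem U) (f₀ : X ⨯ U ⟶ Y), f = homMk U hU f₀ := by
  obtain ⟨⟨U, hU, f₀⟩, rfl⟩ := Quotient.exists_rep f
  exact ⟨U, hU, f₀, rfl⟩

lemma hom_exists_rep₂ {X Y X' Y' : C} (f : Φ.Mor X Y) (g : Φ.Mor X' Y') :
    ∃ (U : C) (hU : Φ.mem U) (f₀ : X ⨯ U ⟶ Y) (g₀ : X' ⨯ U ⟶ Y'),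
      f = homMk U hU f₀ ∧ g = homMk U hU g₀ := by
  obtain ⟨U, hU, f, rfl⟩ := hom_exists_rep f
  obtain ⟨V, hV, g, rfl⟩ := hom_exists_rep g
  exact ⟨U ⨯ V, Φ.mem_prod hU hV, _, _, (homMk_restrict hU _ prod.fst f).symm,
    (homMk_restrict hV _ prod.snd g).symm⟩

/-- Equal morphisms which are represented at the same stage agree at a smaller stage. -/
lemma homMk_eq_iff_same {X Y : C} {U : C} (hU : Φ.mem U) (f g : X ⨯ U ⟶ Y) :
    homMk U hU f = homMk U hU g ↔ ∃ (W : C) (_ : Φ.mem W) (a : W ⟶ U),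
      prod.map (𝟙 _) a ≫ f = prod.map (𝟙 _) a ≫ g := by
  rw [homMk_eq_iff]
  constructor
  · rintro ⟨W, hW, a, b, h⟩
    obtain rfl : a = b := Φ.subterminal _ hU _ _
    exact ⟨W, hW, a, h⟩
  · rintro ⟨W, hW, a, h⟩
    exact ⟨W, hW, a, a, h⟩

/-- The morphism `(x, u, v) ↦ (f (x, u), v)`. -/
def pairRep {X Y U : C} (V : C) (f : X ⨯ U ⟶ Y) : X ⨯ (U ⨯ V) ⟶ Y ⨯ V :=
  prod.lift (prod.map (𝟙 X) prod.fst ≫ f) (prod.snd ≫ prod.snd)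

lemma map_pairRep {X Y U V W W' : C} (a : W ⟶ U) (a' : W' ⟶ V) (f : X ⨯ U ⟶ Y) :
    prod.map (𝟙 X) (prod.map a a') ≫ pairRep V f
      = pairRep W' (prod.map (𝟙 X) a ≫ f) ≫ prod.map (𝟙 Y) a' := by
  ext <;> simp [pairRep]

lemma map_diag_pairRep {X Y U : C} (f : X ⨯ U ⟶ Y) :
    prod.map (𝟙 X) (diag U) ≫ pairRep U f = prod.lift f prod.snd := by
  rw [pairRep]
  ext
  · simp [← Category.assoc]
  · simp

/-- Composition in the filter quotient: the class of `(x, u, v) ↦ g (f (x, u), v)`. -/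
def homComp {X Y Z : C} (f : Φ.Mor X Y) (g : Φ.Mor Y Z) : Φ.Mor X Z :=
  Quotient.liftOn₂ f g
    (fun f g => homMk (f.stage ⨯ g.stage) (Φ.mem_prod f.mem g.mem)
      (pairRep g.stage f.hom ≫ g.hom))
    (by
      rintro ⟨U, hU, f⟩ ⟨V, hV, g⟩ ⟨U', hU', f'⟩ ⟨V', hV', g'⟩ ⟨W, hW, a, b, h⟩
        ⟨W', hW', a', b', h'⟩
      dsimp at a b a' b' h h'
      refine (homMk_eq_iff _ _ _ _).2
        ⟨W ⨯ W', Φ.mem_prod hW hW', prod.map a a', prod.map b b', ?_⟩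
      dsimp
      rw [← Category.assoc, ← Category.assoc, map_pairRep, map_pairRep, Category.assoc,
        Category.assoc, h, h'])

/-- Representatives at a common stage are composed at that stage. -/
lemma homComp_mk {X Y Z : C} {U : C} (hU : Φ.mem U) (f : X ⨯ U ⟶ Y) (g : Y ⨯ U ⟶ Z) :
    homComp (homMk U hU f) (homMk U hU g) = homMk U hU (prod.lift f prod.snd ≫ g) := by
  change homMk (U ⨯ U) (Φ.mem_prod hU hU) (pairRep U f ≫ g) = _
  rw [← homMk_restrict (Φ.mem_prod hU hU) hU (diag U), ← Category.assoc, map_diag_pairRep]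

variable (Φ) in
/-- The class in the filter quotient of a morphism of `C`. -/
def morOf {X Y : C} (f : X ⟶ Y) : Φ.Mor X Y :=
  homMk (⊤_ C) Φ.mem_terminal (prod.fst ≫ f)

lemma morOf_eq {X Y : C} (f : X ⟶ Y) {U : C} (hU : Φ.mem U) :
    Φ.morOf f = homMk U hU (prod.fst ≫ f) := by
  rw [morOf, ← homMk_restrict Φ.mem_terminal hU (terminal.from U)]
  simp

lemma homMk_comp_morOf {X Y Z : C} {U : C} (hU : Φ.mem U) (f : X ⨯ U ⟶ Y) (g : Y ⟶ Z) :
    homComp (homMk U hU f) (Φ.morOf g) = homMk U hU (f ≫ g) := by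
  rw [morOf_eq g hU, homComp_mk]
  simp

lemma morOf_comp_homMk {X Y Z : C} {U : C} (hU : Φ.mem U) (f : X ⟶ Y) (g : Y ⨯ U ⟶ Z) :
    homComp (Φ.morOf f) (homMk U hU g) = homMk U hU (prod.map f (𝟙 U) ≫ g) := by
  rw [morOf_eq f hU, homComp_mk]
  congr 2
  ext <;> simp

lemma homComp_assoc {X Y Z T : C} (f : Φ.Mor X Y) (g : Φ.Mor Y Z) (k : Φ.Mor Z T) :
    homComp (homComp f g) k = homComp f (homComp g k) := by
  obtain ⟨U₁, h₁, f, rfl⟩ := hom_exists_rep f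
  obtain ⟨U₂, h₂, g, k, rfl, rfl⟩ := hom_exists_rep₂ g k
  have hU := Φ.mem_prod h₁ h₂
  rw [← homMk_restrict h₁ hU prod.fst, ← homMk_restrict h₂ hU prod.snd,
    ← homMk_restrict h₂ hU prod.snd]
  simp only [homComp_mk]
  congr 1
  rw [← Category.assoc (prod.lift _ prod.snd) (prod.lift _ prod.snd)]
  congr 1
  ext <;> simp

/-- The filter quotient `C_Φ`: it has the same objects as `C`. -/
structure FilterQuotient {C : Type u₁} [Category.{v₁} C] (Φ : SubterminalFilter C) where
  /-- the underlying object of `C` -/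
  as : C

/-- The category structure on the filter quotient: morphisms are the equivalence classes of
morphisms `X ⨯ U ⟶ Y` with `U` in the filter. -/
instance : Category (Φ.FilterQuotient) where
  Hom X Y := Φ.Mor X.as Y.as
  id X := Φ.morOf (𝟙 X.as)
  comp f g := homComp f g
  id_comp := by
    intro X Y (f : Φ.Mor X.as Y.as)
    obtain ⟨U, hU, f, rfl⟩ := hom_exists_rep f
    rw [morOf_comp_homMk]
    simp
  comp_id := by
    intro X Y (f : Φ.Mor X.as Y.as)
    obtain ⟨U, hU, f, rfl⟩ := hom_exists_rep f
    rw [homMk_comp_morOf]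
    simp
  assoc f g k := homComp_assoc f g k

variable (Φ) in
/-- The projection functor `P_Φ : C ⥤ C_Φ`. -/
def proj : C ⥤ Φ.FilterQuotient where
  obj X := ⟨X⟩
  map f := Φ.morOf f
  map_id _ := rfl
  map_comp {X Y Z} f g := by
    change _ = homComp (Φ.morOf f) (Φ.morOf g)
    conv_rhs => rw [morOf, homMk_comp_morOf]
    simp [morOf]

instance proj_preservesMonomorphisms : Φ.proj.PreservesMonomorphisms where
  preserves {X Y} m hm := by
    constructor
    intro Z (f : Φ.Mor Z.as X) (g : Φ.Mor Z.as X) (h : homComp f (Φ.morOf m) = homComp g (Φ.morOf m))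
    obtain ⟨U, hU, f, g, rfl, rfl⟩ := hom_exists_rep₂ f g
    rw [homMk_comp_morOf, homMk_comp_morOf, homMk_eq_iff_same] at h
    obtain ⟨W, hW, a, h⟩ := h
    refine (homMk_eq_iff_same _ _ _).2 ⟨W, hW, a, ?_⟩
    rw [← cancel_mono m]
    simpa using h

/-! ### Finite products in the filter quotient -/

instance : HasTerminal (Φ.FilterQuotient) := by
  refine (IsTerminal.ofUniqueHom (Y := Φ.proj.obj (⊤_ C))
    (fun X => Φ.morOf (terminal.from X.as)) ?_).hasTerminal
  intro X (m : Φ.Mor X.as (⊤_ C))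
  obtain ⟨U, hU, m, rfl⟩ := hom_exists_rep m
  refine Eq.trans ?_ (morOf_eq (Y := ⊤_ C) (terminal.from X.as) hU).symm
  exact congrArg (homMk U hU) (Subsingleton.elim _ _)

lemma exists_lift {T X Y : C} (f : Φ.Mor T X) (g : Φ.Mor T Y) :
    ∃ l : Φ.Mor T (X ⨯ Y), homComp l (Φ.morOf prod.fst) = f ∧
      homComp l (Φ.morOf prod.snd) = g := by
  obtain ⟨U, hU, f, g, rfl, rfl⟩ := hom_exists_rep₂ f g
  refine ⟨homMk U hU (prod.lift f g), ?_, ?_⟩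
  · rw [homMk_comp_morOf]; simp
  · rw [homMk_comp_morOf]; simp

lemma prod_hom_ext {T X Y : C} (l m : Φ.Mor T (X ⨯ Y))
    (h₁ : homComp l (Φ.morOf prod.fst) = homComp m (Φ.morOf prod.fst))
    (h₂ : homComp l (Φ.morOf prod.snd) = homComp m (Φ.morOf prod.snd)) : l = m := by
  obtain ⟨U, hU, l, m, rfl, rfl⟩ := hom_exists_rep₂ l m
  rw [homMk_comp_morOf, homMk_comp_morOf, homMk_eq_iff_same] at h₁ h₂
  obtain ⟨W, hW, a, h⟩ := h₁
  obtain ⟨W', hW', a', h'⟩ := h₂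
  refine (homMk_eq_iff_same _ _ _).2 ⟨W ⨯ W', Φ.mem_prod hW hW', prod.fst ≫ a, ?_⟩
  have ea : (prod.fst ≫ a : W ⨯ W' ⟶ U) = prod.snd ≫ a' := Φ.subterminal _ hU _ _
  apply Limits.prod.hom_ext
  · rw [map_id_comp]
    simp only [Category.assoc] at h ⊢
    rw [h]
  · rw [ea, map_id_comp]
    simp only [Category.assoc] at h' ⊢
    rw [h']

/-- The image of a binary product of `C` is a binary product in the filter quotient. -/
def isLimitProjFan (X Y : C) : IsLimit (BinaryFan.mk (P := Φ.proj.obj (X ⨯ Y))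
    (Φ.proj.map prod.fst) (Φ.proj.map prod.snd)) :=
  BinaryFan.isLimitMk (fun s => (exists_lift (Φ := Φ) (T := s.pt.as) s.fst s.snd).choose)
    (fun s => (exists_lift (Φ := Φ) (T := s.pt.as) s.fst s.snd).choose_spec.1)
    (fun s => (exists_lift (Φ := Φ) (T := s.pt.as) s.fst s.snd).choose_spec.2)
    (fun s _ h₁ h₂ => prod_hom_ext (Φ := Φ) (T := s.pt.as) _ _
      (h₁.trans (exists_lift (Φ := Φ) (T := s.pt.as) s.fst s.snd).choose_spec.1.symm)
      (h₂.trans (exists_lift (Φ := Φ) (T := s.pt.as) s.fst s.snd).choose_spec.2.symm))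

instance : HasFiniteProducts (Φ.FilterQuotient) := by
  have (X Y : Φ.FilterQuotient) : HasLimit (pair X Y) := ⟨⟨⟨_, isLimitProjFan X.as Y.as⟩⟩⟩
  have : HasBinaryProducts (Φ.FilterQuotient) := hasBinaryProducts_of_hasLimit_pair _
  exact hasFiniteProducts_of_has_binary_and_terminal

/-! ### Classes of morphisms in the filter quotient -/

variable (Φ) in
/-- The class `S_Φ` of the morphisms `f` of `C_Φ` such that `f × U`, regarded as a morphism
`X ⨯ U ⟶ Y ⨯ U` of `C`, belongs to `S` for some `U` in the filter at which `f` is defined. -/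
def quotientClass (S : MorphismProperty C) : MorphismProperty (Φ.FilterQuotient) :=
  fun X Y f => ∃ (U : C) (hU : Φ.mem U) (f₀ : X.as ⨯ U ⟶ Y.as),
    f = homMk U hU f₀ ∧ S (prod.lift f₀ (prod.snd : X.as ⨯ U ⟶ U))

variable (Φ) in
/-- The class `S` is stable under products with objects of the filter. -/
def ProductStable (S : MorphismProperty C) : Prop :=
  ∀ (U : C), Φ.mem U → ∀ {X Y : C} (f : X ⟶ Y), S f → S (prod.map f (𝟙 U))

/-! ### Functors induced between filter quotients -/

section induced

variable {D : Type u₂} [Category.{v₂} D] [HasFiniteProducts D] {Ψ : SubterminalFilter D}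

/-- `F (X ⨯ U ⟶ Y)` as a morphism `F X ⨯ F U ≅ F (X ⨯ U) ⟶ F Y`. -/
def mapRep (F : C ⥤ D) [PreservesFiniteProducts F] {X U Y : C} (f : X ⨯ U ⟶ Y) :
    F.obj X ⨯ F.obj U ⟶ F.obj Y :=
  (PreservesLimitPair.iso F X U).inv ≫ F.map f

lemma iso_inv_fst (F : C ⥤ D) [PreservesFiniteProducts F] (X U : C) :
    (PreservesLimitPair.iso F X U).inv ≫ F.map prod.fst = prod.fst := by
  simp

lemma iso_inv_snd (F : C ⥤ D) [PreservesFiniteProducts F] (X U : C) :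
    (PreservesLimitPair.iso F X U).inv ≫ F.map prod.snd = prod.snd := by
  simp

/-- Morphisms into `F (X ⨯ U)` are determined by their components. -/
lemma map_prod_hom_ext (F : C ⥤ D) [PreservesFiniteProducts F] {X U : C} {Z : D}
    {f g : Z ⟶ F.obj (X ⨯ U)} (h₁ : f ≫ F.map prod.fst = g ≫ F.map prod.fst)
    (h₂ : f ≫ F.map prod.snd = g ≫ F.map prod.snd) : f = g := by
  rw [← cancel_mono (PreservesLimitPair.iso F X U).hom]
  apply Limits.prod.hom_ext
  · simpa using h₁
  · simpa using h₂

lemma map_mapRep (F : C ⥤ D) [PreservesFiniteProducts F] {X W U Y : C} (a : W ⟶ U)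
    (f : X ⨯ U ⟶ Y) :
    prod.map (𝟙 (F.obj X)) (F.map a) ≫ mapRep F f = mapRep F (prod.map (𝟙 X) a ≫ f) := by
  rw [mapRep, mapRep, F.map_comp, ← Category.assoc, ← Category.assoc]
  congr 1
  apply map_prod_hom_ext F
  · simp only [Category.assoc, iso_inv_fst, ← F.map_comp, prod.map_fst]
    simp only [Category.comp_id, iso_inv_fst]
  · simp only [Category.assoc, iso_inv_snd, ← F.map_comp, prod.map_snd]
    simp only [F.map_comp, ← Category.assoc, iso_inv_snd]

/-- The action of the induced functor on morphisms. -/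
def inducedMap (F : C ⥤ D) [PreservesFiniteProducts F] (hF : ∀ U, Φ.mem U → Ψ.mem (F.obj U))
    {X Y : C} (f : Φ.Mor X Y) : Ψ.Mor (F.obj X) (F.obj Y) :=
  Quotient.liftOn f (fun f => homMk (F.obj f.stage) (hF _ f.mem) (mapRep F f.hom))
    (by
      rintro ⟨U, hU, f⟩ ⟨V, hV, g⟩ ⟨W, hW, a, b, h⟩
      refine (homMk_eq_iff _ _ _ _).2 ⟨F.obj W, hF _ hW, F.map a, F.map b, ?_⟩
      dsimp at h ⊢
      rw [map_mapRep, map_mapRep, h])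

/-- The functor `C_Φ ⥤ D_Ψ` induced by a product preserving functor `F : C ⥤ D` which maps
`Φ` to `Ψ`. It sends the class of `f : X ⨯ U ⟶ Y` to the class of
`F X ⨯ F U ≅ F (X ⨯ U) ⟶ F Y`. -/
def induced (F : C ⥤ D) [PreservesFiniteProducts F] (hF : ∀ U, Φ.mem U → Ψ.mem (F.obj U)) :
    Φ.FilterQuotient ⥤ Ψ.FilterQuotient where
  obj X := ⟨F.obj X.as⟩
  map f := inducedMap F hF f
  map_id X := by
    change inducedMap F hF (Φ.morOf (𝟙 X.as)) = Ψ.morOf (𝟙 (F.obj X.as))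
    rw [morOf_eq _ (hF _ Φ.mem_terminal)]
    change homMk _ _ (mapRep F _) = _
    congr 1
    simp [mapRep]
  map_comp {X Y Z} (f : Φ.Mor X.as Y.as) (g : Φ.Mor Y.as Z.as) := by
    obtain ⟨U, hU, f, g, rfl, rfl⟩ := hom_exists_rep₂ f g
    change inducedMap F hF (homComp _ _) = homComp (inducedMap F hF _) (inducedMap F hF _)
    rw [homComp_mk]
    change homMk _ _ (mapRep F _) = homComp (homMk _ _ (mapRep F _)) (homMk _ _ (mapRep F _))
    rw [homComp_mk]
    congr 1
    rw [mapRep, F.map_comp, mapRep.eq_1 F g, ← Category.assoc, ← Category.assoc]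
    congr 1
    apply map_prod_hom_ext F
    · simp only [Category.assoc, iso_inv_fst, ← F.map_comp, Limits.prod.lift_fst, mapRep]
    · simp only [Category.assoc, iso_inv_snd, ← F.map_comp, Limits.prod.lift_snd]

end induced

end SubterminalFilter

/-! ## Propositional coherent theories

A theory is given by its category of contexts `T₀` and its fibration in posets `T₁ ⟶ T₀` of
propositions in context. We present the latter by the functor `P : T₀ᵒᵖ ⥤ PartOrd` of which it is
the Grothendieck construction: `P X` is the fibre over `X`, and `P.map f.op` is the reindexing
(substitution) along `f`, so that a morphism `φ ⟶ ψ` of `T₁` over `f : X ⟶ Y` is an inequality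
`φ ≤ f^* ψ`, and it is cartesian if and only if `φ = f^* ψ`. -/

section Theory

/-- Reindexing of propositions along a morphism of contexts. -/
abbrev reindex {C : Type u₁} [Category.{v₁} C] (P : Cᵒᵖ ⥤ PartOrd.{w}) {X Y : C} (f : X ⟶ Y)
    (φ : P.obj (op Y)) : P.obj (op X) :=
  P.map f.op φ

lemma reindex_comp {C : Type u₁} [Category.{v₁} C] (P : Cᵒᵖ ⥤ PartOrd.{w}) {X Y Z : C}
    (f : X ⟶ Y) (g : Y ⟶ Z) (φ : P.obj (op Z)) :
    reindex P f (reindex P g φ) = reindex P (f ≫ g) φ := by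
  simp [reindex]

lemma reindex_id {C : Type u₁} [Category.{v₁} C] (P : Cᵒᵖ ⥤ PartOrd.{w}) {X : C}
    (φ : P.obj (op X)) : reindex P (𝟙 X) φ = φ := by
  simp [reindex]

lemma reindex_mono {C : Type u₁} [Category.{v₁} C] (P : Cᵒᵖ ⥤ PartOrd.{w}) {X Y : C}
    (f : X ⟶ Y) {φ ψ : P.obj (op Y)} (h : φ ≤ ψ) : reindex P f φ ≤ reindex P f ψ :=
  (P.map f.op).hom.monotone h

/-- The partial order `α` is a bounded distributive lattice. -/
structure IsBoundedDistribLattice (α : Type w) [PartialOrder α] : Prop where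
  exists_top : ∃ t : α, IsTop t
  exists_bot : ∃ b : α, IsBot b
  exists_meet : ∀ a b : α, ∃ m, IsGLB {a, b} m
  exists_join : ∀ a b : α, ∃ j, IsLUB {a, b} j
  distrib : ∀ a b c j m m₁ m₂ : α, IsLUB {b, c} j → IsGLB {a, j} m → IsGLB {a, b} m₁ →
    IsGLB {a, c} m₂ → IsLUB {m₁, m₂} m

/-- The map `f` preserves the order, and finite meets and joins (including the empty ones). -/
structure PreservesFiniteMeetsAndJoins {α : Type u₁} {β : Type u₂} [PartialOrder α]
    [PartialOrder β] (f : α → β) : Prop where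
  monotone : Monotone f
  top : ∀ t, IsTop t → IsTop (f t)
  bot : ∀ b, IsBot b → IsBot (f b)
  meet : ∀ a b m, IsGLB {a, b} m → IsGLB {f a, f b} (f m)
  join : ∀ a b j, IsLUB {a, b} j → IsLUB {f a, f b} (f j)

variable {T₀ : Type u₃} [Category.{v₃} T₀] [HasFiniteProducts T₀] (P : T₀ᵒᵖ ⥤ PartOrd.{w})

/-- The proposition `e` on `X ⨯ X` is the equality predicate of `X`: it is reflexive and satisfies
the substitution rule `s ≡ t, ψ(s) ⊢ ψ(t)` for all propositions `ψ` with parameters. -/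
structure IsEqualityPredicate (X : T₀) (e : P.obj (op (X ⨯ X))) : Prop where
  refl : ∀ {Γ : T₀} (t : Γ ⟶ X), IsTop (reindex P (prod.lift t t) e)
  subst : ∀ {Γ : T₀} (s t : Γ ⟶ X) (ψ : P.obj (op (Γ ⨯ X))) (χ : P.obj (op Γ)),
    χ ≤ reindex P (prod.lift s t) e → χ ≤ reindex P (prod.lift (𝟙 Γ) s) ψ →
      χ ≤ reindex P (prod.lift (𝟙 Γ) t) ψ

/-- `P` is a propositional coherent theory over the category `T₀` with finite products: its fibres
are bounded distributive lattices, whose operations are stable under reindexing, and it has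
equality predicates. -/
structure IsPropositionalCoherentTheory : Prop where
  lattice : ∀ X : T₀, IsBoundedDistribLattice (P.obj (op X))
  reindex : ∀ {X Y : T₀} (f : X ⟶ Y), PreservesFiniteMeetsAndJoins (reindex P f)
  equality : ∀ X : T₀, ∃ e, IsEqualityPredicate P X e

/-- A strict interval in a propositional coherent theory: an object `I` with two points and a
relation `≤` on it, such that the theory proves that `≤` is a total order with bottom `0` and
top `1`, and that `0` and `1` are distinct. The entailments are stated for generalized elements
`x y z : Γ ⟶ I`, and `χ` stands for an arbitrary proposition in the context `Γ`. -/
structure StrictInterval where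
  /-- the interval -/
  I : T₀
  /-- the point `0` -/
  zero : ⊤_ T₀ ⟶ I
  /-- the point `1` -/
  one : ⊤_ T₀ ⟶ I
  /-- the relation `≤` -/
  le : P.obj (op (I ⨯ I))
  /-- the equality predicate of the interval -/
  eq : P.obj (op (I ⨯ I))
  isEqualityPredicate : IsEqualityPredicate P I eq
  refl : ∀ {Γ : T₀} (x : Γ ⟶ I), IsTop (reindex P (prod.lift x x) le)
  trans : ∀ {Γ : T₀} (x y z : Γ ⟶ I) (χ : P.obj (op Γ)), χ ≤ reindex P (prod.lift x y) le →
    χ ≤ reindex P (prod.lift y z) le → χ ≤ reindex P (prod.lift x z) le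
  antisymm : ∀ {Γ : T₀} (x y : Γ ⟶ I) (χ : P.obj (op Γ)), χ ≤ reindex P (prod.lift x y) le →
    χ ≤ reindex P (prod.lift y x) le → χ ≤ reindex P (prod.lift x y) eq
  total : ∀ {Γ : T₀} (x y : Γ ⟶ I) (j : P.obj (op Γ)),
    IsLUB {reindex P (prod.lift x y) le, reindex P (prod.lift y x) le} j → IsTop j
  zero_le : ∀ {Γ : T₀} (x : Γ ⟶ I), IsTop (reindex P (prod.lift (terminal.from Γ ≫ zero) x) le)
  le_one : ∀ {Γ : T₀} (x : Γ ⟶ I), IsTop (reindex P (prod.lift x (terminal.from Γ ≫ one)) le)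
  zero_ne_one : IsBot (reindex P (prod.lift zero one) eq)

/-- The theory `P` has a strict interval. -/
def HasStrictInterval : Prop := Nonempty (StrictInterval P)

end Theory

/-! ## The filter quotient of a theory -/

namespace SubterminalFilter

section Pred

variable {C : Type u₁} [Category.{v₁} C] [HasFiniteProducts C] {Φ : SubterminalFilter C}
  {P : Cᵒᵖ ⥤ PartOrd.{w}}

variable (Φ P) in
/-- A proposition on `X ⨯ U`, for some `U` in the filter; it represents a proposition on `X` in
the filter quotient of the theory. -/
structure PredRep (X : C) where
  /-- the stage at which the representative is defined -/
  stage : C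
  mem : Φ.mem stage
  /-- the representing proposition -/
  pred : P.obj (op (X ⨯ stage))

/-- Representatives are compared after restriction to a smaller stage. -/
instance (X : C) : Preorder (Φ.PredRep P X) where
  le φ ψ := ∃ (W : C) (_ : Φ.mem W) (a : W ⟶ φ.stage) (b : W ⟶ ψ.stage),
    reindex P (prod.map (𝟙 X) a) φ.pred ≤ reindex P (prod.map (𝟙 X) b) ψ.pred
  le_refl φ := ⟨φ.stage, φ.mem, 𝟙 _, 𝟙 _, le_rfl⟩
  le_trans := by
    rintro f g k ⟨W, hW, a, b, h⟩ ⟨W', hW', a', b', h'⟩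
    refine ⟨W ⨯ W', Φ.mem_prod hW hW', prod.fst ≫ a, prod.snd ≫ b', ?_⟩
    have e : (prod.fst ≫ b : W ⨯ W' ⟶ _) = prod.snd ≫ a' := Φ.subterminal _ g.mem _ _
    have h₁ := reindex_mono P (prod.map (𝟙 X) (prod.fst : W ⨯ W' ⟶ W)) h
    have h₂ := reindex_mono P (prod.map (𝟙 X) (prod.snd : W ⨯ W' ⟶ W')) h'
    rw [reindex_comp, reindex_comp, ← map_id_comp, ← map_id_comp] at h₁ h₂
    rw [e] at h₁
    exact h₁.trans h₂

variable (Φ P) in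
/-- The fibre over `X` of the filter quotient of the theory: the filtered colimit of the posets
`P (X ⨯ U)` over the objects `U` of the filter. -/
abbrev Pred (X : C) := Antisymmetrization (Φ.PredRep P X) (· ≤ ·)

/-- The element of the colimit represented by a proposition on `X ⨯ U`. -/
def predMk {X : C} (U : C) (hU : Φ.mem U) (φ : P.obj (op (X ⨯ U))) : Φ.Pred P X :=
  toAntisymmetrization (· ≤ ·) ⟨U, hU, φ⟩

lemma predMk_restrict {X U W : C} (hU : Φ.mem U) (hW : Φ.mem W) (a : W ⟶ U)
    (φ : P.obj (op (X ⨯ U))) :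
    predMk W hW (reindex P (prod.map (𝟙 X) a) φ) = predMk U hU φ := by
  apply Quotient.sound
  refine ⟨⟨W, hW, 𝟙 _, a, ?_⟩, ⟨W, hW, a, 𝟙 _, ?_⟩⟩ <;> simp [reindex_id]

lemma exists_predMk {X : C} (φ : Φ.Pred P X) :
    ∃ (U : C) (hU : Φ.mem U) (φ₀ : P.obj (op (X ⨯ U))), φ = predMk U hU φ₀ := by
  obtain ⟨⟨U, hU, φ₀⟩, rfl⟩ := Quotient.exists_rep φ
  exact ⟨U, hU, φ₀, rfl⟩

/-- Reindexing of a proposition on `Y ⨯ V` along `f : X ⨯ U ⟶ Y`. -/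
def predRepMap {X Y : C} (f : Φ.Rep X Y) (ψ : Φ.PredRep P Y) : Φ.PredRep P X :=
  ⟨f.stage ⨯ ψ.stage, Φ.mem_prod f.mem ψ.mem, reindex P (pairRep ψ.stage f.hom) ψ.pred⟩

lemma predRepMap_le {X Y : C} {f g : Φ.Rep X Y} (h : f.Rel g) {φ ψ : Φ.PredRep P Y}
    (h' : φ ≤ ψ) : predRepMap f φ ≤ predRepMap g ψ := by
  obtain ⟨W, hW, a, b, h⟩ := h
  obtain ⟨W', hW', a', b', h'⟩ := h'
  refine ⟨W ⨯ W', Φ.mem_prod hW hW', prod.map a a', prod.map b b', ?_⟩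
  dsimp only [predRepMap]
  rw [reindex_comp, reindex_comp, map_pairRep, map_pairRep, h, ← reindex_comp, ← reindex_comp]
  exact reindex_mono P _ h'

/-- Reindexing in the filter quotient of the theory. -/
def predMap {X Y : C} (f : Φ.Mor X Y) : Φ.Pred P Y →o Φ.Pred P X :=
  Quotient.liftOn f
    (fun f => OrderHom.antisymmetrization
      ⟨predRepMap f, fun _ _ h => predRepMap_le ((Φ.repSetoid X Y).refl f) h⟩)
    (by
      intro f g h
      ext φ
      obtain ⟨φ, rfl⟩ := Quotient.exists_rep φ
      exact Quotient.sound ⟨predRepMap_le h le_rfl, predRepMap_le ((Φ.repSetoid X Y).symm h) le_rfl⟩)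

lemma predMap_mk {X Y U : C} (hU : Φ.mem U) (f : X ⨯ U ⟶ Y) (φ : P.obj (op (Y ⨯ U))) :
    predMap (homMk U hU f) (predMk U hU φ)
      = predMk U hU (reindex P (prod.lift f prod.snd) φ) := by
  change predMk (U ⨯ U) (Φ.mem_prod hU hU) (reindex P (pairRep U f) φ) = _
  rw [← predMk_restrict (Φ.mem_prod hU hU) hU (diag U), reindex_comp, map_diag_pairRep]

lemma predMap_id {X : C} (φ : Φ.Pred P X) : predMap (Φ.morOf (𝟙 X)) φ = φ := by
  obtain ⟨U, hU, φ, rfl⟩ := exists_predMk φ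
  rw [morOf_eq _ hU, predMap_mk]
  simp [reindex_id]

lemma predMap_comp {X Y Z : C} (f : Φ.Mor X Y) (g : Φ.Mor Y Z) (φ : Φ.Pred P Z) :
    predMap (homComp f g) φ = predMap f (predMap g φ) := by
  obtain ⟨U₁, h₁, f, g, rfl, rfl⟩ := hom_exists_rep₂ f g
  obtain ⟨U₂, h₂, φ, rfl⟩ := exists_predMk φ
  have hU := Φ.mem_prod h₁ h₂
  rw [← homMk_restrict h₁ hU prod.fst, ← homMk_restrict h₁ hU prod.fst,
    ← predMk_restrict h₂ hU prod.snd, homComp_mk, predMap_mk, predMap_mk, predMap_mk,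
    reindex_comp _ (prod.lift _ _) (prod.lift _ _)]
  congr 2
  ext <;> simp

variable (Φ P) in
/-- The filter quotient of the theory `P`. -/
def quotientTheory : (Φ.FilterQuotient)ᵒᵖ ⥤ PartOrd where
  obj X := PartOrd.of (Φ.Pred P X.unop.as)
  map f := PartOrd.ofHom (predMap f.unop)
  map_id X := by
    ext φ
    exact predMap_id (P := P) φ
  map_comp f g := by
    ext φ
    exact predMap_comp (P := P) g.unop f.unop φ

end Pred

/-! ### Models of the filter quotient of a theory -/

section Model

variable {C : Type u₁} [Category.{v₁} C] [HasFiniteProducts C] {Φ : SubterminalFilter C}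
  {P : Cᵒᵖ ⥤ PartOrd.{w}}
  {D : Type u₂} [Category.{v₂} D] [HasFiniteProducts D] {Ψ : SubterminalFilter D}
  (F : C ⥤ D) [PreservesFiniteProducts F] (hF : ∀ U, Φ.mem U → Ψ.mem (F.obj U))

lemma mono_map_fst (hF : ∀ U, Φ.mem U → Ψ.mem (F.obj U)) (X : C) {U : C} (hU : Φ.mem U) :
    Mono (F.map (prod.fst : X ⨯ U ⟶ X)) :=
  ⟨fun _ _ h => map_prod_hom_ext F h (Ψ.subterminal _ (hF U hU) _ _)⟩

/-- The subobject of `F X` in the filter quotient of `D` which is represented by a subobject of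
`F (X ⨯ U)` in `D`; note that `F (X ⨯ U) ⟶ F X` is a monomorphism. -/
def subMk (hF : ∀ U, Φ.mem U → Ψ.mem (F.obj U)) {X U : C} (hU : Φ.mem U)
    (A : Subobject (F.obj (X ⨯ U))) : Subobject (Ψ.proj.obj (F.obj X)) :=
  have := mono_map_fst F hF X hU
  Subobject.mk (Ψ.proj.map (A.arrow ≫ F.map prod.fst))

lemma subMk_mono (hF : ∀ U, Φ.mem U → Ψ.mem (F.obj U)) {X U : C} (hU : Φ.mem U)
    {A B : Subobject (F.obj (X ⨯ U))} (h : A ≤ B) : subMk F hF hU A ≤ subMk F hF hU B := by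
  have := mono_map_fst F hF X hU
  refine Subobject.mk_le_mk_of_comm (Ψ.proj.map (Subobject.ofLE A B h)) ?_
  rw [← Functor.map_comp, ← Category.assoc, Subobject.ofLE_arrow]

lemma subMk_pullback [HasPullbacks D] (hF : ∀ U, Φ.mem U → Ψ.mem (F.obj U)) {X U W : C}
    (hU : Φ.mem U) (hW : Φ.mem W) (a : W ⟶ U) (A : Subobject (F.obj (X ⨯ U))) :
    subMk F hF hW ((Subobject.pullback (F.map (prod.map (𝟙 X) a))).obj A) = subMk F hF hU A := by
  have h₁ := mono_map_fst F hF X hU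
  have h₂ := mono_map_fst F hF X hW
  have sq := Subobject.isPullback (F.map (prod.map (𝟙 X) a)) A
  set A' := (Subobject.pullback (F.map (prod.map (𝟙 X) a))).obj A with hA'
  apply le_antisymm
  · refine Subobject.mk_le_mk_of_comm (Ψ.proj.map (Subobject.pullbackπ _ A)) ?_
    rw [← Functor.map_comp, ← Category.assoc, sq.w, Category.assoc, ← F.map_comp, prod.map_fst,
      Category.comp_id]
  · let k : (A : D) ⨯ F.obj W ⟶ F.obj (X ⨯ W) :=
      prod.map (A.arrow ≫ F.map prod.fst) (𝟙 _) ≫ (PreservesLimitPair.iso F X W).inv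
    have hk : k ≫ F.map prod.fst = prod.fst ≫ A.arrow ≫ F.map prod.fst := by
      simp only [k, Category.assoc, iso_inv_fst, prod.map_fst]
    have w : prod.fst ≫ A.arrow = k ≫ F.map (prod.map (𝟙 X) a) := by
      apply map_prod_hom_ext F
      · rw [Category.assoc, Category.assoc, ← F.map_comp, prod.map_fst, Category.comp_id, hk]
      · exact Ψ.subterminal _ (hF U hU) _ _
    refine Subobject.mk_le_mk_of_comm
      (homMk (Φ := Ψ) (X := (A : D)) (Y := (A' : D)) (F.obj W) (hF W hW) (sq.lift prod.fst k w)) ?_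
    have e : sq.lift prod.fst k w ≫ A'.arrow ≫ F.map prod.fst
        = prod.fst ≫ A.arrow ≫ F.map prod.fst := by
      rw [← Category.assoc, sq.lift_snd, hk]
    exact (homMk_comp_morOf (hF W hW) _ _).trans
      ((congrArg (homMk _ (hF W hW)) e).trans (morOf_eq _ (hF W hW)).symm)

/-- A natural and monotone interpretation `m` of the propositions of the theory `P` as subobjects
in `D` induces an interpretation of the filter quotient of `P` in the filter quotient of `D`:
the class of `φ ∈ P (X ⨯ U)` is interpreted by the class of `m φ ↪ F (X ⨯ U) ↪ F X`. -/
def quotientInterp [HasPullbacks D] (hF : ∀ U, Φ.mem U → Ψ.mem (F.obj U))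
    (m : ∀ X : C, P.obj (op X) → Subobject (F.obj X)) (hm : ∀ X, Monotone (m X))
    (hnat : ∀ {X Y : C} (f : X ⟶ Y) (φ : P.obj (op Y)),
      m X (reindex P f φ) = (Subobject.pullback (F.map f)).obj (m Y φ))
    (X : C) (φ : Φ.Pred P X) : Subobject (Ψ.proj.obj (F.obj X)) :=
  have key : ∀ φ ψ : Φ.PredRep P X, φ ≤ ψ →
      subMk F hF φ.mem (m _ φ.pred) ≤ subMk F hF ψ.mem (m _ ψ.pred) := by
    rintro ⟨U, hU, φ⟩ ⟨V, hV, ψ⟩ ⟨W, hW, a, b, h⟩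
    dsimp only at h ⊢
    rw [← subMk_pullback F hF hU hW a, ← subMk_pullback F hF hV hW b, ← hnat, ← hnat]
    exact subMk_mono F hF hW (hm _ h)
  Quotient.liftOn φ (fun φ => subMk F hF φ.mem (m _ φ.pred))
    (fun φ ψ h => le_antisymm (key φ ψ h.1) (key ψ φ h.2))

end Model

end SubterminalFilter

/-! ## Elementary toposes, coherent categories, model structures -/

/-- An elementary topos: a cartesian closed category with finite limits and a subobject
classifier. -/
class IsElementaryTopos (M : Type u₁) [Category.{v₁} M] : Prop extends HasFiniteLimits M where
  hasSubobjectClassifier : HasSubobjectClassifier M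
  cartesianClosed : ∀ X : M, (prod.functor.obj X).IsLeftAdjoint

/-- A coherent category: a regular category in which subobjects have finite unions (including the
empty one), and these are stable under pullback. -/
class IsCoherentCategory (V : Type u₂) [Category.{v₂} V] : Prop extends Regular V where
  exists_bot : ∀ X : V, ∃ B : Subobject X, IsBot B
  exists_union : ∀ (X : V) (A B : Subobject X), ∃ S, IsLUB {A, B} S
  pullback_bot : ∀ {X Y : V} (f : X ⟶ Y) (B : Subobject Y), IsBot B →
    IsBot ((Subobject.pullback f).obj B)
  pullback_union : ∀ {X Y : V} (f : X ⟶ Y) (A B S : Subobject Y), IsLUB {A, B} S →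
    IsLUB {(Subobject.pullback f).obj A, (Subobject.pullback f).obj B}
      ((Subobject.pullback f).obj S)

/-- The image of a subobject under a functor which preserves monomorphisms. -/
def mapSubobject {V : Type u₂} [Category.{v₂} V] {M : Type u₁} [Category.{v₁} M] (F : V ⥤ M)
    [F.PreservesMonomorphisms] {X : V} (A : Subobject X) : Subobject (F.obj X) :=
  Subobject.mk (F.map A.arrow)

/-- A coherent functor preserves finite limits, regular epimorphisms and finite unions. -/
structure IsCoherentFunctor {V : Type u₂} [Category.{v₂} V] {M : Type u₁} [Category.{v₁} M]
    (F : V ⥤ M) : Prop where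
  preservesFiniteLimits : PreservesFiniteLimits F
  map_regularEpi : ∀ {X Y : V} (f : X ⟶ Y), IsRegularEpi f → IsRegularEpi (F.map f)
  map_bot : ∀ {X : V} (B : Subobject X), IsBot B → IsBot (mapSubobject F B)
  map_union : ∀ {X : V} (A B S : Subobject X), IsLUB {A, B} S →
    IsLUB {mapSubobject F A, mapSubobject F B} (mapSubobject F S)

/-- The triple of classes of fibrations, cofibrations and weak equivalences is a model structure
on a category with finite limits and finite colimits. -/
def IsFinitaryModelStructure {M : Type u₁} [Category.{v₁} M] (fib cof we : MorphismProperty M) :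
    Prop :=
  ∃ _ : HomotopicalAlgebra.ModelCategory M, HomotopicalAlgebra.fibrations M = fib ∧
    HomotopicalAlgebra.cofibrations M = cof ∧ HomotopicalAlgebra.weakEquivalences M = we

/-! ## Finitary model categories with shapes -/

/-- The data underlying a finitary model category with shapes. -/
structure ShapeData (M : Type u₁) [Category.{v₁} M] (V : Type u₂) [Category.{v₂} V]
    (T₀ : Type u₃) [Category.{v₃} T₀] where
  /-- the fibrations of `M` -/
  fib : MorphismProperty M
  /-- the cofibrations of `M` -/
  cof : MorphismProperty M
  /-- the weak equivalences of `M` -/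
  we : MorphismProperty M
  /-- the theory, as a fibration in posets over its category of contexts `T₀` -/
  theory : T₀ᵒᵖ ⥤ PartOrd.{w}
  /-- the interpretation of contexts in `V` -/
  m₀ : T₀ ⥤ V
  /-- the interpretation of propositions as subobjects in `V` -/
  m₁ : ∀ X : T₀, theory.obj (op X) → Subobject (m₀.obj X)
  /-- the functor from `V` to `M` -/
  ω : V ⥤ M

namespace ShapeData

variable {M : Type u₁} [Category.{v₁} M] [HasFiniteProducts M]
  {V : Type u₂} [Category.{v₂} V] [HasFiniteProducts V]
  {T₀ : Type u₃} [Category.{v₃} T₀] [HasFiniteProducts T₀]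

/-- The axioms of a finitary model category with shapes. -/
structure IsFinitaryModelCategoryWithShapes (S : ShapeData.{v₁, v₂, v₃, u₁, u₂, u₃, w} M V T₀) :
    Prop where
  /-- `M` is an elementary topos with a right proper finitary model structure, whose cofibrations
  are monomorphisms -/
  topos : IsElementaryTopos M
  modelStructure : IsFinitaryModelStructure S.fib S.cof S.we
  rightProper : ∀ {X' X Y' Y : M} (g' : X' ⟶ X) (f' : X' ⟶ Y') (f : X ⟶ Y) (g : Y' ⟶ Y),
    IsPullback g' f' f g → S.fib f → S.we g → S.we g'
  cof_mono : ∀ {X Y : M} (f : X ⟶ Y), S.cof f → Mono f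
  /-- a propositional coherent theory, and a model of it in the coherent category `V` -/
  theory : IsPropositionalCoherentTheory S.theory
  coherentCategory : IsCoherentCategory V
  m₀_products : PreservesFiniteProducts S.m₀
  m₁_lattice : ∀ X : T₀, PreservesFiniteMeetsAndJoins (S.m₁ X)
  m₁_reindex : ∀ {X Y : T₀} (f : X ⟶ Y) (φ : S.theory.obj (op Y)),
    S.m₁ X (reindex S.theory f φ) = (Subobject.pullback (S.m₀.map f)).obj (S.m₁ Y φ)
  /-- the functor `ω` is coherent -/
  coherentFunctor : IsCoherentFunctor S.ω
  /-- the product with `ω U` preserves acyclic cofibrations -/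
  acyclic : ∀ (U : V) {X Y : M} (f : X ⟶ Y), S.cof f → S.we f →
    S.cof (prod.map (𝟙 (S.ω.obj U)) f) ∧ S.we (prod.map (𝟙 (S.ω.obj U)) f)

/-- The model interprets the equality predicates as the diagonals. -/
def PreservesEquality (S : ShapeData.{v₁, v₂, v₃, u₁, u₂, u₃, w} M V T₀) : Prop :=
  ∀ (X : T₀) (e : S.theory.obj (op (X ⨯ X))), IsEqualityPredicate S.theory X e →
    S.m₁ (X ⨯ X) e = Subobject.mk (S.m₀.map (diag X))

/-- A model filter for shapes: compatible filters of subterminal objects on `T₀`, `V` and `M`, of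
which the last one is a model filter. -/
structure ModelFilter (S : ShapeData.{v₁, v₂, v₃, u₁, u₂, u₃, w} M V T₀) where
  /-- the filter on `T₀` -/
  ΦT : SubterminalFilter T₀
  /-- the filter on `V` -/
  ΦV : SubterminalFilter V
  /-- the filter on `M` -/
  ΦM : SubterminalFilter M
  fibrant : ∀ U, ΦM.mem U → S.fib (terminal.from U)
  cof_stable : ΦM.ProductStable S.cof
  we_stable : ΦM.ProductStable S.we
  map_m₀ : ∀ U, ΦT.mem U → ΦV.mem (S.m₀.obj U)
  map_ω : ∀ U, ΦV.mem U → ΦM.mem (S.ω.obj U)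

/-- The filter quotient of a finitary model category with shapes. -/
def filterQuotient (S : ShapeData.{v₁, v₂, v₃, u₁, u₂, u₃, w} M V T₀)
    (hS : S.IsFinitaryModelCategoryWithShapes) (Φ : S.ModelFilter) :
    ShapeData Φ.ΦM.FilterQuotient Φ.ΦV.FilterQuotient Φ.ΦT.FilterQuotient :=
  have := hS.coherentCategory
  have := hS.m₀_products
  have := hS.coherentFunctor.preservesFiniteLimits
  { fib := Φ.ΦM.quotientClass S.fib
    cof := Φ.ΦM.quotientClass S.cof
    we := Φ.ΦM.quotientClass S.we
    theory := Φ.ΦT.quotientTheory S.theory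
    m₀ := SubterminalFilter.induced S.m₀ Φ.map_m₀
    m₁ := fun X => SubterminalFilter.quotientInterp S.m₀ Φ.map_m₀ S.m₁
      (fun X => (hS.m₁_lattice X).monotone) hS.m₁_reindex X.as
    ω := SubterminalFilter.induced S.ω Φ.map_ω }

end ShapeData

end

/-!
The filter quotient `C_Φ` is a category of germs. A morphism `f` of `C_Φ` is given by a morphism
`φ : X ⨯ U ⟶ Y ⨯ U` of `C` at some stage `U` of the filter, where the second component is forced
because `U` is subterminal (`stageHom`); two such morphisms are identified if they agree at a
smaller stage, and any finite diagram of `C_Φ` lives, commutativity included, at a common stage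
(`exists_stageHom_square`). Moreover `X ⨯ U ⟶ X` becomes an isomorphism in `C_Φ` (`fstIso`), so that
`f` is isomorphic to the image of `φ` under the projection functor `Φ.proj`. Hence a construction in
`C_Φ` can be carried out in `C` at one stage and then projected, and a property which is stable
under products with the objects of the filter can be checked at one stage.

For a class of morphisms which is stable under products with the objects of the filter, the
two-out-of-three property, stability under retracts, lifting properties and factorizations
therefore pass to the filter quotient. The cofibrations and weak equivalences are stable in this
sense by assumption, and the fibrations because `f ⨯ U` is a base change of `f`. This gives the
model structure (`isFinitaryModelStructure_quotientClass`), its right properness and the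
compatibility with the functor from `V`.

The projection functor preserves finite limits, and finite colimits if `C` is cartesian closed
(`isPullback_proj_map`, `isPushout_proj_map`). For the topos structure, the image of the subobject
classifier classifies monomorphisms, since each of these is monic already at some stage
(`quotientClass_monomorphisms`); uniqueness of the classifying map at some stage is seen by testing
it on the generic subobject. Exponentials are obtained as terminal objects of comma categories.
Every subobject of `X` in `C_Φ` comes from a subobject of `X` in `C`
(`mapSubobject_proj_surjective`), and so images, unions and their stability under pullback descend
to the filter quotient of a coherent category.

On the side of the theory, the fibres of the quotient are filtered colimits of bounded distributive
lattices along lattice homomorphisms (`predOf_preserves`), and an entailment which holds at all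
stages holds in the quotient (`predOf_entails`); the latter gives the equality predicates and the
strict interval. Up to the isomorphism `F (X ⨯ U) ≅ F X` in the quotient, the induced interpretation
of a proposition on `X ⨯ U` is the image of the given one (`pullback_inducedInterp_predOf`), from
which its properties follow.
-/

namespace SubterminalFilter

/-! ### Morphisms of the filter quotient at a stage -/

section Stage

variable {C : Type u₁} [Category.{v₁} C] [HasFiniteProducts C] {Φ : SubterminalFilter C}

/-- Since `U` is subterminal, a morphism into `Y ⨯ U` is determined by its first component. -/
lemma stage_hom_ext {Z Y U : C} (hU : Φ.mem U) {f g : Z ⟶ Y ⨯ U}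
    (h : f ≫ prod.fst = g ≫ prod.fst) : f = g :=
  Limits.prod.hom_ext h (Φ.subterminal U hU _ _)

/-- Every object of the filter quotient is the image of an object of `C`. -/
@[elab_as_elim]
lemma projInduction {p : Φ.FilterQuotient → Prop} (h : ∀ X : C, p (Φ.proj.obj X))
    (X : Φ.FilterQuotient) : p X :=
  h X.as

lemma isIso_proj_map_fst (X : C) {U : C} (hU : Φ.mem U) :
    IsIso (Φ.proj.map (prod.fst : X ⨯ U ⟶ X)) := by
  refine ⟨⟨(homMk U hU (𝟙 (X ⨯ U)) : Φ.Mor X (X ⨯ U)), ?_, ?_⟩⟩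
  · refine (morOf_comp_homMk hU (prod.fst : X ⨯ U ⟶ X) (𝟙 (X ⨯ U))).trans ?_
    refine Eq.trans ?_ (morOf_eq (𝟙 (X ⨯ U)) hU).symm
    exact congrArg _ (stage_hom_ext hU (by simp))
  · refine (homMk_comp_morOf hU (𝟙 (X ⨯ U)) prod.fst).trans ?_
    refine Eq.trans ?_ (morOf_eq (𝟙 X) hU).symm
    rw [Category.id_comp, Category.comp_id]

/-- The isomorphism `X ⨯ U ≅ X` of the filter quotient, for `U` in the filter. -/
noncomputable def fstIso (X : C) {U : C} (hU : Φ.mem U) :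
    Φ.proj.obj (X ⨯ U) ≅ Φ.proj.obj X :=
  have := isIso_proj_map_fst X hU
  asIso (Φ.proj.map (prod.fst : X ⨯ U ⟶ X))

lemma fstIso_hom (X : C) {U : C} (hU : Φ.mem U) :
    (fstIso X hU).hom = Φ.proj.map prod.fst := rfl

/-- The morphism of the filter quotient given by a morphism `X ⨯ U ⟶ Y ⨯ U` of `C`. As `U` is
subterminal, this is the same thing as a representative `X ⨯ U ⟶ Y`, but it has the advantage
that composition at the stage `U` is composition in `C`. -/
noncomputable def stageHom {X Y U : C} (hU : Φ.mem U) (φ : X ⨯ U ⟶ Y ⨯ U) :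
    Φ.proj.obj X ⟶ Φ.proj.obj Y :=
  (homMk U hU (φ ≫ prod.fst) : Φ.Mor X Y)

/-- The restriction of a morphism at the stage `U` to a smaller stage `W`. -/
noncomputable def restrict {X Y U W : C} (a : W ⟶ U) (φ : X ⨯ U ⟶ Y ⨯ U) : X ⨯ W ⟶ Y ⨯ W :=
  prod.lift (prod.map (𝟙 X) a ≫ φ ≫ prod.fst) prod.snd

lemma restrict_fst {X Y U W : C} (a : W ⟶ U) (φ : X ⨯ U ⟶ Y ⨯ U) :
    restrict a φ ≫ prod.fst = prod.map (𝟙 X) a ≫ φ ≫ prod.fst := by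
  simp [restrict]

lemma restrict_map {X Y U W : C} (hU : Φ.mem U) (a : W ⟶ U) (φ : X ⨯ U ⟶ Y ⨯ U) :
    restrict a φ ≫ prod.map (𝟙 Y) a = prod.map (𝟙 X) a ≫ φ :=
  stage_hom_ext hU (by simp [restrict_fst])

lemma restrict_id {X U W : C} (a : W ⟶ U) : restrict a (𝟙 (X ⨯ U)) = 𝟙 (X ⨯ W) := by
  ext <;> simp [restrict]

lemma restrict_comp {X Y Z U W : C} (hU : Φ.mem U) (a : W ⟶ U) (φ : X ⨯ U ⟶ Y ⨯ U)
    (ψ : Y ⨯ U ⟶ Z ⨯ U) : restrict a (φ ≫ ψ) = restrict a φ ≫ restrict a ψ := by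
  apply Limits.prod.hom_ext
  · rw [restrict_fst, Category.assoc, Category.assoc, restrict_fst, ← Category.assoc (restrict a φ),
      restrict_map hU, Category.assoc]
  · simp [restrict]

lemma restrict_restrict {X Y U V W : C} (b : W ⟶ V) (a : V ⟶ U) (φ : X ⨯ U ⟶ Y ⨯ U) :
    restrict b (restrict a φ) = restrict (b ≫ a) φ := by
  simp [restrict]

lemma stageHom_restrict {X Y U W : C} (hU : Φ.mem U) (hW : Φ.mem W) (a : W ⟶ U)
    (φ : X ⨯ U ⟶ Y ⨯ U) : stageHom hW (restrict a φ) = stageHom hU φ := by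
  rw [stageHom, restrict_fst]
  exact homMk_restrict hU hW a _

lemma stageHom_id {X U : C} (hU : Φ.mem U) : stageHom hU (𝟙 (X ⨯ U)) = 𝟙 (Φ.proj.obj X) := by
  refine Eq.trans ?_ (morOf_eq (𝟙 X) hU).symm
  exact congrArg (homMk U hU) (by simp)

lemma stageHom_comp {X Y Z U : C} (hU : Φ.mem U) (φ : X ⨯ U ⟶ Y ⨯ U) (ψ : Y ⨯ U ⟶ Z ⨯ U) :
    stageHom hU (φ ≫ ψ) = stageHom hU φ ≫ stageHom hU ψ := by
  refine Eq.trans ?_ (homComp_mk hU (φ ≫ prod.fst) (ψ ≫ prod.fst)).symm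
  have : prod.lift (φ ≫ prod.fst) prod.snd = φ := stage_hom_ext hU (by simp)
  rw [this, stageHom, Category.assoc]

lemma exists_stageHom {X Y : C} (f : Φ.proj.obj X ⟶ Φ.proj.obj Y) :
    ∃ (U : C) (hU : Φ.mem U) (φ : X ⨯ U ⟶ Y ⨯ U), f = stageHom hU φ := by
  obtain ⟨U, hU, f₀, rfl⟩ := hom_exists_rep (X := X) (Y := Y) f
  exact ⟨U, hU, prod.lift f₀ prod.snd, congrArg (homMk U hU) (by simp)⟩

lemma exists_stageHom₂ {X Y X' Y' : C} (f : Φ.proj.obj X ⟶ Φ.proj.obj Y)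
    (g : Φ.proj.obj X' ⟶ Φ.proj.obj Y') :
    ∃ (U : C) (hU : Φ.mem U) (φ : X ⨯ U ⟶ Y ⨯ U) (ψ : X' ⨯ U ⟶ Y' ⨯ U),
      f = stageHom hU φ ∧ g = stageHom hU ψ := by
  obtain ⟨U, hU, φ, rfl⟩ := exists_stageHom f
  obtain ⟨V, hV, ψ, rfl⟩ := exists_stageHom g
  exact ⟨U ⨯ V, Φ.mem_prod hU hV, restrict prod.fst φ, restrict prod.snd ψ,
    (stageHom_restrict hU _ _ _).symm, (stageHom_restrict hV _ _ _).symm⟩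

lemma stageHom_eq_iff {X Y U : C} (hU : Φ.mem U) (φ ψ : X ⨯ U ⟶ Y ⨯ U) :
    stageHom hU φ = stageHom hU ψ ↔
      ∃ (W : C) (_ : Φ.mem W) (a : W ⟶ U), restrict a φ = restrict a ψ := by
  refine (homMk_eq_iff_same hU _ _).trans ⟨?_, ?_⟩
  · rintro ⟨W, hW, a, h⟩
    exact ⟨W, hW, a, by rw [restrict, restrict, h]⟩
  · rintro ⟨W, hW, a, h⟩
    refine ⟨W, hW, a, ?_⟩
    rw [← restrict_fst, ← restrict_fst, h]

lemma proj_map_eq_stageHom {X Y U : C} (hU : Φ.mem U) (f : X ⟶ Y) :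
    Φ.proj.map f = stageHom hU (prod.map f (𝟙 U)) := by
  refine (morOf_eq f hU).trans ?_
  simp [stageHom]

lemma fst_comp_stageHom {X Y U : C} (hU : Φ.mem U) (φ : X ⨯ U ⟶ Y ⨯ U) :
    Φ.proj.map prod.fst ≫ stageHom hU φ = Φ.proj.map φ ≫ Φ.proj.map prod.fst := by
  refine (morOf_comp_homMk hU (prod.fst : X ⨯ U ⟶ X) (φ ≫ prod.fst)).trans ?_
  rw [← Functor.map_comp]
  refine Eq.trans ?_ (morOf_eq (φ ≫ prod.fst) hU).symm
  have : prod.map prod.fst (𝟙 U) = (prod.fst : (X ⨯ U) ⨯ U ⟶ X ⨯ U) := stage_hom_ext hU (by simp)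
  rw [this]

lemma stageHom_eq {X Y U : C} (hU : Φ.mem U) (φ : X ⨯ U ⟶ Y ⨯ U) :
    stageHom hU φ = (fstIso X hU).inv ≫ Φ.proj.map φ ≫ (fstIso Y hU).hom := by
  rw [Iso.eq_inv_comp]
  exact fst_comp_stageHom hU φ

/-- A commutative square of the filter quotient, two opposite sides of which are represented at
some stage, is represented by a commutative square at a smaller stage. -/
lemma exists_stageHom_square {X Y Z T : C} {U : C} (hU : Φ.mem U) (φ : X ⨯ U ⟶ Y ⨯ U)
    (ψ : Z ⨯ U ⟶ T ⨯ U) {l : Φ.proj.obj X ⟶ Φ.proj.obj Z} {r : Φ.proj.obj Y ⟶ Φ.proj.obj T}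
    (h : stageHom hU φ ≫ r = l ≫ stageHom hU ψ) :
    ∃ (W : C) (hW : Φ.mem W) (a : W ⟶ U) (l' : X ⨯ W ⟶ Z ⨯ W) (r' : Y ⨯ W ⟶ T ⨯ W),
      l = stageHom hW l' ∧ r = stageHom hW r' ∧ restrict a φ ≫ r' = l' ≫ restrict a ψ := by
  obtain ⟨V, hV, l', r', hl, hr⟩ := exists_stageHom₂ l r
  have hUV := Φ.mem_prod hU hV
  rw [hl, hr, ← stageHom_restrict hU hUV prod.fst, ← stageHom_restrict hU hUV prod.fst,
    ← stageHom_restrict hV hUV prod.snd, ← stageHom_restrict hV hUV prod.snd, ← stageHom_comp,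
    ← stageHom_comp, stageHom_eq_iff] at h
  obtain ⟨W, hW, a, h⟩ := h
  rw [restrict_comp hUV, restrict_comp hUV] at h
  rw [restrict_restrict a prod.fst φ, restrict_restrict a prod.fst ψ] at h
  refine ⟨W, hW, a ≫ prod.fst, restrict a (restrict prod.snd l'), restrict a (restrict prod.snd r'),
    ?_, ?_, h⟩
  · rw [stageHom_restrict hUV, stageHom_restrict hV, hl]
  · rw [stageHom_restrict hUV, stageHom_restrict hV, hr]

end Stage

/-! ### Classes of morphisms in the filter quotient -/

section Classes

variable {C : Type u₁} [Category.{v₁} C] [HasFiniteProducts C] {Φ : SubterminalFilter C}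
  {S : MorphismProperty C}

lemma quotientClass_iff {X Y : C} (f : Φ.proj.obj X ⟶ Φ.proj.obj Y) :
    Φ.quotientClass S f ↔ ∃ (U : C) (hU : Φ.mem U) (φ : X ⨯ U ⟶ Y ⨯ U),
      f = stageHom hU φ ∧ S φ := by
  constructor
  · rintro ⟨U, hU, (f₀ : X ⨯ U ⟶ Y), rfl, h⟩
    exact ⟨U, hU, prod.lift f₀ prod.snd, congrArg (homMk U hU) (prod.lift_fst _ _).symm, h⟩
  · rintro ⟨U, hU, φ, rfl, h⟩
    have : prod.lift (φ ≫ prod.fst) prod.snd = φ := stage_hom_ext hU (by simp)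
    exact ⟨U, hU, φ ≫ prod.fst, rfl, this.symm ▸ h⟩

lemma quotientClass_stageHom {X Y U : C} (hU : Φ.mem U) {φ : X ⨯ U ⟶ Y ⨯ U} (h : S φ) :
    Φ.quotientClass S (stageHom hU φ) :=
  (quotientClass_iff _).2 ⟨U, hU, φ, rfl, h⟩

lemma quotientClass_mono {S T : MorphismProperty C} (h : S ≤ T) :
    Φ.quotientClass S ≤ Φ.quotientClass T := by
  rintro X Y f ⟨U, hU, f₀, rfl, hf⟩
  exact ⟨U, hU, f₀, rfl, h _ hf⟩

lemma ProductStable.proj_map (hS : Φ.ProductStable S) {X Y : C} {f : X ⟶ Y} (hf : S f) :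
    Φ.quotientClass S (Φ.proj.map f) := by
  rw [proj_map_eq_stageHom Φ.mem_terminal]
  exact quotientClass_stageHom _ (hS _ Φ.mem_terminal _ hf)

/-- A product-stable class is stable under restriction to a smaller stage, because the restriction
of `φ` to `W` is isomorphic to the product of `φ` and `W`. -/
lemma ProductStable.restrict [S.RespectsIso] (hS : Φ.ProductStable S) {X Y U W : C}
    (hU : Φ.mem U) (hW : Φ.mem W) (a : W ⟶ U) {φ : X ⨯ U ⟶ Y ⨯ U} (hφ : S φ) :
    S (restrict a φ) := by
  let e (Z : C) : Z ⨯ W ≅ (Z ⨯ U) ⨯ W :=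
    { hom := prod.lift (prod.map (𝟙 Z) a) prod.snd
      inv := prod.map prod.fst (𝟙 W)
      hom_inv_id := by ext <;> simp
      inv_hom_id := stage_hom_ext hW (stage_hom_ext hU (by simp)) }
  refine (MorphismProperty.arrow_mk_iso_iff S (Arrow.isoMk
    (f := Arrow.mk (SubterminalFilter.restrict a φ)) (g := Arrow.mk (prod.map φ (𝟙 W)))
    (e X) (e Y) ?_)).2 (hS W hW φ hφ)
  refine stage_hom_ext hW ?_
  have := restrict_map hU a φ
  simp [e, this]

variable [S.RespectsIso]

/-- A morphism of `S_Φ` is represented by a morphism of `S` below every stage at which it is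
represented. -/
lemma ProductStable.exists_restrict (hS : Φ.ProductStable S) {X Y U : C} (hU : Φ.mem U)
    {φ : X ⨯ U ⟶ Y ⨯ U} (h : Φ.quotientClass S (stageHom hU φ)) :
    ∃ (W : C) (_ : Φ.mem W) (a : W ⟶ U), S (SubterminalFilter.restrict a φ) := by
  obtain ⟨V, hV, ψ, e, hψ⟩ := (quotientClass_iff _).1 h
  have hUV := Φ.mem_prod hU hV
  rw [← stageHom_restrict hU hUV prod.fst, ← stageHom_restrict hV hUV prod.snd,
    stageHom_eq_iff] at e
  obtain ⟨W, hW, a, e⟩ := e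
  refine ⟨W, hW, a ≫ prod.fst, ?_⟩
  have := hS.restrict hUV hW a (hS.restrict hV hUV prod.snd hψ)
  rw [← e] at this
  convert this using 1
  simp [SubterminalFilter.restrict]

lemma ProductStable.exists_stageHom_le (hS : Φ.ProductStable S) {X Y : C}
    {f : Φ.proj.obj X ⟶ Φ.proj.obj Y} (hf : Φ.quotientClass S f) {U : C} (hU : Φ.mem U) :
    ∃ (W : C) (hW : Φ.mem W) (_ : W ⟶ U) (φ : X ⨯ W ⟶ Y ⨯ W), f = stageHom hW φ ∧ S φ := by
  obtain ⟨V, hV, φ, rfl, hφ⟩ := (quotientClass_iff _).1 hf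
  have hUV := Φ.mem_prod hU hV
  exact ⟨U ⨯ V, hUV, prod.fst, SubterminalFilter.restrict prod.snd φ,
    (stageHom_restrict hV _ _ _).symm, hS.restrict hV hUV _ hφ⟩

lemma quotientClass_exists₂ {T : MorphismProperty C} [T.RespectsIso] (hS : Φ.ProductStable S)
    (hT : Φ.ProductStable T) {X Y X' Y' : C} {f : Φ.proj.obj X ⟶ Φ.proj.obj Y}
    {g : Φ.proj.obj X' ⟶ Φ.proj.obj Y'}
    (hf : Φ.quotientClass S f) (hg : Φ.quotientClass T g) :
    ∃ (U : C) (hU : Φ.mem U) (φ : X ⨯ U ⟶ Y ⨯ U) (ψ : X' ⨯ U ⟶ Y' ⨯ U),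
      f = stageHom hU φ ∧ g = stageHom hU ψ ∧ S φ ∧ T ψ := by
  obtain ⟨U, hU, φ, rfl, hφ⟩ := (quotientClass_iff _).1 hf
  obtain ⟨W, hW, a, ψ, rfl, hψ⟩ := hT.exists_stageHom_le hg hU
  exact ⟨W, hW, SubterminalFilter.restrict a φ, ψ, (stageHom_restrict hU _ _ _).symm, rfl,
    hS.restrict hU hW _ hφ, hψ⟩

lemma quotientClass_inf {T : MorphismProperty C} [T.RespectsIso] (hS : Φ.ProductStable S)
    (hT : Φ.ProductStable T) :
    Φ.quotientClass (S ⊓ T) = Φ.quotientClass S ⊓ Φ.quotientClass T := by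
  refine le_antisymm (le_inf (quotientClass_mono inf_le_left) (quotientClass_mono inf_le_right)) ?_
  intro X Y f h
  induction X using projInduction with | h X
  induction Y using projInduction with | h Y
  obtain ⟨h₁, h₂⟩ := h
  obtain ⟨U, hU, φ, rfl, hφ⟩ := (quotientClass_iff _).1 h₁
  obtain ⟨W, hW, a, hψ⟩ := hT.exists_restrict hU h₂
  rw [← stageHom_restrict hU hW a]
  exact quotientClass_stageHom _ ⟨hS.restrict hU hW a hφ, hψ⟩

lemma ProductStable.inf {T : MorphismProperty C} (hS : Φ.ProductStable S)
    (hT : Φ.ProductStable T) : Φ.ProductStable (S ⊓ T) :=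
  fun U hU _ _ f hf => ⟨hS U hU f hf.1, hT U hU f hf.2⟩

lemma quotientClass_isStableUnderRetracts {S : MorphismProperty C} [S.IsStableUnderRetracts]
    (hS : Φ.ProductStable S) : (Φ.quotientClass S).IsStableUnderRetracts where
  of_retract {X Y Z T f g} h hg := by
    induction X using projInduction with | h X
    induction Y using projInduction with | h Y
    induction Z using projInduction with | h Z
    induction T using projInduction with | h T
    obtain ⟨U, hU, φ, ψ, rfl, rfl⟩ := exists_stageHom₂ f g
    obtain ⟨W₁, h₁, a₁, hg⟩ := hS.exists_restrict hU hg
    rw [← stageHom_restrict hU h₁ a₁, ← stageHom_restrict hU h₁ a₁] at h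
    rw [← stageHom_restrict hU h₁ a₁]
    generalize SubterminalFilter.restrict a₁ φ = φ, SubterminalFilter.restrict a₁ ψ = ψ at h hg ⊢
    -- Both commutative squares of the retract, and then both of its equations, hold at some stage.
    obtain ⟨W₂, h₂, a₂, il, ir, hil, hir, ei⟩ := exists_stageHom_square h₁ φ ψ (l := h.i.left)
      (r := h.i.right) h.i.w.symm
    obtain ⟨W₃, h₃, a₃, rl, rr, hrl, hrr, er⟩ := exists_stageHom_square h₂
      (SubterminalFilter.restrict a₂ ψ) (SubterminalFilter.restrict a₂ φ) (l := h.r.left)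
      (r := h.r.right) (by rw [stageHom_restrict h₁, stageHom_restrict h₁]; exact h.r.w.symm)
    rw [← stageHom_restrict h₂ h₃ a₃] at hil hir
    have el : stageHom h₃ (SubterminalFilter.restrict a₃ il ≫ rl) = stageHom h₃ (𝟙 _) := by
      rw [stageHom_comp, ← hil, ← hrl, stageHom_id]
      exact congrArg CommaMorphism.left h.retract
    have er' : stageHom h₃ (SubterminalFilter.restrict a₃ ir ≫ rr) = stageHom h₃ (𝟙 _) := by
      rw [stageHom_comp, ← hir, ← hrr, stageHom_id]
      exact congrArg CommaMorphism.right h.retract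
    obtain ⟨W₄, h₄, a₄, el⟩ := (stageHom_eq_iff _ _ _).1 el
    obtain ⟨W₅, h₅, a₅, er'⟩ := (stageHom_eq_iff _ _ _).1 er'
    have h₆ := Φ.mem_prod h₄ h₅
    have e₆ : (prod.snd ≫ a₅ : W₄ ⨯ W₅ ⟶ W₃) = prod.fst ≫ a₄ := Φ.subterminal _ h₃ _ _
    replace el := congrArg (SubterminalFilter.restrict (prod.fst : W₄ ⨯ W₅ ⟶ _)) el
    replace er' := congrArg (SubterminalFilter.restrict (prod.snd : W₄ ⨯ W₅ ⟶ _)) er'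
    rw [restrict_restrict, restrict_restrict] at el er'
    rw [e₆] at er'
    generalize (prod.fst ≫ a₄ : W₄ ⨯ W₅ ⟶ W₃) = a₆ at el er'
    replace ei := congrArg (SubterminalFilter.restrict (a₆ ≫ a₃)) ei
    replace er := congrArg (SubterminalFilter.restrict a₆) er
    simp only [restrict_comp h₂, restrict_comp h₃, restrict_restrict, restrict_id] at el er' ei er
    simp only [Category.assoc] at el er' ei er
    rw [← stageHom_restrict h₁ h₆ (a₆ ≫ a₃ ≫ a₂)]
    refine quotientClass_stageHom h₆ (MorphismProperty.of_retract (P := S)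
      { i := Arrow.homMk _ _ ei.symm
        r := Arrow.homMk _ _ er.symm
        retract := ?_ } (hS.restrict h₁ h₆ (a₆ ≫ a₃ ≫ a₂) hg))
    ext
    · exact el
    · exact er'

/-- A retract-stable class gives rise to a class which is stable under isomorphisms. -/
lemma quotientClass_respectsIso {S : MorphismProperty C} [S.IsStableUnderRetracts]
    (hS : Φ.ProductStable S) : (Φ.quotientClass S).RespectsIso :=
  have := quotientClass_isStableUnderRetracts hS
  inferInstance

lemma quotientClass_hasTwoOutOfThreeProperty {S : MorphismProperty C} [S.RespectsIso]
    [S.HasTwoOutOfThreeProperty] (hS : Φ.ProductStable S) :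
    (Φ.quotientClass S).HasTwoOutOfThreeProperty where
  comp_mem {X Y Z} f g hf hg := by
    induction X using projInduction with | h X
    induction Y using projInduction with | h Y
    induction Z using projInduction with | h Z
    obtain ⟨U, hU, φ, ψ, rfl, rfl, hφ, hψ⟩ := quotientClass_exists₂ hS hS hf hg
    rw [← stageHom_comp]
    exact quotientClass_stageHom hU (S.comp_mem _ _ hφ hψ)
  of_postcomp {X Y Z} f g hg hfg := by
    induction X using projInduction with | h X
    induction Y using projInduction with | h Y
    induction Z using projInduction with | h Z
    obtain ⟨V, hV, φ, rfl⟩ := exists_stageHom f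
    obtain ⟨U, hU, a, ψ, rfl, hψ⟩ := hS.exists_stageHom_le hg hV
    rw [← stageHom_restrict hV hU a, ← stageHom_comp] at hfg
    rw [← stageHom_restrict hV hU a]
    obtain ⟨W, hW, b, h⟩ := hS.exists_restrict hU hfg
    rw [restrict_comp hU] at h
    rw [← stageHom_restrict hU hW b]
    exact quotientClass_stageHom hW (S.of_postcomp _ _ (hS.restrict hU hW b hψ) h)
  of_precomp {X Y Z} f g hf hfg := by
    induction X using projInduction with | h X
    induction Y using projInduction with | h Y
    induction Z using projInduction with | h Z
    obtain ⟨V, hV, ψ, rfl⟩ := exists_stageHom g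
    obtain ⟨U, hU, a, φ, rfl, hφ⟩ := hS.exists_stageHom_le hf hV
    rw [← stageHom_restrict hV hU a, ← stageHom_comp] at hfg
    rw [← stageHom_restrict hV hU a]
    obtain ⟨W, hW, b, h⟩ := hS.exists_restrict hU hfg
    rw [restrict_comp hU] at h
    rw [← stageHom_restrict hU hW b]
    exact quotientClass_stageHom hW (S.of_precomp _ _ (hS.restrict hU hW b hφ) h)

/-- Lifting properties pass to the filter quotient, because a lifting problem and its two
sides live at a common stage. -/
lemma quotientClass_hasLiftingProperty {S T : MorphismProperty C} [S.RespectsIso] [T.RespectsIso]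
    (hS : Φ.ProductStable S) (hT : Φ.ProductStable T)
    (hST : ∀ {A B X Y : C} (i : A ⟶ B) (p : X ⟶ Y), S i → T p → HasLiftingProperty i p)
    {A B X Y : Φ.FilterQuotient} (i : A ⟶ B) (p : X ⟶ Y) (hi : Φ.quotientClass S i)
    (hp : Φ.quotientClass T p) : HasLiftingProperty i p where
  sq_hasLift {f g} sq := by
    induction A using projInduction with | h A
    induction B using projInduction with | h B
    induction X using projInduction with | h X
    induction Y using projInduction with | h Y
    obtain ⟨U, hU, φ, ψ, rfl, rfl, hφ, hψ⟩ := quotientClass_exists₂ hS hT hi hp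
    obtain ⟨W, hW, a, f', g', rfl, rfl, e⟩ := exists_stageHom_square hU φ ψ sq.w.symm
    have := hST _ _ (hS.restrict hU hW a hφ) (hT.restrict hU hW a hψ)
    have sq' : CommSq f' (SubterminalFilter.restrict a φ) (SubterminalFilter.restrict a ψ) g' :=
      ⟨e.symm⟩
    refine ⟨⟨⟨stageHom hW sq'.lift, ?_, ?_⟩⟩⟩
    · rw [← stageHom_restrict hU hW a, ← stageHom_comp, sq'.fac_left]
    · rw [← stageHom_restrict hU hW a, ← stageHom_comp, sq'.fac_right]

/-- Factorizations pass to the filter quotient: a morphism is factored at a stage at which it is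
represented, and the factorization is projected. -/
lemma quotientClass_hasFactorization {S T : MorphismProperty C} [S.IsStableUnderRetracts]
    [T.IsStableUnderRetracts] [S.HasFactorization T] (hS : Φ.ProductStable S)
    (hT : Φ.ProductStable T) :
    (Φ.quotientClass S).HasFactorization (Φ.quotientClass T) where
  nonempty_mapFactorizationData {X Y} f := by
    induction X using projInduction with | h X
    induction Y using projInduction with | h Y
    obtain ⟨U, hU, φ, rfl⟩ := exists_stageHom f
    have := quotientClass_respectsIso hS
    have := quotientClass_respectsIso hT
    obtain ⟨F⟩ := MorphismProperty.HasFactorization.nonempty_mapFactorizationData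
      (W₁ := S) (W₂ := T) φ
    exact ⟨{
      Z := Φ.proj.obj F.Z
      i := (fstIso X hU).inv ≫ Φ.proj.map F.i
      p := Φ.proj.map F.p ≫ (fstIso Y hU).hom
      fac := by
        rw [stageHom_eq, Category.assoc, ← Φ.proj.map_comp_assoc, F.fac]
      hi := (MorphismProperty.cancel_left_of_respectsIso _ _ _).2 (hS.proj_map F.hi)
      hp := (MorphismProperty.cancel_right_of_respectsIso _ _ _).2 (hT.proj_map F.hp) }⟩

end Classes

end SubterminalFilter

/-! ### Recognizing functors which preserve finite limits -/

section

variable {C : Type u₁} [Category.{v₁} C] {D : Type u₂} [Category.{v₂} D]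

/-- A functor preserves pullbacks if it preserves some pullback square on each cospan. -/
lemma preservesLimitsOfShape_walkingCospan_of_isPullback (F : C ⥤ D)
    (h : ∀ {X Y Z : C} (f : X ⟶ Z) (g : Y ⟶ Z), ∃ (P : C) (p : P ⟶ X) (q : P ⟶ Y),
      IsPullback p q f g ∧ IsPullback (F.map p) (F.map q) (F.map f) (F.map g)) :
    PreservesLimitsOfShape WalkingCospan F where
  preservesLimit {K} := by
    obtain ⟨P, p, q, sq, sq'⟩ := h (K.map WalkingCospan.Hom.inl) (K.map WalkingCospan.Hom.inr)
    have := preservesLimit_of_preserves_limit_cone sq.isLimit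
      ((isLimitMapConePullbackConeEquiv F sq.w).symm sq'.isLimit)
    exact preservesLimit_of_iso_diagram _ (diagramIsoCospan K).symm

/-- A functor preserves finite products if it preserves some terminal object and some product of
every two objects. -/
lemma preservesFiniteProducts_of_isLimit [HasFiniteProducts C] (F : C ⥤ D) {T : C}
    (hT : IsTerminal T) (hT' : IsTerminal (F.obj T))
    (h : ∀ X Y : C, ∃ (P : C) (p : P ⟶ X) (q : P ⟶ Y), Nonempty (IsLimit (BinaryFan.mk p q)) ∧
      Nonempty (IsLimit (BinaryFan.mk (F.map p) (F.map q)))) :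
    PreservesFiniteProducts F := by
  have : PreservesLimit (Functor.empty.{0} C) F :=
    preservesLimit_of_preserves_limit_cone hT ((isLimitMapConeEmptyConeEquiv _ _).symm hT')
  have := preservesLimitsOfShape_pempty_of_preservesTerminal F
  have (X Y : C) : PreservesLimit (pair X Y) F := by
    obtain ⟨P, p, q, ⟨h₁⟩, ⟨h₂⟩⟩ := h X Y
    exact preservesLimit_of_preserves_limit_cone h₁ ((isLimitMapConeBinaryFanEquiv _ _ _).symm h₂)
  have : PreservesLimitsOfShape (Discrete WalkingPair) F :=
    ⟨fun {K} => preservesLimit_of_iso_diagram _ (diagramIsoPair K).symm⟩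
  exact .of_preserves_binary_and_terminal _

end

namespace SubterminalFilter

/-! ### Finite limits in the filter quotient -/

section Limits

variable {C : Type u₁} [Category.{v₁} C] [HasFiniteProducts C] {Φ : SubterminalFilter C}

/-- The morphism of the filter quotient represented by `f : X ⨯ U ⟶ Y`, as a morphism between
objects in the image of the projection functor. -/
noncomputable def repHom {X Y U : C} (hU : Φ.mem U) (f : X ⨯ U ⟶ Y) :
    Φ.proj.obj X ⟶ Φ.proj.obj Y :=
  (homMk U hU f : Φ.Mor X Y)

lemma exists_repHom {X Y : C} (f : Φ.proj.obj X ⟶ Φ.proj.obj Y) :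
    ∃ (U : C) (hU : Φ.mem U) (f₀ : X ⨯ U ⟶ Y), f = repHom hU f₀ :=
  hom_exists_rep (X := X) (Y := Y) f

lemma exists_repHom₂ {X Y X' Y' : C} (f : Φ.proj.obj X ⟶ Φ.proj.obj Y)
    (g : Φ.proj.obj X' ⟶ Φ.proj.obj Y') :
    ∃ (U : C) (hU : Φ.mem U) (f₀ : X ⨯ U ⟶ Y) (g₀ : X' ⨯ U ⟶ Y'),
      f = repHom hU f₀ ∧ g = repHom hU g₀ :=
  hom_exists_rep₂ (X := X) (Y := Y) (X' := X') (Y' := Y') f g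

lemma repHom_restrict {X Y U W : C} (hU : Φ.mem U) (hW : Φ.mem W) (a : W ⟶ U) (f : X ⨯ U ⟶ Y) :
    repHom hW (prod.map (𝟙 X) a ≫ f) = repHom hU f :=
  homMk_restrict hU hW a f

lemma repHom_eq_iff {X Y U : C} (hU : Φ.mem U) (f g : X ⨯ U ⟶ Y) :
    repHom hU f = repHom hU g ↔
      ∃ (W : C) (_ : Φ.mem W) (a : W ⟶ U), prod.map (𝟙 X) a ≫ f = prod.map (𝟙 X) a ≫ g :=
  homMk_eq_iff_same hU f g

lemma repHom_comp_map {X Y Z U : C} (hU : Φ.mem U) (f : X ⨯ U ⟶ Y) (g : Y ⟶ Z) :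
    repHom hU f ≫ Φ.proj.map g = repHom hU (f ≫ g) :=
  homMk_comp_morOf hU f g

lemma map_comp_repHom {X Y Z U : C} (hU : Φ.mem U) (f : X ⟶ Y) (g : Y ⨯ U ⟶ Z) :
    Φ.proj.map f ≫ repHom hU g = repHom hU (prod.map f (𝟙 U) ≫ g) :=
  morOf_comp_homMk hU f g

lemma map_eq_repHom {X Y U : C} (hU : Φ.mem U) (f : X ⟶ Y) :
    Φ.proj.map f = repHom hU (prod.fst ≫ f) :=
  morOf_eq f hU

lemma repHom_eq {X Y U : C} (hU : Φ.mem U) (f : X ⨯ U ⟶ Y) :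
    repHom hU f = (fstIso X hU).inv ≫ Φ.proj.map f := by
  rw [Iso.eq_inv_comp, fstIso_hom, map_comp_repHom, map_eq_repHom hU]
  have : prod.map prod.fst (𝟙 U) = (prod.fst : (X ⨯ U) ⨯ U ⟶ X ⨯ U) := stage_hom_ext hU (by simp)
  rw [this]

/-- Up to an isomorphism of its source, every morphism of the filter quotient is in the image of
the projection functor. -/
lemma exists_eq_inv_fstIso_comp {X Y : C} (f : Φ.proj.obj X ⟶ Φ.proj.obj Y) :
    ∃ (U : C) (hU : Φ.mem U) (f₀ : X ⨯ U ⟶ Y), f = (fstIso X hU).inv ≫ Φ.proj.map f₀ := by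
  obtain ⟨U, hU, f₀, rfl⟩ := exists_repHom f
  exact ⟨U, hU, f₀, repHom_eq hU f₀⟩

/-- A jointly monic pair of morphisms remains jointly monic in the filter quotient. -/
lemma proj_map_joint_mono {P X Y : C} (p : P ⟶ X) (q : P ⟶ Y)
    (h : ∀ {T : C} (l m : T ⟶ P), l ≫ p = m ≫ p → l ≫ q = m ≫ q → l = m)
    {T : C} (l m : Φ.proj.obj T ⟶ Φ.proj.obj P) (hp : l ≫ Φ.proj.map p = m ≫ Φ.proj.map p)
    (hq : l ≫ Φ.proj.map q = m ≫ Φ.proj.map q) : l = m := by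
  obtain ⟨U, hU, l, m, rfl, rfl⟩ := exists_repHom₂ l m
  simp only [repHom_comp_map, repHom_eq_iff] at hp hq ⊢
  obtain ⟨W, hW, a, hp⟩ := hp
  obtain ⟨W', hW', a', hq⟩ := hq
  refine ⟨W ⨯ W', Φ.mem_prod hW hW', prod.fst ≫ a, h _ _ ?_ ?_⟩
  · simp only [map_id_comp, Category.assoc, hp]
  · have ea : (prod.fst ≫ a : W ⨯ W' ⟶ U) = prod.snd ≫ a' := Φ.subterminal _ hU _ _
    simp only [ea, map_id_comp, Category.assoc, hq]

lemma isPullback_proj_map {P X Y Z : C} {p : P ⟶ X} {q : P ⟶ Y} {f : X ⟶ Z} {g : Y ⟶ Z}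
    (sq : IsPullback p q f g) :
    IsPullback (Φ.proj.map p) (Φ.proj.map q) (Φ.proj.map f) (Φ.proj.map g) := by
  have w : Φ.proj.map p ≫ Φ.proj.map f = Φ.proj.map q ≫ Φ.proj.map g := by
    rw [← Functor.map_comp, ← Functor.map_comp, sq.w]
  have key : ∀ (T : Φ.FilterQuotient) (a : T ⟶ Φ.proj.obj X) (b : T ⟶ Φ.proj.obj Y),
      a ≫ Φ.proj.map f = b ≫ Φ.proj.map g →
        ∃ l : T ⟶ Φ.proj.obj P, l ≫ Φ.proj.map p = a ∧ l ≫ Φ.proj.map q = b := by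
    intro T
    induction T using projInduction with | h T
    intro a b h
    obtain ⟨U, hU, a, b, rfl, rfl⟩ := exists_repHom₂ a b
    rw [repHom_comp_map, repHom_comp_map, repHom_eq_iff] at h
    obtain ⟨W, hW, c, h⟩ := h
    rw [← Category.assoc, ← Category.assoc] at h
    refine ⟨repHom hW (sq.lift _ _ h), ?_, ?_⟩
    · rw [repHom_comp_map, sq.lift_fst, repHom_restrict]
    · rw [repHom_comp_map, sq.lift_snd, repHom_restrict]
  refine ⟨⟨w⟩, ⟨PullbackCone.IsLimit.mk w (fun s => (key _ _ _ s.condition).choose)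
    (fun s => (key _ _ _ s.condition).choose_spec.1)
    (fun s => (key _ _ _ s.condition).choose_spec.2) ?_⟩⟩
  intro s m h₁ h₂
  refine proj_map_joint_mono (T := s.pt.as) p q (fun l m => sq.hom_ext) _ _ ?_ ?_
  · exact h₁.trans (key _ _ _ s.condition).choose_spec.1.symm
  · exact h₂.trans (key _ _ _ s.condition).choose_spec.2.symm

/-- Every cospan of the filter quotient is isomorphic to the image of a cospan of `C`. -/
lemma exists_isPullback [HasPullbacks C] {X Y Z : C} (f : Φ.proj.obj X ⟶ Φ.proj.obj Z)
    (g : Φ.proj.obj Y ⟶ Φ.proj.obj Z) :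
    ∃ (U : C) (hU : Φ.mem U) (f₀ : X ⨯ U ⟶ Z) (g₀ : Y ⨯ U ⟶ Z),
      f = (fstIso X hU).inv ≫ Φ.proj.map f₀ ∧ g = (fstIso Y hU).inv ≫ Φ.proj.map g₀ ∧
      IsPullback (Φ.proj.map (pullback.fst f₀ g₀) ≫ (fstIso X hU).hom)
        (Φ.proj.map (pullback.snd f₀ g₀) ≫ (fstIso Y hU).hom) f g := by
  obtain ⟨U, hU, f₀, g₀, rfl, rfl⟩ := exists_repHom₂ f g
  refine ⟨U, hU, f₀, g₀, repHom_eq _ _, repHom_eq _ _, ?_⟩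
  refine (isPullback_proj_map (Φ := Φ) (IsPullback.of_hasPullback f₀ g₀)).of_iso (Iso.refl _)
    (fstIso X hU) (fstIso Y hU) (Iso.refl _) ?_ ?_ ?_ ?_
  · simp
  · simp
  · rw [Iso.refl_hom, Category.comp_id, repHom_eq, Iso.hom_inv_id_assoc]
  · rw [Iso.refl_hom, Category.comp_id, repHom_eq, Iso.hom_inv_id_assoc]

instance [HasPullbacks C] : HasPullbacks Φ.FilterQuotient := by
  have (X Y Z : Φ.FilterQuotient) (f : X ⟶ Z) (g : Y ⟶ Z) : HasLimit (cospan f g) := by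
    induction X using projInduction with | h X
    induction Y using projInduction with | h Y
    induction Z using projInduction with | h Z
    obtain ⟨U, hU, f₀, g₀, -, -, h⟩ := exists_isPullback f g
    exact h.hasPullback
  exact hasPullbacks_of_hasLimit_cospan _

instance [HasFiniteLimits C] : HasFiniteLimits Φ.FilterQuotient :=
  hasFiniteLimits_of_hasTerminal_and_pullbacks

/-- The image of the terminal object is terminal. -/
noncomputable def isTerminalProj : IsTerminal (Φ.proj.obj (⊤_ C)) := by
  refine IsTerminal.ofUniqueHom (fun X => Φ.proj.map (terminal.from X.as)) ?_
  intro X m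
  induction X using projInduction with | h X
  obtain ⟨U, hU, m, rfl⟩ := exists_repHom m
  exact (congrArg (repHom hU) (Subsingleton.elim _ _)).trans (map_eq_repHom hU _).symm

instance : PreservesFiniteProducts Φ.proj :=
  preservesFiniteProducts_of_isLimit _ terminalIsTerminal isTerminalProj
    fun X Y => ⟨_, _, _, ⟨prodIsProd X Y⟩, ⟨isLimitProjFan X Y⟩⟩

end Limits

/-! ### Finite colimits in the filter quotient -/

section Colimits

variable {C : Type u₁} [Category.{v₁} C] [HasFiniteProducts C] {Φ : SubterminalFilter C}

/-- A pair of morphisms whose products with the objects of the filter are jointly epic remains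
jointly epic in the filter quotient. -/
lemma proj_map_joint_epi {P X Y : C} (p : X ⟶ P) (q : Y ⟶ P)
    (h : ∀ {U : C}, Φ.mem U → ∀ {T : C} (l m : P ⨯ U ⟶ T),
      prod.map p (𝟙 U) ≫ l = prod.map p (𝟙 U) ≫ m →
      prod.map q (𝟙 U) ≫ l = prod.map q (𝟙 U) ≫ m → l = m)
    {T : C} (l m : Φ.proj.obj P ⟶ Φ.proj.obj T) (hp : Φ.proj.map p ≫ l = Φ.proj.map p ≫ m)
    (hq : Φ.proj.map q ≫ l = Φ.proj.map q ≫ m) : l = m := by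
  obtain ⟨U, hU, l, m, rfl, rfl⟩ := exists_repHom₂ l m
  simp only [map_comp_repHom, repHom_eq_iff] at hp hq ⊢
  obtain ⟨W, hW, a, hp⟩ := hp
  obtain ⟨W', hW', a', hq⟩ := hq
  have comm {A B V V' T' : C} (f : A ⟶ B) (v : V' ⟶ V) (k : B ⨯ V ⟶ T') :
      prod.map (𝟙 A) v ≫ prod.map f (𝟙 V) ≫ k = prod.map f (𝟙 V') ≫ prod.map (𝟙 B) v ≫ k := by
    simp
  refine ⟨W ⨯ W', Φ.mem_prod hW hW', prod.fst ≫ a, h (Φ.mem_prod hW hW') _ _ ?_ ?_⟩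
  · simp only [← comm]
    simp only [map_id_comp, Category.assoc, hp]
  · have ea : (prod.fst ≫ a : W ⨯ W' ⟶ U) = prod.snd ≫ a' := Φ.subterminal _ hU _ _
    simp only [← comm]
    simp only [ea, map_id_comp, Category.assoc, hq]

/-- A pushout square of `C` whose products with the objects of the filter are pushout squares
remains a pushout square in the filter quotient. -/
lemma isPushout_proj_map {P X Y Z : C} {f : Z ⟶ X} {g : Z ⟶ Y} {p : X ⟶ P} {q : Y ⟶ P}
    (sq : ∀ {U : C}, Φ.mem U → IsPushout (prod.map f (𝟙 U)) (prod.map g (𝟙 U))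
      (prod.map p (𝟙 U)) (prod.map q (𝟙 U))) :
    IsPushout (Φ.proj.map f) (Φ.proj.map g) (Φ.proj.map p) (Φ.proj.map q) := by
  have w : Φ.proj.map f ≫ Φ.proj.map p = Φ.proj.map g ≫ Φ.proj.map q := by
    have hT := Φ.mem_terminal
    rw [proj_map_eq_stageHom hT, proj_map_eq_stageHom hT, proj_map_eq_stageHom hT,
      proj_map_eq_stageHom hT, ← stageHom_comp, ← stageHom_comp, (sq hT).w]
  have key : ∀ (T : Φ.FilterQuotient) (a : Φ.proj.obj X ⟶ T) (b : Φ.proj.obj Y ⟶ T),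
      Φ.proj.map f ≫ a = Φ.proj.map g ≫ b →
        ∃ l : Φ.proj.obj P ⟶ T, Φ.proj.map p ≫ l = a ∧ Φ.proj.map q ≫ l = b := by
    intro T
    induction T using projInduction with | h T
    intro a b h
    obtain ⟨U, hU, a, b, rfl, rfl⟩ := exists_repHom₂ a b
    rw [map_comp_repHom, map_comp_repHom, repHom_eq_iff] at h
    obtain ⟨W, hW, c, h⟩ := h
    have h' : prod.map f (𝟙 W) ≫ prod.map (𝟙 X) c ≫ a =
        prod.map g (𝟙 W) ≫ prod.map (𝟙 Y) c ≫ b := by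
      simpa using h
    refine ⟨repHom hW ((sq hW).desc _ _ h'), ?_, ?_⟩
    · rw [map_comp_repHom, (sq hW).inl_desc, repHom_restrict]
    · rw [map_comp_repHom, (sq hW).inr_desc, repHom_restrict]
  refine ⟨⟨w⟩, ⟨PushoutCocone.IsColimit.mk w (fun s => (key _ _ _ s.condition).choose)
    (fun s => (key _ _ _ s.condition).choose_spec.1)
    (fun s => (key _ _ _ s.condition).choose_spec.2) ?_⟩⟩
  intro s m h₁ h₂
  refine proj_map_joint_epi (T := s.pt.as) p q (fun hU _ l m => (sq hU).hom_ext) _ _ ?_ ?_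
  · exact h₁.trans (key _ _ _ s.condition).choose_spec.1.symm
  · exact h₂.trans (key _ _ _ s.condition).choose_spec.2.symm

/-- Products with objects of a cartesian closed category preserve pushout squares. -/
lemma isPushout_prod_map [∀ X : C, (prod.functor.obj X).IsLeftAdjoint] {P X Y Z : C} {f : Z ⟶ X}
    {g : Z ⟶ Y} {p : X ⟶ P} {q : Y ⟶ P} (sq : IsPushout f g p q) (U : C) :
    IsPushout (prod.map f (𝟙 U)) (prod.map g (𝟙 U)) (prod.map p (𝟙 U)) (prod.map q (𝟙 U)) := by
  have : PreservesColimitsOfSize.{0, 0} (prod.functor.obj U) :=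
    (Adjunction.ofIsLeftAdjoint (prod.functor.obj U)).leftAdjoint_preservesColimits
  have sq' : IsPushout (prod.map (𝟙 U) f) (prod.map (𝟙 U) g) (prod.map (𝟙 U) p)
    (prod.map (𝟙 U) q) := sq.map (prod.functor.obj U)
  refine sq'.of_iso (prod.braiding _ _) (prod.braiding _ _)
    (prod.braiding _ _) (prod.braiding _ _) ?_ ?_ ?_ ?_ <;> simp

instance [∀ X : C, (prod.functor.obj X).IsLeftAdjoint] [HasPushouts C] :
    HasPushouts Φ.FilterQuotient := by
  have (X Y Z : Φ.FilterQuotient) (f : Z ⟶ X) (g : Z ⟶ Y) : HasColimit (span f g) := by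
    induction X using projInduction with | h X
    induction Y using projInduction with | h Y
    induction Z using projInduction with | h Z
    obtain ⟨U, hU, f₀, g₀, rfl, rfl⟩ := exists_repHom₂ f g
    have sq := isPushout_proj_map (Φ := Φ)
      (fun {W} _ => isPushout_prod_map (IsPushout.of_hasPushout f₀ g₀) W)
    refine (sq.of_iso (fstIso Z hU) (Iso.refl _) (Iso.refl _) (Iso.refl _)
      (f' := repHom hU f₀) (g' := repHom hU g₀) ?_ ?_ (by simp; rfl) (by simp; rfl)).hasPushout
    · rw [Iso.refl_hom, Category.comp_id, repHom_eq, Iso.hom_inv_id_assoc]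
    · rw [Iso.refl_hom, Category.comp_id, repHom_eq, Iso.hom_inv_id_assoc]
  exact hasPushouts_of_hasColimit_span _

instance [∀ X : C, (prod.functor.obj X).IsLeftAdjoint] [HasInitial C] :
    HasInitial Φ.FilterQuotient := by
  refine (IsInitial.ofUniqueHom (X := Φ.proj.obj (⊥_ C))
    (fun X => Φ.proj.map (initial.to X.as)) ?_).hasInitial
  intro X m
  induction X using projInduction with | h X
  obtain ⟨U, hU, m, rfl⟩ := exists_repHom m
  have : PreservesColimitsOfSize.{0, 0} (prod.functor.obj U) :=
    (Adjunction.ofIsLeftAdjoint (prod.functor.obj U)).leftAdjoint_preservesColimits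
  have h : IsInitial ((⊥_ C) ⨯ U) :=
    (initialIsInitial.isInitialObj (prod.functor.obj U)).ofIso (prod.braiding _ _)
  exact (congrArg (repHom hU) (h.hom_ext _ _)).trans (map_eq_repHom hU _).symm

instance [∀ X : C, (prod.functor.obj X).IsLeftAdjoint] [HasFiniteColimits C] :
    HasFiniteColimits Φ.FilterQuotient :=
  hasFiniteColimits_of_hasInitial_and_pushouts

end Colimits

/-! ### The filter quotient of an elementary topos -/

section Topos

variable {C : Type u₁} [Category.{v₁} C] [HasFiniteProducts C] {Φ : SubterminalFilter C}

/-- The monomorphisms of the filter quotient are represented by monomorphisms: if the two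
projections of the kernel pair of `φ` become equal in the filter quotient, then they are equal at
some stage, and the restriction of `φ` to this stage is a monomorphism. -/
lemma quotientClass_monomorphisms [HasPullbacks C] :
    Φ.quotientClass (MorphismProperty.monomorphisms C) =
      MorphismProperty.monomorphisms Φ.FilterQuotient := by
  ext X Y f
  induction X using projInduction with | h X
  induction Y using projInduction with | h Y
  simp only [MorphismProperty.monomorphisms.iff]
  constructor
  · rw [quotientClass_iff]
    rintro ⟨U, hU, φ, rfl, hφ : Mono φ⟩
    rw [stageHom_eq]
    infer_instance
  · intro hf
    obtain ⟨U, hU, φ, rfl⟩ := exists_stageHom f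
    have hφ : Mono (Φ.proj.map φ) := by
      have : Φ.proj.map φ = (fstIso X hU).hom ≫ stageHom hU φ ≫ (fstIso Y hU).inv := by
        simp [stageHom_eq]
      rw [this]
      infer_instance
    have e : Φ.proj.map (pullback.fst φ φ) = Φ.proj.map (pullback.snd φ φ) := by
      rw [← cancel_mono (Φ.proj.map φ), ← Functor.map_comp, ← Functor.map_comp,
        pullback.condition]
    rw [map_eq_repHom hU, map_eq_repHom hU, repHom_eq_iff] at e
    obtain ⟨W, hW, a, e⟩ := e
    rw [prod.map_fst_assoc, Category.id_comp, prod.map_fst_assoc, Category.id_comp] at e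
    rw [← stageHom_restrict hU hW a]
    refine quotientClass_stageHom hW ⟨fun {Z} g h w => stage_hom_ext hW ?_⟩
    have w' : (g ≫ prod.map (𝟙 X) a) ≫ φ = (h ≫ prod.map (𝟙 X) a) ≫ φ := by
      rw [Category.assoc, Category.assoc, ← restrict_map hU, ← Category.assoc, w, Category.assoc]
    have := congrArg (prod.lift (pullback.lift _ _ w') (g ≫ prod.snd) ≫ · ≫ prod.fst) e
    simp only [Category.assoc, Limits.prod.lift_fst_assoc, pullback.lift_fst_assoc,
      pullback.lift_snd_assoc, prod.map_fst, Category.comp_id] at this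
    exact this

/-- A morphism into the object of truth values is determined by the generalized elements which
it maps to the truth. -/
lemma classifier_hom_ext [HasPullbacks C] (𝒞 : Subobject.Classifier C) {X : C} {c c' : X ⟶ 𝒞.Ω}
    (h : ∀ {T : C} (t : T ⟶ X), t ≫ c = 𝒞.χ₀ T ≫ 𝒞.truth ↔ t ≫ c' = 𝒞.χ₀ T ≫ 𝒞.truth) :
    c = c' := by
  have sq (d : X ⟶ 𝒞.Ω) (hd : ∀ {T : C} (t : T ⟶ X),
      t ≫ c = 𝒞.χ₀ T ≫ 𝒞.truth ↔ t ≫ d = 𝒞.χ₀ T ≫ 𝒞.truth) :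
      IsPullback (pullback.fst c 𝒞.truth) (𝒞.χ₀ _) d 𝒞.truth := by
    have w : pullback.fst c 𝒞.truth ≫ c = 𝒞.χ₀ _ ≫ 𝒞.truth :=
      pullback.condition.trans (congrArg (· ≫ _) (Subsingleton.elim _ _))
    refine ⟨⟨(hd _).1 w⟩, ⟨PullbackCone.IsLimit.mk _ (fun s => pullback.lift s.fst (𝒞.χ₀ _)
      ((hd _).2 (s.condition.trans (congrArg (· ≫ _) (Subsingleton.elim _ _)))))
      (fun s => pullback.lift_fst _ _ _) (fun s => Subsingleton.elim _ _) (fun s m h₁ _ => ?_)⟩⟩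
    rw [← cancel_mono (pullback.fst c 𝒞.truth), h₁]
    exact (pullback.lift_fst _ _ _).symm
  exact (𝒞.uniq _ (sq c fun _ => Iff.rfl)).trans (𝒞.uniq _ (sq c' h)).symm

/-- If the subobject classified by `c` is contained in the one classified by `c'` in the filter
quotient, then this holds already at some stage, as is seen by testing the hypothesis on the
inclusion of the subobject classified by `c`. -/
lemma exists_stage_classifier_le [HasPullbacks C] (𝒞 : Subobject.Classifier C) {X : C}
    {c c' : X ⟶ 𝒞.Ω}
    (h : ∀ {T : C} (t : Φ.proj.obj T ⟶ Φ.proj.obj X),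
      t ≫ Φ.proj.map c = Φ.proj.map (𝒞.χ₀ T ≫ 𝒞.truth) →
      t ≫ Φ.proj.map c' = Φ.proj.map (𝒞.χ₀ T ≫ 𝒞.truth)) :
    ∃ (W : C) (_ : Φ.mem W), ∀ {T : C} (t : T ⟶ X) (_ : T ⟶ W),
      t ≫ c = 𝒞.χ₀ T ≫ 𝒞.truth → t ≫ c' = 𝒞.χ₀ T ≫ 𝒞.truth := by
  let i := pullback.fst c 𝒞.truth
  have w : i ≫ c = 𝒞.χ₀ _ ≫ 𝒞.truth :=
    pullback.condition.trans (congrArg (· ≫ _) (Subsingleton.elim _ _))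
  have e := h (Φ.proj.map i) (by rw [← Functor.map_comp, w])
  rw [← Functor.map_comp, map_eq_repHom Φ.mem_terminal, map_eq_repHom Φ.mem_terminal,
    repHom_eq_iff] at e
  obtain ⟨W, hW, a, e⟩ := e
  refine ⟨W, hW, fun {T} t p ht => ?_⟩
  have e' := congrArg (prod.lift (pullback.lift t (𝒞.χ₀ T) ht) p ≫ ·) e
  simp only [prod.map_fst_assoc, Category.id_comp, Limits.prod.lift_fst_assoc, i,
    pullback.lift_fst_assoc] at e'
  rw [e', ← Category.assoc]
  exact congrArg (· ≫ _) (Subsingleton.elim _ _)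

/-- A morphism of the filter quotient into the image of the object of truth values is determined by
the generalized elements which it maps to the truth. -/
lemma classifier_proj_hom_ext [HasPullbacks C] (𝒞 : Subobject.Classifier C) {X : C}
    {χ χ' : Φ.proj.obj X ⟶ Φ.proj.obj 𝒞.Ω}
    (h : ∀ {T : C} (t : Φ.proj.obj T ⟶ Φ.proj.obj X),
      t ≫ χ = Φ.proj.map (𝒞.χ₀ T ≫ 𝒞.truth) ↔ t ≫ χ' = Φ.proj.map (𝒞.χ₀ T ≫ 𝒞.truth)) :
    χ = χ' := by
  obtain ⟨U, hU, c, c', rfl, rfl⟩ := exists_repHom₂ χ χ'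
  simp only [repHom_eq] at h
  have h' {T : C} (t : Φ.proj.obj T ⟶ Φ.proj.obj (X ⨯ U)) :
      t ≫ Φ.proj.map c = Φ.proj.map (𝒞.χ₀ T ≫ 𝒞.truth) ↔
        t ≫ Φ.proj.map c' = Φ.proj.map (𝒞.χ₀ T ≫ 𝒞.truth) := by
    simpa using h (t ≫ (fstIso X hU).hom)
  obtain ⟨W, hW, H⟩ := exists_stage_classifier_le 𝒞 (fun t => (h' t).1)
  obtain ⟨W', hW', H'⟩ := exists_stage_classifier_le 𝒞 (fun t => (h' t).2)
  rw [repHom_eq_iff]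
  refine ⟨U ⨯ (W ⨯ W'), Φ.mem_prod hU (Φ.mem_prod hW hW'), prod.fst,
    classifier_hom_ext 𝒞 fun {T} t => ?_⟩
  rw [← Category.assoc, ← Category.assoc]
  exact ⟨H _ (t ≫ prod.snd ≫ prod.snd ≫ prod.fst), H' _ (t ≫ prod.snd ≫ prod.snd ≫ prod.snd)⟩

/-- The image of a subobject classifier is a subobject classifier. -/
instance [HasPullbacks C] [HasSubobjectClassifier C] :
    HasSubobjectClassifier Φ.FilterQuotient := by
  obtain ⟨⟨𝒞⟩⟩ := ‹HasSubobjectClassifier C›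
  have t : IsTerminal (Φ.proj.obj 𝒞.Ω₀) := 𝒞.isTerminalΩ₀.isTerminalObj Φ.proj
  -- A monomorphism is classified at a stage at which it is represented by a monomorphism of `C`.
  have key : ∀ {A X : Φ.FilterQuotient} (m : A ⟶ X) [Mono m], ∃ χ : X ⟶ Φ.proj.obj 𝒞.Ω,
      IsPullback m (t.from A) χ (Φ.proj.map 𝒞.truth) := by
    intro A X m hm
    induction A using projInduction with | h A
    induction X using projInduction with | h X
    rw [← MorphismProperty.monomorphisms.iff, ← quotientClass_monomorphisms,
      quotientClass_iff] at hm
    obtain ⟨U, hU, φ, rfl, hφ : Mono φ⟩ := hm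
    refine ⟨(fstIso X hU).inv ≫ Φ.proj.map (𝒞.χ φ), ?_⟩
    refine (isPullback_proj_map (Φ := Φ) (𝒞.isPullback φ)).of_iso (fstIso A hU) (fstIso X hU)
      (Iso.refl _) (Iso.refl _) ?_ (t.hom_ext _ _) ?_ ?_
    · simp [stageHom_eq]
    · simp
    · simp
  refine ⟨⟨.mkOfTerminalΩ₀ _ t _ (Φ.proj.map 𝒞.truth) (fun m _ => (key m).choose)
    (fun m _ => (key m).choose_spec) ?_⟩⟩
  intro A X m _ χ' h'
  have h := (key m).choose_spec
  generalize (key m).choose = χ at h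
  induction X using projInduction with | h X
  refine classifier_proj_hom_ext 𝒞 fun {T} t' => ?_
  have aux {χ₁ χ₂ : Φ.proj.obj X ⟶ Φ.proj.obj 𝒞.Ω}
      (h₁ : IsPullback m (t.from A) χ₁ (Φ.proj.map 𝒞.truth))
      (h₂ : IsPullback m (t.from A) χ₂ (Φ.proj.map 𝒞.truth))
      (e : t' ≫ χ₁ = Φ.proj.map (𝒞.χ₀ T ≫ 𝒞.truth)) :
      t' ≫ χ₂ = Φ.proj.map (𝒞.χ₀ T ≫ 𝒞.truth) := by
    rw [Functor.map_comp] at e ⊢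
    rw [← h₁.lift_fst _ _ e, Category.assoc, h₂.w, ← Category.assoc]
    exact congrArg (· ≫ _) (t.hom_ext _ _)
  exact ⟨aux h' h, aux h h'⟩

end Topos

section CartesianClosed

variable {C : Type u₁} [Category.{v₁} C] [HasFiniteProducts C] {Φ : SubterminalFilter C}

/-- The comparison isomorphism between the product of the filter quotient and the image of the
product of `C`. -/
noncomputable def prodIso (X Y : C) :
    Φ.proj.obj X ⨯ Φ.proj.obj Y ≅ Φ.proj.obj (X ⨯ Y) :=
  (PreservesLimitPair.iso Φ.proj X Y).symm

lemma prodIso_hom_fst (X Y : C) :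
    (prodIso (Φ := Φ) X Y).hom ≫ Φ.proj.map prod.fst = prod.fst :=
  iso_inv_fst Φ.proj X Y

lemma prodIso_hom_snd (X Y : C) :
    (prodIso (Φ := Φ) X Y).hom ≫ Φ.proj.map prod.snd = prod.snd :=
  iso_inv_snd Φ.proj X Y

lemma prod_map_repHom (X : C) {Z E U : C} (hU : Φ.mem U) (g : Z ⨯ U ⟶ E) :
    prod.map (𝟙 (Φ.proj.obj X)) (repHom hU g) ≫ (prodIso X E).hom =
      (prodIso X Z).hom ≫ repHom hU ((prod.associator X Z U).hom ≫ prod.map (𝟙 X) g) := by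
  apply map_prod_hom_ext Φ.proj
  · simp only [Category.assoc, repHom_comp_map, prodIso_hom_fst, prod.map_fst, Category.comp_id]
    rw [← prodIso_hom_fst, map_eq_repHom hU]
    simp
  · simp only [Category.assoc, repHom_comp_map, prodIso_hom_snd, prod.map_snd]
    rw [← prodIso_hom_snd, Category.assoc, map_comp_repHom]
    congr 2
    rw [← Category.assoc]
    congr 1
    ext <;> simp

/-- The filter quotient of a cartesian closed category is cartesian closed. The exponential of `C`
remains an exponential: the evaluation is terminal in the comma category of the product functor. -/
instance [∀ X : C, (prod.functor.obj X).IsLeftAdjoint] (X : Φ.FilterQuotient) :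
    (prod.functor.obj X).IsLeftAdjoint := by
  induction X using projInduction with | h X
  have (Y : Φ.FilterQuotient) :
      HasTerminal (CostructuredArrow (prod.functor.obj (Φ.proj.obj X)) Y) := by
    induction Y using projInduction with | h Y
    let adj := Adjunction.ofIsLeftAdjoint (prod.functor.obj X)
    let E := (prod.functor.obj X).rightAdjoint.obj Y
    let ev : X ⨯ E ⟶ Y := adj.counit.app Y
    have ex {A : C} (h : X ⨯ A ⟶ Y) : ∃ g : A ⟶ E, prod.map (𝟙 X) g ≫ ev = h :=
      ⟨adj.homEquiv A Y h,
        (adj.homEquiv_counit _ _ _).symm.trans ((adj.homEquiv A Y).symm_apply_apply h)⟩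
    have un {A : C} (g g' : A ⟶ E) (h : prod.map (𝟙 X) g ≫ ev = prod.map (𝟙 X) g' ≫ ev) :
        g = g' :=
      (adj.homEquiv A Y).symm.injective
        ((adj.homEquiv_counit _ _ _).trans (h.trans (adj.homEquiv_counit _ _ _).symm))
    let t : CostructuredArrow (prod.functor.obj (Φ.proj.obj X)) (Φ.proj.obj Y) :=
      CostructuredArrow.mk (Y := Φ.proj.obj E) ((prodIso X E).hom ≫ Φ.proj.map ev)
    have key (Z : Φ.FilterQuotient) (f : Φ.proj.obj X ⨯ Z ⟶ Φ.proj.obj Y) :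
        ∃! g : Z ⟶ Φ.proj.obj E,
          prod.map (𝟙 (Φ.proj.obj X)) g ≫ (prodIso X E).hom ≫ Φ.proj.map ev = f := by
      induction Z using projInduction with | h Z
      refine existsUnique_of_exists_of_unique ?_ ?_
      · obtain ⟨U, hU, f₀, hf⟩ := exists_repHom ((prodIso X Z).inv ≫ f)
        obtain ⟨g, hg⟩ := ex ((prod.associator X Z U).inv ≫ f₀)
        refine ⟨repHom hU g, ?_⟩
        rw [← Category.assoc, prod_map_repHom, Category.assoc, repHom_comp_map, Category.assoc, hg,
          Iso.hom_inv_id_assoc, ← hf, Iso.hom_inv_id_assoc]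
      · intro g g' hg hg'
        obtain ⟨U, hU, g, g', rfl, rfl⟩ := exists_repHom₂ g g'
        have h := hg.trans hg'.symm
        rw [← Category.assoc, ← Category.assoc, prod_map_repHom, prod_map_repHom, Category.assoc,
          Category.assoc, cancel_epi, repHom_comp_map, repHom_comp_map, repHom_eq_iff] at h
        obtain ⟨W, hW, a, h⟩ := h
        refine (repHom_eq_iff _ _ _).2 ⟨W, hW, a, un _ _ ?_⟩
        rw [← cancel_epi (prod.associator X Z W).hom]
        have nat {T : C} (k : X ⨯ (Z ⨯ U) ⟶ T) :
            prod.map (𝟙 (X ⨯ Z)) a ≫ (prod.associator X Z U).hom ≫ k =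
              (prod.associator X Z W).hom ≫ prod.map (𝟙 X) (prod.map (𝟙 Z) a) ≫ k := by
          rw [← Category.assoc, ← Category.assoc]
          simp
        simp only [Category.assoc, nat] at h
        simpa only [Category.assoc, map_id_comp] using h
    refine (IsTerminal.ofUniqueHom (Y := t)
      (fun A => CostructuredArrow.homMk (key A.left A.hom).choose (key A.left A.hom).choose_spec.1)
      ?_).hasTerminal
    intro A m
    ext
    exact (key A.left A.hom).choose_spec.2 _ (CostructuredArrow.w m)
  exact isLeftAdjoint_of_costructuredArrowTerminals _

end CartesianClosed
end SubterminalFilter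

/-! ### Subobjects and functors -/

section Subobjects

variable {C : Type u₁} [Category.{v₁} C] {D : Type u₂} [Category.{v₂} D]

lemma mapSubobject_mk (F : C ⥤ D) [F.PreservesMonomorphisms] {X A : C} (m : A ⟶ X) [Mono m] :
    mapSubobject F (Subobject.mk m) = Subobject.mk (F.map m) := by
  refine Subobject.mk_eq_mk_of_comm _ _ (F.mapIso (Subobject.underlyingIso m)) ?_
  rw [Functor.mapIso_hom, ← Functor.map_comp, Subobject.underlyingIso_hom_comp_eq_mk]

lemma mapSubobject_mono (F : C ⥤ D) [F.PreservesMonomorphisms] {X : C} :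
    Monotone (mapSubobject F : Subobject X → Subobject (F.obj X)) := fun A B h =>
  Subobject.mk_le_mk_of_comm (F.map (Subobject.ofLE A B h)) (by
    rw [← Functor.map_comp, Subobject.ofLE_arrow])

lemma mapSubobject_pullback (F : C ⥤ D) [F.PreservesMonomorphisms] [HasPullbacks C]
    [HasPullbacks D] [PreservesLimitsOfShape WalkingCospan F] {X Y : C} (f : X ⟶ Y)
    (A : Subobject Y) :
    mapSubobject F ((Subobject.pullback f).obj A) =
      (Subobject.pullback (F.map f)).obj (mapSubobject F A) :=
  (Subobject.pullback_obj_mk ((Subobject.isPullback f A).map F)).symm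

lemma le_pullback_mk_iff [HasPullbacks C] {X Y Z : C} (f : X ⟶ Y) (m : Z ⟶ Y) [Mono m]
    (A : Subobject X) :
    A ≤ (Subobject.pullback f).obj (Subobject.mk m) ↔
      ∃ k : (A : C) ⟶ Z, k ≫ m = A.arrow ≫ f := by
  have sq := Subobject.isPullback f (Subobject.mk m)
  constructor
  · intro h
    refine ⟨Subobject.ofLE _ _ h ≫ Subobject.pullbackπ _ _ ≫ (Subobject.underlyingIso m).hom, ?_⟩
    rw [Category.assoc, Category.assoc, Subobject.underlyingIso_hom_comp_eq_mk, sq.w,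
      ← Category.assoc, Subobject.ofLE_arrow]
  · rintro ⟨k, hk⟩
    exact Subobject.le_of_comm (sq.lift (k ≫ (Subobject.underlyingIso m).inv) A.arrow
      (by rw [Category.assoc, Subobject.underlyingIso_arrow, hk])) (sq.lift_snd _ _ _)

/-- Pulling back subobjects along an isomorphism is an isomorphism of posets. -/
noncomputable def pullbackOrderIso [HasPullbacks C] {X Y : C} (e : X ≅ Y) :
    Subobject Y ≃o Subobject X where
  toFun A := (Subobject.pullback e.hom).obj A
  invFun A := (Subobject.pullback e.inv).obj A
  left_inv A := by
    dsimp only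
    rw [← Subobject.pullback_comp, e.inv_hom_id, Subobject.pullback_id]
  right_inv A := by
    dsimp only
    rw [← Subobject.pullback_comp, e.hom_inv_id, Subobject.pullback_id]
  map_rel_iff' {A B} := by
    refine ⟨fun h => ?_, fun h => (Subobject.pullback e.hom).monotone h⟩
    have := (Subobject.pullback e.inv).monotone h
    simpa only [Equiv.coe_fn_mk, ← Subobject.pullback_comp, e.inv_hom_id,
      Subobject.pullback_id] using this

lemma pullbackOrderIso_apply [HasPullbacks C] {X Y : C} (e : X ≅ Y) (A : Subobject Y) :
    pullbackOrderIso e A = (Subobject.pullback e.hom).obj A := rfl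

lemma OrderIso.isLUB_pair_iff {α β : Type*} [Preorder α] [Preorder β] (e : α ≃o β) {a b s : α} :
    IsLUB {e a, e b} (e s) ↔ IsLUB {a, b} s := by
  rw [← e.isLUB_image', Set.image_pair]

lemma OrderIso.isGLB_pair_iff {α β : Type*} [Preorder α] [Preorder β] (e : α ≃o β) {a b s : α} :
    IsGLB {e a, e b} (e s) ↔ IsGLB {a, b} s := by
  rw [← e.isGLB_image', Set.image_pair]

lemma isLUB_pair_iff {α : Type*} [Preorder α] {a b s : α} :
    IsLUB {a, b} s ↔ a ≤ s ∧ b ≤ s ∧ ∀ c, a ≤ c → b ≤ c → s ≤ c := by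
  simp [IsLUB, IsLeast, upperBounds, lowerBounds, and_assoc]

lemma isGLB_pair_iff {α : Type*} [Preorder α] {a b s : α} :
    IsGLB {a, b} s ↔ s ≤ a ∧ s ≤ b ∧ ∀ c, c ≤ a → c ≤ b → c ≤ s := by
  simp [IsGLB, IsGreatest, upperBounds, lowerBounds, and_assoc]

end Subobjects

namespace SubterminalFilter

/-! ### Subobjects in the filter quotient -/

section Subobjects

variable {C : Type u₁} [Category.{v₁} C] [HasFiniteProducts C] {Φ : SubterminalFilter C}

lemma mono_fst (X : C) {U : C} (hU : Φ.mem U) : Mono (prod.fst : X ⨯ U ⟶ X) :=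
  ⟨fun _ _ h => stage_hom_ext hU h⟩

variable [HasPullbacks C]

instance : PreservesLimitsOfShape WalkingCospan Φ.proj :=
  preservesLimitsOfShape_walkingCospan_of_isPullback _
    fun f g => ⟨_, _, _, IsPullback.of_hasPullback f g,
      isPullback_proj_map (IsPullback.of_hasPullback f g)⟩

/-- Every subobject of `X` in the filter quotient comes from a subobject of `X`: it is represented
by a monomorphism `A ⨯ U ⟶ X ⨯ U`, and `X ⨯ U ⟶ X` is a monomorphism. -/
lemma mapSubobject_proj_surjective {X : C} :
    Function.Surjective (mapSubobject Φ.proj : Subobject X → Subobject (Φ.proj.obj X)) := by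
  intro A
  obtain ⟨Z, m, hm, rfl⟩ : ∃ (Z : Φ.FilterQuotient) (m : Z ⟶ Φ.proj.obj X) (_ : Mono m),
      A = Subobject.mk m := ⟨_, A.arrow, inferInstance, (Subobject.mk_arrow A).symm⟩
  induction Z using projInduction with | h Z
  have hm' := hm
  rw [← MorphismProperty.monomorphisms.iff, ← quotientClass_monomorphisms,
    quotientClass_iff] at hm'
  obtain ⟨U, hU, φ, rfl, hφ : Mono φ⟩ := hm'
  have := mono_fst X hU
  refine ⟨Subobject.mk (φ ≫ prod.fst), ?_⟩
  rw [mapSubobject_mk]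
  refine Subobject.mk_eq_mk_of_comm _ _ (fstIso Z hU) ?_
  rw [fstIso_hom, fst_comp_stageHom, Functor.map_comp]

/-- The order on the subobjects of `X` in the filter quotient: an inequality holds if it holds
after restriction to some stage. -/
lemma mapSubobject_proj_le_iff {X : C} (A B : Subobject X) :
    mapSubobject Φ.proj A ≤ mapSubobject Φ.proj B ↔
      ∃ (U : C) (_ : Φ.mem U), (Subobject.pullback (prod.fst : X ⨯ U ⟶ X)).obj A ≤
        (Subobject.pullback (prod.fst : X ⨯ U ⟶ X)).obj B := by
  constructor
  · intro h
    obtain ⟨k, hk⟩ : ∃ k : Φ.proj.obj (A : C) ⟶ Φ.proj.obj (B : C),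
        k ≫ Φ.proj.map B.arrow = Φ.proj.map A.arrow :=
      ⟨Subobject.ofMkLEMk _ _ h, Subobject.ofMkLEMk_comp h⟩
    obtain ⟨U, hU, k, rfl⟩ := exists_repHom k
    rw [repHom_comp_map, map_eq_repHom hU, repHom_eq_iff] at hk
    obtain ⟨W, hW, a, hk⟩ := hk
    rw [prod.map_fst_assoc, Category.id_comp] at hk
    refine ⟨W, hW, ?_⟩
    have sqA := Subobject.isPullback (prod.fst : X ⨯ W ⟶ X) A
    have sqB := Subobject.isPullback (prod.fst : X ⨯ W ⟶ X) B
    set A' := (Subobject.pullback (prod.fst : X ⨯ W ⟶ X)).obj A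
    refine Subobject.le_of_comm (sqB.lift
      (prod.lift (Subobject.pullbackπ _ A) (A'.arrow ≫ prod.snd) ≫ prod.map (𝟙 _) a ≫ k)
      A'.arrow ?_) (sqB.lift_snd _ _ _)
    rw [Category.assoc, Category.assoc, hk, Limits.prod.lift_fst_assoc, sqA.w]
  · rintro ⟨U, hU, h⟩
    rw [← (pullbackOrderIso (fstIso X hU)).le_iff_le]
    have := mapSubobject_mono Φ.proj h
    rwa [mapSubobject_pullback, mapSubobject_pullback] at this

lemma isBot_mapSubobject_proj {X : C} {B : Subobject X} (hB : IsBot B) :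
    IsBot (mapSubobject Φ.proj B) := by
  intro A
  obtain ⟨A, rfl⟩ := mapSubobject_proj_surjective A
  exact mapSubobject_mono Φ.proj (hB A)

/-- A union of subobjects which remains a union after pullback to `X ⨯ U`, for all objects `U` of
the filter, is a union in the filter quotient. -/
lemma isLUB_mapSubobject_proj {X : C} {A B S : Subobject X} (hS : IsLUB {A, B} S)
    (hU : ∀ U : C, Φ.mem U → IsLUB {(Subobject.pullback (prod.fst : X ⨯ U ⟶ X)).obj A,
      (Subobject.pullback (prod.fst : X ⨯ U ⟶ X)).obj B}
      ((Subobject.pullback (prod.fst : X ⨯ U ⟶ X)).obj S)) :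
    IsLUB {mapSubobject Φ.proj A, mapSubobject Φ.proj B} (mapSubobject Φ.proj S) := by
  simp only [isLUB_pair_iff] at hS hU ⊢
  refine ⟨mapSubobject_mono _ hS.1, mapSubobject_mono _ hS.2.1, fun T hA hB => ?_⟩
  obtain ⟨T, rfl⟩ := mapSubobject_proj_surjective T
  obtain ⟨U, hU₁, hA⟩ := (mapSubobject_proj_le_iff _ _).1 hA
  obtain ⟨V, hV, hB⟩ := (mapSubobject_proj_le_iff _ _).1 hB
  refine (mapSubobject_proj_le_iff _ _).2 ⟨U ⨯ V, Φ.mem_prod hU₁ hV,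
    (hU _ (Φ.mem_prod hU₁ hV)).2.2 _ ?_ ?_⟩
  · have := (Subobject.pullback (prod.map (𝟙 X) (prod.fst : U ⨯ V ⟶ U))).monotone hA
    simpa only [← Subobject.pullback_comp, prod.map_fst, Category.comp_id] using this
  · have := (Subobject.pullback (prod.map (𝟙 X) (prod.snd : U ⨯ V ⟶ V))).monotone hB
    simpa only [← Subobject.pullback_comp, prod.map_fst, Category.comp_id] using this

/-- In a cartesian closed category, unions are stable under pullback along `X ⨯ U ⟶ X` for `U`
subterminal: for a subobject `T` of `X`, the inequality `A ⊓ U ≤ T` is equivalent to `A ≤ T'`,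
where `T'` is the pullback of `T ^ U` along `X ⟶ X ^ U`. -/
lemma isLUB_pullback_fst [∀ X : C, (prod.functor.obj X).IsLeftAdjoint] {X U : C} (hU : Φ.mem U)
    {A B S : Subobject X} (hS : IsLUB {A, B} S) :
    IsLUB {(Subobject.pullback (prod.fst : X ⨯ U ⟶ X)).obj A,
      (Subobject.pullback (prod.fst : X ⨯ U ⟶ X)).obj B}
      ((Subobject.pullback (prod.fst : X ⨯ U ⟶ X)).obj S) := by
  have := mono_fst X hU
  let adj := Adjunction.ofIsLeftAdjoint (prod.functor.obj U)
  have : PreservesLimitsOfSize.{0, 0} (prod.functor.obj U).rightAdjoint :=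
    adj.rightAdjoint_preservesLimits
  have key (T : Subobject (X ⨯ U)) : ∃ T' : Subobject X, ∀ A : Subobject X,
      (Subobject.pullback (prod.fst : X ⨯ U ⟶ X)).obj A ≤ T ↔ A ≤ T' := by
    refine ⟨(Subobject.pullback (adj.homEquiv X X prod.snd)).obj
      (Subobject.mk ((prod.functor.obj U).rightAdjoint.map (T.arrow ≫ prod.fst))), fun A => ?_⟩
    have sq := Subobject.isPullback (prod.fst : X ⨯ U ⟶ X) A
    have h₁ : (Subobject.pullback (prod.fst : X ⨯ U ⟶ X)).obj A ≤ T ↔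
        ∃ k : U ⨯ (A : C) ⟶ (T : C), k ≫ T.arrow ≫ prod.fst = prod.snd ≫ A.arrow := by
      constructor
      · intro h
        have w : (prod.snd : U ⨯ (A : C) ⟶ _) ≫ A.arrow =
            prod.lift (prod.snd ≫ A.arrow) prod.fst ≫ prod.fst := by simp
        refine ⟨sq.lift _ _ w ≫ Subobject.ofLE _ _ h, ?_⟩
        rw [Category.assoc, ← Category.assoc (Subobject.ofLE _ _ h), Subobject.ofLE_arrow,
          ← Category.assoc, sq.lift_snd, Limits.prod.lift_fst]
      · rintro ⟨k, hk⟩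
        refine Subobject.le_of_comm (prod.lift (Subobject.arrow _ ≫ prod.snd)
          (Subobject.pullbackπ _ A) ≫ k) (stage_hom_ext hU ?_)
        rw [Category.assoc, Category.assoc, hk, Limits.prod.lift_snd_assoc, sq.w]
    rw [h₁, le_pullback_mk_iff, ← (adj.homEquiv _ _).exists_congr_right]
    refine exists_congr fun k => ?_
    have : adj.homEquiv (A : C) X (prod.snd ≫ A.arrow) =
        A.arrow ≫ adj.homEquiv X X prod.snd := by
      refine Eq.trans ?_ (adj.homEquiv_naturality_left A.arrow (prod.snd : U ⨯ X ⟶ X))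
      exact congrArg _ (prod.map_snd (𝟙 U) A.arrow).symm
    exact ((adj.homEquiv _ _).apply_eq_iff_eq).symm.trans
      (Eq.congr (adj.homEquiv_naturality_right k (T.arrow ≫ prod.fst)) this)
  rw [isLUB_pair_iff] at hS ⊢
  refine ⟨(Subobject.pullback _).monotone hS.1, (Subobject.pullback _).monotone hS.2.1,
    fun T hA hB => ?_⟩
  obtain ⟨T', hT'⟩ := key T
  rw [hT'] at hA hB ⊢
  exact hS.2.2 _ hA hB

end Subobjects

/-! ### Regular epimorphisms in the filter quotient -/

section Regular

variable {C : Type u₁} [Category.{v₁} C] [HasFiniteProducts C] {Φ : SubterminalFilter C}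

lemma isPullback_prod_map_fst {X Y : C} (f : X ⟶ Y) (U : C) :
    IsPullback (prod.fst : X ⨯ U ⟶ X) (prod.map f (𝟙 U)) f prod.fst := by
  refine ⟨⟨(prod.map_fst _ _).symm⟩, ⟨PullbackCone.IsLimit.mk _
    (fun s => prod.lift s.fst (s.snd ≫ prod.snd)) (fun s => Limits.prod.lift_fst _ _)
    (fun s => ?_) (fun s m h₁ h₂ => ?_)⟩⟩
  · apply Limits.prod.hom_ext
    · simp [s.condition]
    · simp
  · apply Limits.prod.hom_ext
    · simpa using h₁
    · simpa using congrArg (· ≫ prod.snd) h₂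

lemma isPullback_prod_map {P X Y Z : C} {p : P ⟶ X} {q : P ⟶ Y} {f : X ⟶ Z} {g : Y ⟶ Z}
    (sq : IsPullback p q f g) (U : C) :
    IsPullback (prod.map p (𝟙 U)) (prod.map q (𝟙 U)) (prod.map f (𝟙 U)) (prod.map g (𝟙 U)) := by
  refine IsPullback.of_right ?_ (by simp [sq.w]) (isPullback_prod_map_fst f U)
  simpa using (isPullback_prod_map_fst q U).paste_horiz sq

variable (Φ) in
/-- A regular epimorphism whose products with the objects of the filter are regular epimorphisms
remains a regular epimorphism in the filter quotient. -/
lemma isRegularEpi_proj_map [HasPullbacks C] {X Y : C} (e : X ⟶ Y)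
    (he : ∀ U : C, Φ.mem U → IsRegularEpi (prod.map e (𝟙 U))) : IsRegularEpi (Φ.proj.map e) := by
  let p := pullback.fst e e
  let q := pullback.snd e e
  have hK (U : C) : IsKernelPair (prod.map e (𝟙 U)) (prod.map p (𝟙 U)) (prod.map q (𝟙 U)) :=
    isPullback_prod_map (IsPullback.of_hasPullback e e) U
  have w : Φ.proj.map p ≫ Φ.proj.map e = Φ.proj.map q ≫ Φ.proj.map e := by
    rw [← Functor.map_comp, ← Functor.map_comp, pullback.condition]
  have key : ∀ (Z : Φ.FilterQuotient) (k : Φ.proj.obj X ⟶ Z),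
      Φ.proj.map p ≫ k = Φ.proj.map q ≫ k → ∃ l, Φ.proj.map e ≫ l = k := by
    intro Z
    induction Z using projInduction with | h Z
    intro k hk
    obtain ⟨U, hU, k, rfl⟩ := exists_repHom k
    rw [map_comp_repHom, map_comp_repHom, repHom_eq_iff] at hk
    obtain ⟨W, hW, a, hk⟩ := hk
    have hk' : prod.map p (𝟙 W) ≫ prod.map (𝟙 X) a ≫ k =
        prod.map q (𝟙 W) ≫ prod.map (𝟙 X) a ≫ k := by simpa using hk
    have := he W hW
    obtain ⟨l, hl⟩ := IsRegularEpi.exists_of_isKernelPair (prod.map e (𝟙 W)) (hK W) _ hk'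
    refine ⟨repHom hW l, ?_⟩
    rw [map_comp_repHom, hl, repHom_restrict]
  refine ⟨⟨⟨_, _, _, w, Cofork.IsColimit.mk _ (fun s => (key _ s.π s.condition).choose)
    (fun s => (key _ s.π s.condition).choose_spec) ?_⟩⟩⟩
  intro s m hm
  have h := hm.trans (key _ s.π s.condition).choose_spec.symm
  refine proj_map_joint_epi (T := s.pt.as) e e (fun {U} hU T l m h _ => ?_) _ _ h h
  have := he U hU
  exact (cancel_epi _).1 h

lemma isRegularEpi_prod_map_of_regular [Regular C] {X Y : C} (e : X ⟶ Y) [he : IsRegularEpi e]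
    (U : C) : IsRegularEpi (prod.map e (𝟙 U)) :=
  Regular.regularEpiIsStableUnderBaseChange.of_isPullback (isPullback_prod_map_fst e U) he

lemma isRegularEpi_prod_map_of_cartesianClosed [∀ X : C, (prod.functor.obj X).IsLeftAdjoint]
    {X Y : C} (e : X ⟶ Y) [he : IsRegularEpi e] (U : C) :
    IsRegularEpi (prod.map e (𝟙 U)) := by
  have : PreservesColimitsOfSize.{0, 0} (prod.functor.obj U) :=
    (Adjunction.ofIsLeftAdjoint (prod.functor.obj U)).leftAdjoint_preservesColimits
  obtain ⟨⟨r⟩⟩ := he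
  have h : IsRegularEpi ((prod.functor.obj U).map e) :=
    ⟨⟨⟨_, _, _, _, isColimitCoforkMapOfIsColimit (prod.functor.obj U) r.w r.isColimit⟩⟩⟩
  refine ((MorphismProperty.regularEpi C).arrow_mk_iso_iff (Arrow.isoMk
    (f := Arrow.mk (prod.map (𝟙 U) e)) (g := Arrow.mk (prod.map e (𝟙 U)))
    (prod.braiding _ _) (prod.braiding _ _) ?_)).1 h
  simp

/-- A morphism `m ∘ e` with `e` a regular epimorphism and `m` a monomorphism becomes a regular
epimorphism in the filter quotient if and only if `m` becomes an isomorphism. -/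
lemma isRegularEpi_proj_map_comp_iff [Regular C] {X I Y : C} (e : X ⟶ I) (m : I ⟶ Y)
    [IsRegularEpi e] [Mono m] :
    IsRegularEpi (Φ.proj.map (e ≫ m)) ↔ IsIso (Φ.proj.map m) := by
  have he : IsRegularEpi (Φ.proj.map e) :=
    isRegularEpi_proj_map Φ e fun U _ => isRegularEpi_prod_map_of_regular e U
  rw [Functor.map_comp]
  constructor
  · intro h
    have := strongEpi_of_strongEpi (Φ.proj.map e) (Φ.proj.map m)
    exact isIso_of_mono_of_strongEpi _
  · intro h
    exact (MorphismProperty.cancel_right_of_respectsIso (MorphismProperty.regularEpi _) _ _).2 he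

lemma exists_regularEpi_mono [Regular C] {X Y : C} (f : X ⟶ Y) :
    ∃ (I : C) (e : X ⟶ I) (m : I ⟶ Y), IsRegularEpi e ∧ Mono m ∧ e ≫ m = f :=
  ⟨_, (Regular.strongEpiMonoFactorisation f).e, (Regular.strongEpiMonoFactorisation f).m,
    inferInstance, inferInstance, (Regular.strongEpiMonoFactorisation f).fac⟩

/-- The filter quotient of a regular category is regular. -/
instance [Regular C] : Regular Φ.FilterQuotient where
  hasCoequalizer_of_isKernelPair {X Y Z f g₁ g₂} h := by
    induction X using projInduction with | h X
    induction Y using projInduction with | h Y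
    obtain ⟨U, hU, f₀, rfl⟩ := exists_eq_inv_fstIso_comp f
    obtain ⟨I, e, m, he, hm, rfl⟩ := exists_regularEpi_mono f₀
    have he : IsRegularEpi (Φ.proj.map e) :=
      isRegularEpi_proj_map Φ e fun U _ => isRegularEpi_prod_map_of_regular e U
    have he' : IsRegularEpi ((fstIso X hU).inv ≫ Φ.proj.map e) :=
      (MorphismProperty.cancel_left_of_respectsIso (MorphismProperty.regularEpi _) _ _).2 he
    rw [Functor.map_comp, ← Category.assoc] at h
    have h' := h.cancel_right_of_mono
    exact ⟨⟨⟨_, h'.toCoequalizer'⟩⟩⟩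
  regularEpiIsStableUnderBaseChange :=
    { of_isPullback := by
        intro X Y Y' S f g f' g' sq (hg : IsRegularEpi g)
        change IsRegularEpi g'
        induction X using projInduction with | h X
        induction Y using projInduction with | h Y
        induction S using projInduction with | h S
        -- Up to isomorphism, `g` is the image of `e ≫ m`, where `m` becomes an isomorphism. So the
        -- pullback of `g` is the image of the pullback of `e`, followed by an isomorphism.
        obtain ⟨U, hU, g₀, f₀, rfl, rfl, sq'⟩ := exists_isPullback g f
        obtain ⟨I, e, m, he, hm, rfl⟩ := exists_regularEpi_mono g₀
        have iso := (MorphismProperty.cancel_left_of_respectsIso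
          (MorphismProperty.regularEpi _) _ _).1 hg
        rw [MorphismProperty.regularEpi_iff, isRegularEpi_proj_map_comp_iff] at iso
        have sqm := IsPullback.of_hasPullback m f₀
        have sqe := IsPullback.of_right' (IsPullback.of_hasPullback (e ≫ m) f₀).flip sqm.flip
        have sqm' := isPullback_proj_map (Φ := Φ) sqm
        have : IsIso (Φ.proj.map (pullback.snd m f₀)) := sqm'.isIso_snd_of_isIso iso
        have hreg : IsRegularEpi (sqm.flip.lift (pullback.snd (e ≫ m) f₀)
            (pullback.fst (e ≫ m) f₀ ≫ e)
            ((IsPullback.of_hasPullback (e ≫ m) f₀).flip.w.trans (by simp))) :=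
          Regular.regularEpiIsStableUnderBaseChange.of_isPullback sqe.flip he
        have : IsRegularEpi (Φ.proj.map (pullback.snd (e ≫ m) f₀)) := by
          have := (isRegularEpi_proj_map_comp_iff (Φ := Φ) (sqm.flip.lift
            (pullback.snd (e ≫ m) f₀) (pullback.fst (e ≫ m) f₀ ≫ e)
            ((IsPullback.of_hasPullback (e ≫ m) f₀).flip.w.trans (by simp)))
            (pullback.snd m f₀)).2 inferInstance
          rwa [sqm.flip.lift_fst] at this
        have h' : IsRegularEpi (Φ.proj.map (pullback.snd (e ≫ m) f₀) ≫ (fstIso X hU).hom) :=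
          (MorphismProperty.cancel_right_of_respectsIso (MorphismProperty.regularEpi _) _ _).2 this
        have e' : g' = (sq.isoIsPullback _ _ sq').hom ≫
            Φ.proj.map (pullback.snd (e ≫ m) f₀) ≫ (fstIso X hU).hom := by
          simp
        rw [e']
        exact (MorphismProperty.cancel_left_of_respectsIso
          (MorphismProperty.regularEpi _) _ _).2 h' }

end Regular

/-! ### The filter quotient of a coherent category -/

section Coherent

variable {C : Type u₁} [Category.{v₁} C] [HasFiniteProducts C] {Φ : SubterminalFilter C}
  [IsCoherentCategory C]

lemma isLUB_mapSubobject_proj_of_coherent {X : C} {A B S : Subobject X} (hS : IsLUB {A, B} S) :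
    IsLUB {mapSubobject Φ.proj A, mapSubobject Φ.proj B} (mapSubobject Φ.proj S) :=
  isLUB_mapSubobject_proj hS fun _ _ => IsCoherentCategory.pullback_union _ _ _ _ hS

/-- The filter quotient of a coherent category is coherent. -/
instance : IsCoherentCategory Φ.FilterQuotient where
  exists_bot X := by
    induction X using projInduction with | h X
    obtain ⟨B, hB⟩ := IsCoherentCategory.exists_bot X
    exact ⟨_, isBot_mapSubobject_proj hB⟩
  exists_union X A B := by
    induction X using projInduction with | h X
    obtain ⟨A, rfl⟩ := mapSubobject_proj_surjective A
    obtain ⟨B, rfl⟩ := mapSubobject_proj_surjective B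
    obtain ⟨S, hS⟩ := IsCoherentCategory.exists_union X A B
    exact ⟨_, isLUB_mapSubobject_proj_of_coherent hS⟩
  pullback_bot {X Y} f B hB := by
    induction X using projInduction with | h X
    induction Y using projInduction with | h Y
    obtain ⟨U, hU, f₀, rfl⟩ := exists_eq_inv_fstIso_comp f
    obtain ⟨B₀, hB₀⟩ := IsCoherentCategory.exists_bot Y
    obtain rfl : B = mapSubobject Φ.proj B₀ :=
      le_antisymm (hB _) (isBot_mapSubobject_proj hB₀ _)
    rw [Subobject.pullback_comp, ← mapSubobject_pullback]
    have e (T : Subobject (Φ.proj.obj (X ⨯ U))) :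
        (Subobject.pullback (fstIso X hU).inv).obj T = pullbackOrderIso (fstIso X hU).symm T := rfl
    rw [e]
    refine fun T => ((pullbackOrderIso (fstIso X hU).symm).le_symm_apply).1 ?_
    exact isBot_mapSubobject_proj (IsCoherentCategory.pullback_bot f₀ _ hB₀) _
  pullback_union {X Y} f A B S hS := by
    induction X using projInduction with | h X
    induction Y using projInduction with | h Y
    obtain ⟨U, hU, f₀, rfl⟩ := exists_eq_inv_fstIso_comp f
    obtain ⟨A, rfl⟩ := mapSubobject_proj_surjective A
    obtain ⟨B, rfl⟩ := mapSubobject_proj_surjective B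
    obtain ⟨S₀, hS₀⟩ := IsCoherentCategory.exists_union Y A B
    obtain rfl : S = mapSubobject Φ.proj S₀ :=
      hS.unique (isLUB_mapSubobject_proj_of_coherent hS₀)
    rw [Subobject.pullback_comp, Subobject.pullback_comp, Subobject.pullback_comp,
      ← mapSubobject_pullback, ← mapSubobject_pullback, ← mapSubobject_pullback]
    have e (T : Subobject (Φ.proj.obj (X ⨯ U))) :
        (Subobject.pullback (fstIso X hU).inv).obj T = pullbackOrderIso (fstIso X hU).symm T := rfl
    rw [e, e, e]
    refine (OrderIso.isLUB_pair_iff (pullbackOrderIso (fstIso X hU).symm)).2 ?_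
    exact isLUB_mapSubobject_proj_of_coherent (IsCoherentCategory.pullback_union f₀ _ _ _ hS₀)

end Coherent

end SubterminalFilter

namespace SubterminalFilter

/-! ### Functors induced between filter quotients -/

section Induced

variable {C : Type u₁} [Category.{v₁} C] [HasFiniteProducts C] {Φ : SubterminalFilter C}
  {D : Type u₂} [Category.{v₂} D] [HasFiniteProducts D] {Ψ : SubterminalFilter D}
  (F : C ⥤ D) [PreservesFiniteProducts F] (hF : ∀ U, Φ.mem U → Ψ.mem (F.obj U))

lemma induced_map_proj_map {X Y : C} (f : X ⟶ Y) :
    (induced F hF).map (Φ.proj.map f) = Ψ.proj.map (F.map f) := by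
  refine Eq.trans ?_ (morOf_eq (F.map f) (hF _ Φ.mem_terminal)).symm
  change homMk (F.obj (⊤_ C)) _ (mapRep F (prod.fst ≫ f)) = _
  rw [mapRep, F.map_comp, ← Category.assoc, iso_inv_fst]

lemma induced_preservesFiniteProducts : PreservesFiniteProducts (induced F hF) := by
  refine preservesFiniteProducts_of_isLimit (T := Φ.proj.obj (⊤_ C)) _ isTerminalProj
    ((terminalIsTerminal.isTerminalObj F).isTerminalObj Ψ.proj) fun X Y => ?_
  induction X using projInduction with | h X
  induction Y using projInduction with | h Y
  refine ⟨_, _, _, ⟨isLimitProjFan X Y⟩, ?_⟩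
  rw [induced_map_proj_map, induced_map_proj_map]
  exact ⟨mapIsLimitOfPreservesOfIsLimit Ψ.proj _ _
    (mapIsLimitOfPreservesOfIsLimit F _ _ (prodIsProd X Y))⟩

lemma induced_preservesPullbacks [HasPullbacks C] [PreservesLimitsOfShape WalkingCospan F] :
    PreservesLimitsOfShape WalkingCospan (induced F hF) := by
  refine preservesLimitsOfShape_walkingCospan_of_isPullback _ fun {X Y Z} f g => ?_
  induction X using projInduction with | h X
  induction Y using projInduction with | h Y
  induction Z using projInduction with | h Z
  obtain ⟨U, hU, f₀, g₀, rfl, rfl, sq⟩ := exists_isPullback f g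
  refine ⟨_, _, _, sq, ?_⟩
  have sq' : IsPullback ((induced F hF).map (Φ.proj.map (pullback.fst f₀ g₀)))
      ((induced F hF).map (Φ.proj.map (pullback.snd f₀ g₀)))
      ((induced F hF).map (Φ.proj.map f₀)) ((induced F hF).map (Φ.proj.map g₀)) := by
    rw [induced_map_proj_map, induced_map_proj_map, induced_map_proj_map, induced_map_proj_map]
    exact isPullback_proj_map ((IsPullback.of_hasPullback f₀ g₀).map F)
  refine sq'.of_iso (Iso.refl _) ((induced F hF).mapIso (fstIso X hU))
    ((induced F hF).mapIso (fstIso Y hU)) (Iso.refl _) ?_ ?_ ?_ ?_ <;>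
    simp [← Functor.map_comp]

lemma induced_preservesFiniteLimits [HasFiniteLimits C] [PreservesFiniteLimits F] :
    PreservesFiniteLimits (induced F hF) := by
  have := induced_preservesFiniteProducts F hF
  have := induced_preservesPullbacks F hF
  exact preservesFiniteLimits_of_preservesTerminal_and_pullbacks _

lemma subobject_mk_congr {X A : C} {f g : A ⟶ X} (hf : Mono f) (hg : Mono g) (h : f = g) :
    Subobject.mk f = Subobject.mk g := by
  subst h
  rfl

lemma mapSubobject_induced [F.PreservesMonomorphisms] [(induced F hF).PreservesMonomorphisms]
    {X : C} (A : Subobject X) :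
    mapSubobject (induced F hF) (mapSubobject Φ.proj A) =
      mapSubobject Ψ.proj (mapSubobject F A) := by
  refine (mapSubobject_mk (induced F hF) (Φ.proj.map A.arrow)).trans
    (Eq.trans ?_ (mapSubobject_mk Ψ.proj (F.map A.arrow)).symm)
  exact subobject_mk_congr _ _ (induced_map_proj_map F hF A.arrow)

/-- A coherent functor with values in a cartesian closed category induces a coherent functor
between the filter quotients. -/
lemma isCoherentFunctor_induced [IsCoherentCategory C] [HasFiniteLimits D]
    [∀ X : D, (prod.functor.obj X).IsLeftAdjoint] (h : IsCoherentFunctor F) :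
    IsCoherentFunctor (induced F hF) := by
  have := h.preservesFiniteLimits
  have := induced_preservesFiniteLimits F hF
  refine ⟨inferInstance, fun {X Y} f hf => ?_, fun {X} B hB => ?_, fun {X} A B S hS => ?_⟩
  · induction X using projInduction with | h X
    induction Y using projInduction with | h Y
    obtain ⟨U, hU, f₀, rfl⟩ := exists_eq_inv_fstIso_comp f
    obtain ⟨I, e, m, he, hm, rfl⟩ := exists_regularEpi_mono f₀
    replace hf := (MorphismProperty.cancel_left_of_respectsIso
      (MorphismProperty.regularEpi _) _ _).1 hf
    rw [MorphismProperty.regularEpi_iff, isRegularEpi_proj_map_comp_iff] at hf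
    have hFe := h.map_regularEpi e he
    have he' : IsRegularEpi (Ψ.proj.map (F.map e)) :=
      isRegularEpi_proj_map Ψ _ fun U _ => isRegularEpi_prod_map_of_cartesianClosed _ U
    rw [← induced_map_proj_map F hF] at he'
    rw [Functor.map_comp, Functor.map_comp, Functor.map_comp]
    exact (MorphismProperty.cancel_left_of_respectsIso (MorphismProperty.regularEpi _) _ _).2
      ((MorphismProperty.cancel_right_of_respectsIso (MorphismProperty.regularEpi _) _ _).2 he')
  · induction X using projInduction with | h X
    obtain ⟨B₀, hB₀⟩ := IsCoherentCategory.exists_bot X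
    obtain rfl : B = mapSubobject Φ.proj B₀ :=
      le_antisymm (hB _) (isBot_mapSubobject_proj hB₀ _)
    rw [mapSubobject_induced]
    exact isBot_mapSubobject_proj (h.map_bot _ hB₀)
  · induction X using projInduction with | h X
    obtain ⟨A, rfl⟩ := mapSubobject_proj_surjective A
    obtain ⟨B, rfl⟩ := mapSubobject_proj_surjective B
    obtain ⟨S₀, hS₀⟩ := IsCoherentCategory.exists_union X A B
    obtain rfl : S = mapSubobject Φ.proj S₀ :=
      hS.unique (isLUB_mapSubobject_proj_of_coherent hS₀)
    rw [mapSubobject_induced, mapSubobject_induced, mapSubobject_induced]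
    have hF' := h.map_union _ _ _ hS₀
    exact isLUB_mapSubobject_proj hF' fun U hU => isLUB_pullback_fst hU hF'

end Induced

end SubterminalFilter

/-! ### Lattices and equality predicates -/

section Order

lemma PreservesFiniteMeetsAndJoins.comp {α : Type u₁} {β : Type u₂} {γ : Type u₃} [PartialOrder α]
    [PartialOrder β] [PartialOrder γ] {g : β → γ} {f : α → β} (hg : PreservesFiniteMeetsAndJoins g)
    (hf : PreservesFiniteMeetsAndJoins f) : PreservesFiniteMeetsAndJoins (g ∘ f) where
  monotone := hg.monotone.comp hf.monotone
  top t ht := hg.top _ (hf.top t ht)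
  bot b hb := hg.bot _ (hf.bot b hb)
  meet a b m h := hg.meet _ _ _ (hf.meet a b m h)
  join a b j h := hg.join _ _ _ (hf.join a b j h)

lemma OrderIso.preservesFiniteMeetsAndJoins {α : Type u₁} {β : Type u₂} [PartialOrder α]
    [PartialOrder β] (e : α ≃o β) : PreservesFiniteMeetsAndJoins e where
  monotone := e.monotone
  top _ ht b := e.symm_apply_le.1 (ht (e.symm b))
  bot _ hb b := e.le_symm_apply.1 (hb (e.symm b))
  meet _ _ _ h := e.isGLB_pair_iff.2 h
  join _ _ _ h := e.isLUB_pair_iff.2 h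

/-- Two equality predicates on the same object agree: if `e` and `e'` are two of them, substitute
along `e` in the proposition `e'`. -/
lemma IsEqualityPredicate.unique {T₀ : Type u₃} [Category.{v₃} T₀] [HasFiniteProducts T₀]
    {P : T₀ᵒᵖ ⥤ PartOrd.{w}} {X : T₀} {e e' : P.obj (op (X ⨯ X))}
    (h : IsEqualityPredicate P X e) (h' : IsEqualityPredicate P X e') : e = e' := by
  have le {e e' : P.obj (op (X ⨯ X))} (h : IsEqualityPredicate P X e)
      (h' : IsEqualityPredicate P X e') : e ≤ e' := by
    have := h.subst (prod.fst : X ⨯ X ⟶ X) prod.snd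
      (reindex P (prod.map prod.fst (𝟙 X)) e') e
    rw [reindex_comp, reindex_comp, Limits.prod.lift_map, Limits.prod.lift_map] at this
    simp only [Category.id_comp, Category.comp_id, prod.lift_fst_snd, reindex_id] at this
    exact this le_rfl (h'.refl _ _)
  exact le_antisymm (le h h') (le h' h)

end Order

namespace SubterminalFilter

/-! ### The filter quotient of a propositional coherent theory -/

section Theory

variable {C : Type u₁} [Category.{v₁} C] [HasFiniteProducts C] {Φ : SubterminalFilter C}
  {P : Cᵒᵖ ⥤ PartOrd.{w}}

/-- The proposition of the filter quotient represented by a proposition on `X ⨯ U`. -/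
def predOf {X U : C} (hU : Φ.mem U) (φ : P.obj (op (X ⨯ U))) :
    (Φ.quotientTheory P).obj (op (Φ.proj.obj X)) :=
  (predMk U hU φ : Φ.Pred P X)

lemma predOf_restrict {X U W : C} (hU : Φ.mem U) (hW : Φ.mem W) (a : W ⟶ U)
    (φ : P.obj (op (X ⨯ U))) : predOf hW (reindex P (prod.map (𝟙 X) a) φ) = predOf hU φ :=
  predMk_restrict hU hW a φ

/-- A proposition of the filter quotient is represented at some stage below a given one. -/
lemma exists_predOf {U₀ : C} (hU₀ : Φ.mem U₀) {X : C}
    (φ : (Φ.quotientTheory P).obj (op (Φ.proj.obj X))) :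
    ∃ (U : C) (hU : Φ.mem U) (_ : U ⟶ U₀) (φ₀ : P.obj (op (X ⨯ U))), φ = predOf hU φ₀ := by
  obtain ⟨V, hV, φ₀, rfl⟩ := exists_predMk (X := X) φ
  exact ⟨U₀ ⨯ V, Φ.mem_prod hU₀ hV, prod.fst, reindex P (prod.map (𝟙 X) prod.snd) φ₀,
    (predOf_restrict hV _ _ _).symm⟩

lemma exists_predOf₂ {U₀ : C} (hU₀ : Φ.mem U₀) {X Y : C}
    (φ : (Φ.quotientTheory P).obj (op (Φ.proj.obj X)))
    (ψ : (Φ.quotientTheory P).obj (op (Φ.proj.obj Y))) :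
    ∃ (U : C) (hU : Φ.mem U) (_ : U ⟶ U₀) (φ₀ : P.obj (op (X ⨯ U))) (ψ₀ : P.obj (op (Y ⨯ U))),
      φ = predOf hU φ₀ ∧ ψ = predOf hU ψ₀ := by
  obtain ⟨U, hU, a, φ₀, rfl⟩ := exists_predOf hU₀ φ
  obtain ⟨W, hW, b, ψ₀, rfl⟩ := exists_predOf hU ψ
  exact ⟨W, hW, b ≫ a, reindex P (prod.map (𝟙 X) b) φ₀, ψ₀, (predOf_restrict hU hW b _).symm, rfl⟩

lemma predOf_le_iff {X U : C} (hU : Φ.mem U) (φ ψ : P.obj (op (X ⨯ U))) :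
    predOf hU φ ≤ predOf hU ψ ↔ ∃ (W : C) (_ : Φ.mem W) (a : W ⟶ U),
      reindex P (prod.map (𝟙 X) a) φ ≤ reindex P (prod.map (𝟙 X) a) ψ := by
  constructor
  · rintro ⟨W, hW, a, b, h⟩
    obtain rfl : a = b := Φ.subterminal _ hU _ _
    exact ⟨W, hW, a, h⟩
  · rintro ⟨W, hW, a, h⟩
    exact ⟨W, hW, a, a, h⟩

lemma predOf_mono {X U : C} (hU : Φ.mem U) {φ ψ : P.obj (op (X ⨯ U))} (h : φ ≤ ψ) :
    predOf hU φ ≤ predOf hU ψ :=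
  (predOf_le_iff hU φ ψ).2 ⟨U, hU, 𝟙 U, reindex_mono P _ h⟩

lemma reindex_stageHom {X Y U : C} (hU : Φ.mem U) (f : X ⨯ U ⟶ Y ⨯ U) (φ : P.obj (op (Y ⨯ U))) :
    reindex (Φ.quotientTheory P) (stageHom hU f) (predOf hU φ) = predOf hU (reindex P f φ) := by
  refine (predMap_mk hU (f ≫ prod.fst) φ).trans ?_
  have : prod.lift (f ≫ prod.fst) prod.snd = f := stage_hom_ext hU (by simp)
  rw [this]
  rfl

lemma reindex_repHom {X Y U : C} (hU : Φ.mem U) (f : X ⨯ U ⟶ Y) (φ : P.obj (op (Y ⨯ U))) :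
    reindex (Φ.quotientTheory P) (repHom hU f) (predOf hU φ) =
      predOf hU (reindex P (prod.lift f prod.snd) φ) :=
  predMap_mk hU f φ

/-- If the entailment `α ∧ β ⊢ γ` holds after restriction to every smaller stage, then it holds in
the filter quotient. -/
lemma predOf_entails {X U : C} (hU : Φ.mem U) (α β γ : P.obj (op (X ⨯ U)))
    (h : ∀ {W : C} (_ : Φ.mem W) (a : W ⟶ U) (θ : P.obj (op (X ⨯ W))),
      θ ≤ reindex P (prod.map (𝟙 X) a) α → θ ≤ reindex P (prod.map (𝟙 X) a) β →
        θ ≤ reindex P (prod.map (𝟙 X) a) γ)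
    (χ : (Φ.quotientTheory P).obj (op (Φ.proj.obj X))) (hα : χ ≤ predOf hU α)
    (hβ : χ ≤ predOf hU β) : χ ≤ predOf hU γ := by
  obtain ⟨V, hV, v, χ, rfl⟩ := exists_predOf hU χ
  rw [← predOf_restrict hU hV v, predOf_le_iff] at hα hβ ⊢
  obtain ⟨W, hW, a, hα⟩ := hα
  obtain ⟨W', hW', a', hβ⟩ := hβ
  have e : (prod.snd ≫ a' : W ⨯ W' ⟶ V) = prod.fst ≫ a := Φ.subterminal _ hV _ _
  replace hα := reindex_mono P (prod.map (𝟙 X) (prod.fst : W ⨯ W' ⟶ W)) hα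
  replace hβ := reindex_mono P (prod.map (𝟙 X) (prod.snd : W ⨯ W' ⟶ W')) hβ
  simp only [reindex_comp, ← map_id_comp] at hα hβ
  rw [← Category.assoc, e, Category.assoc] at hβ
  refine ⟨W ⨯ W', Φ.mem_prod hW hW', prod.fst ≫ a, ?_⟩
  simp only [reindex_comp, ← map_id_comp]
  simp only [Category.assoc] at hα hβ ⊢
  exact h (Φ.mem_prod hW hW') _ _ hα hβ

variable (hP : IsPropositionalCoherentTheory P)

include hP

/-- The passage from the propositions at some stage to the filter quotient preserves finite meets
and joins, since it is the passage to a filtered colimit along lattice homomorphisms. -/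
lemma predOf_preserves {X U : C} (hU : Φ.mem U) :
    PreservesFiniteMeetsAndJoins (predOf (P := P) (X := X) hU) where
  monotone _ _ h := predOf_mono hU h
  top t ht φ := by
    obtain ⟨V, hV, v, φ, rfl⟩ := exists_predOf hU φ
    rw [← predOf_restrict hU hV v]
    exact predOf_mono hV ((hP.reindex _).top t ht _)
  bot b hb φ := by
    obtain ⟨V, hV, v, φ, rfl⟩ := exists_predOf hU φ
    rw [← predOf_restrict hU hV v]
    exact predOf_mono hV ((hP.reindex _).bot b hb _)
  meet a b m hm := by
    have hm' := isGLB_pair_iff.1 hm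
    refine isGLB_pair_iff.2 ⟨predOf_mono hU hm'.1, predOf_mono hU hm'.2.1, fun c ha hb => ?_⟩
    refine predOf_entails hU a b m (fun hW u θ h₁ h₂ => ?_) c ha hb
    exact (isGLB_pair_iff.1 ((hP.reindex _).meet _ _ _ hm)).2.2 θ h₁ h₂
  join a b j hj := by
    have hj' := isLUB_pair_iff.1 hj
    refine isLUB_pair_iff.2 ⟨predOf_mono hU hj'.1, predOf_mono hU hj'.2.1, fun c ha hb => ?_⟩
    obtain ⟨V, hV, v, c, rfl⟩ := exists_predOf hU c
    rw [← predOf_restrict hU hV v, predOf_le_iff] at ha hb ⊢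
    obtain ⟨W, hW, u, ha⟩ := ha
    obtain ⟨W', hW', u', hb⟩ := hb
    have e : (prod.snd ≫ u' : W ⨯ W' ⟶ V) = prod.fst ≫ u := Φ.subterminal _ hV _ _
    replace ha := reindex_mono P (prod.map (𝟙 X) (prod.fst : W ⨯ W' ⟶ W)) ha
    replace hb := reindex_mono P (prod.map (𝟙 X) (prod.snd : W ⨯ W' ⟶ W')) hb
    refine ⟨W ⨯ W', Φ.mem_prod hW hW', prod.fst ≫ u, ?_⟩
    simp only [reindex_comp, ← map_id_comp] at ha hb ⊢
    rw [← Category.assoc, e] at hb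
    simp only [Category.assoc] at ha hb ⊢
    exact (isLUB_pair_iff.1 ((hP.reindex _).join _ _ _ hj)).2.2 _ ha hb

lemma quotientTheory_lattice (X : C) :
    IsBoundedDistribLattice ((Φ.quotientTheory P).obj (op (Φ.proj.obj X))) where
  exists_top := by
    obtain ⟨t, ht⟩ := (hP.lattice (X ⨯ ⊤_ C)).exists_top
    exact ⟨_, (predOf_preserves hP Φ.mem_terminal).top t ht⟩
  exists_bot := by
    obtain ⟨b, hb⟩ := (hP.lattice (X ⨯ ⊤_ C)).exists_bot
    exact ⟨_, (predOf_preserves hP Φ.mem_terminal).bot b hb⟩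
  exists_meet a b := by
    obtain ⟨U, hU, -, a, b, rfl, rfl⟩ := exists_predOf₂ Φ.mem_terminal a b
    obtain ⟨m, hm⟩ := (hP.lattice (X ⨯ U)).exists_meet a b
    exact ⟨_, (predOf_preserves hP hU).meet _ _ _ hm⟩
  exists_join a b := by
    obtain ⟨U, hU, -, a, b, rfl, rfl⟩ := exists_predOf₂ Φ.mem_terminal a b
    obtain ⟨m, hm⟩ := (hP.lattice (X ⨯ U)).exists_join a b
    exact ⟨_, (predOf_preserves hP hU).join _ _ _ hm⟩
  distrib a b c j m m₁ m₂ hj hm h₁ h₂ := by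
    obtain ⟨V, hV, -, a, b, rfl, rfl⟩ := exists_predOf₂ Φ.mem_terminal a b
    obtain ⟨U, hU, u, c, rfl⟩ := exists_predOf hV c
    rw [← predOf_restrict hV hU u] at hj hm h₁ h₂
    rw [← predOf_restrict hV hU u] at h₁
    generalize reindex P (prod.map (𝟙 X) u) a = a, reindex P (prod.map (𝟙 X) u) b = b
      at hj hm h₁ h₂
    have L := hP.lattice (X ⨯ U)
    have Q := predOf_preserves (X := X) hP hU
    obtain ⟨j₀, hj₀⟩ := L.exists_join b c
    obtain rfl := hj.unique (Q.join _ _ _ hj₀)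
    obtain ⟨m₀, hm₀⟩ := L.exists_meet a j₀
    obtain rfl := hm.unique (Q.meet _ _ _ hm₀)
    obtain ⟨n₁, hn₁⟩ := L.exists_meet a b
    obtain rfl := h₁.unique (Q.meet _ _ _ hn₁)
    obtain ⟨n₂, hn₂⟩ := L.exists_meet a c
    obtain rfl := h₂.unique (Q.meet _ _ _ hn₂)
    exact Q.join _ _ _ (L.distrib _ _ _ _ _ _ _ hj₀ hm₀ hn₁ hn₂)

/-- A map on the propositions of the filter quotient preserves finite meets and joins if it does so
at all sufficiently small stages. -/
lemma preserves_of_predOf {β : Type*} [PartialOrder β] {X U₀ : C} (hU₀ : Φ.mem U₀)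
    (f : (Φ.quotientTheory P).obj (op (Φ.proj.obj X)) → β)
    (h : ∀ {U : C} (hU : Φ.mem U) (_ : U ⟶ U₀),
      PreservesFiniteMeetsAndJoins (f ∘ predOf (P := P) (X := X) hU)) :
    PreservesFiniteMeetsAndJoins f where
  monotone a b hab := by
    obtain ⟨U, hU, u, a, b, rfl, rfl⟩ := exists_predOf₂ hU₀ a b
    obtain ⟨W, hW, v, hab⟩ := (predOf_le_iff hU _ _).1 hab
    rw [← predOf_restrict hU hW v a, ← predOf_restrict hU hW v b]
    exact (h hW (v ≫ u)).monotone hab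
  top t ht := by
    obtain ⟨t₀, ht₀⟩ := (hP.lattice (X ⨯ U₀)).exists_top
    obtain rfl : t = predOf hU₀ t₀ := le_antisymm ((predOf_preserves hP hU₀).top _ ht₀ _) (ht _)
    exact (h hU₀ (𝟙 _)).top _ ht₀
  bot t ht := by
    obtain ⟨t₀, ht₀⟩ := (hP.lattice (X ⨯ U₀)).exists_bot
    obtain rfl : t = predOf hU₀ t₀ := le_antisymm (ht _) ((predOf_preserves hP hU₀).bot _ ht₀ _)
    exact (h hU₀ (𝟙 _)).bot _ ht₀
  meet a b m hm := by
    obtain ⟨U, hU, u, a, b, rfl, rfl⟩ := exists_predOf₂ hU₀ a b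
    obtain ⟨m₀, hm₀⟩ := (hP.lattice (X ⨯ U)).exists_meet a b
    obtain rfl := hm.unique ((predOf_preserves hP hU).meet _ _ _ hm₀)
    exact (h hU u).meet _ _ _ hm₀
  join a b m hm := by
    obtain ⟨U, hU, u, a, b, rfl, rfl⟩ := exists_predOf₂ hU₀ a b
    obtain ⟨m₀, hm₀⟩ := (hP.lattice (X ⨯ U)).exists_join a b
    obtain rfl := hm.unique ((predOf_preserves hP hU).join _ _ _ hm₀)
    exact (h hU u).join _ _ _ hm₀

lemma quotientTheory_reindex {X Y : C} (f : Φ.proj.obj X ⟶ Φ.proj.obj Y) :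
    PreservesFiniteMeetsAndJoins (reindex (Φ.quotientTheory P) f) := by
  obtain ⟨U, hU, f, rfl⟩ := exists_stageHom f
  refine preserves_of_predOf hP hU _ fun {W} hW a => ?_
  rw [← stageHom_restrict hU hW a]
  have : reindex (Φ.quotientTheory P) (stageHom hW (restrict a f)) ∘ predOf hW =
      predOf hW ∘ reindex P (restrict a f) := funext (reindex_stageHom hW _)
  rw [this]
  exact (predOf_preserves hP hW).comp (hP.reindex _)

end Theory

end SubterminalFilter

namespace SubterminalFilter

/-! ### Equality predicates and intervals in the filter quotient of a theory -/

section Equality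

variable {C : Type u₁} [Category.{v₁} C] [HasFiniteProducts C] {Φ : SubterminalFilter C}
  {P : Cᵒᵖ ⥤ PartOrd.{w}}

variable (Φ) in
/-- The image in the filter quotient of a proposition of the theory. -/
noncomputable def projPred {X : C} (φ : P.obj (op X)) :
    (Φ.quotientTheory P).obj (op (Φ.proj.obj X)) :=
  predOf Φ.mem_terminal (reindex P prod.fst φ)

lemma projPred_eq_predOf {X U : C} (hU : Φ.mem U) (φ : P.obj (op X)) :
    Φ.projPred φ = predOf hU (reindex P prod.fst φ) := by
  rw [projPred, ← predOf_restrict Φ.mem_terminal hU (terminal.from U), reindex_comp, prod.map_fst,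
    Category.comp_id]

lemma reindex_repHom_projPred {X Y U : C} (hU : Φ.mem U) (f : X ⨯ U ⟶ Y) (φ : P.obj (op Y)) :
    reindex (Φ.quotientTheory P) (repHom hU f) (Φ.projPred φ) = predOf hU (reindex P f φ) := by
  rw [projPred_eq_predOf hU, reindex_repHom, reindex_comp, Limits.prod.lift_fst]

variable (Φ) in
/-- The relation in the filter quotient which is induced by a relation of the theory. -/
noncomputable def projRel {X Y : C} (r : P.obj (op (X ⨯ Y))) :
    (Φ.quotientTheory P).obj (op (Φ.proj.obj X ⨯ Φ.proj.obj Y)) :=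
  reindex (Φ.quotientTheory P) (prodIso X Y).hom (Φ.projPred r)

lemma lift_repHom {Γ X Y U : C} (hU : Φ.mem U) (s : Γ ⨯ U ⟶ X) (t : Γ ⨯ U ⟶ Y) :
    prod.lift (repHom hU s) (repHom hU t) ≫ (prodIso X Y).hom = repHom hU (prod.lift s t) := by
  apply map_prod_hom_ext Φ.proj
  · rw [Category.assoc, prodIso_hom_fst, Limits.prod.lift_fst, repHom_comp_map,
      Limits.prod.lift_fst]
  · rw [Category.assoc, prodIso_hom_snd, Limits.prod.lift_snd, repHom_comp_map,
      Limits.prod.lift_snd]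

lemma reindex_lift_projRel {Γ X Y U : C} (hU : Φ.mem U) (s : Γ ⨯ U ⟶ X) (t : Γ ⨯ U ⟶ Y)
    (r : P.obj (op (X ⨯ Y))) :
    reindex (Φ.quotientTheory P) (prod.lift (repHom hU s) (repHom hU t)) (Φ.projRel r) =
      predOf hU (reindex P (prod.lift s t) r) := by
  rw [projRel, reindex_comp, lift_repHom, reindex_repHom_projPred]

/-- Every proposition on a product in the filter quotient comes from a stage. -/
lemma exists_eq_reindex_prodIso_predOf {U₀ : C} (hU₀ : Φ.mem U₀) {X Y : C}
    (ψ : (Φ.quotientTheory P).obj (op (Φ.proj.obj X ⨯ Φ.proj.obj Y))) :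
    ∃ (U : C) (hU : Φ.mem U) (_ : U ⟶ U₀) (ψ₀ : P.obj (op ((X ⨯ Y) ⨯ U))),
      ψ = reindex (Φ.quotientTheory P) (prodIso X Y).hom (predOf hU ψ₀) := by
  obtain ⟨U, hU, a, ψ₀, h⟩ :=
    exists_predOf hU₀ (reindex (Φ.quotientTheory P) (prodIso X Y).inv ψ)
  refine ⟨U, hU, a, ψ₀, ?_⟩
  rw [← h, reindex_comp, Iso.hom_inv_id, reindex_id]

lemma reindex_lift_prodIso {Γ X U : C} (hU : Φ.mem U) (s : Γ ⨯ U ⟶ X)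
    (ψ : P.obj (op ((Γ ⨯ X) ⨯ U))) :
    reindex (Φ.quotientTheory P) (prod.lift (𝟙 (Φ.proj.obj Γ)) (repHom hU s))
        (reindex (Φ.quotientTheory P) (prodIso Γ X).hom (predOf hU ψ)) =
      predOf hU (reindex P (prod.lift (prod.lift prod.fst s) prod.snd) ψ) := by
  have h : 𝟙 (Φ.proj.obj Γ) = repHom hU prod.fst := by
    rw [← Φ.proj.map_id, map_eq_repHom hU, Category.comp_id]
  rw [reindex_comp, h, lift_repHom, reindex_repHom]

lemma exists_repHom₃ {Γ X Y Z : C} (x : Φ.proj.obj Γ ⟶ Φ.proj.obj X)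
    (y : Φ.proj.obj Γ ⟶ Φ.proj.obj Y) (z : Φ.proj.obj Γ ⟶ Φ.proj.obj Z) :
    ∃ (U : C) (hU : Φ.mem U) (x₀ : Γ ⨯ U ⟶ X) (y₀ : Γ ⨯ U ⟶ Y) (z₀ : Γ ⨯ U ⟶ Z),
      x = repHom hU x₀ ∧ y = repHom hU y₀ ∧ z = repHom hU z₀ := by
  obtain ⟨U, hU, x, y, rfl, rfl⟩ := exists_repHom₂ x y
  obtain ⟨V, hV, z, rfl⟩ := exists_repHom z
  have hUV := Φ.mem_prod hU hV
  exact ⟨U ⨯ V, hUV, _, _, _, (repHom_restrict hU hUV prod.fst x).symm,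
    (repHom_restrict hU hUV prod.fst y).symm, (repHom_restrict hV hUV prod.snd z).symm⟩

lemma terminal_from_comp_eq_repHom {Γ I U : C} (hU : Φ.mem U) (z : ⊤_ C ⟶ I) :
    terminal.from (Φ.proj.obj Γ) ≫ isTerminalProj.from (⊤_ Φ.FilterQuotient) ≫ Φ.proj.map z =
      repHom hU (terminal.from (Γ ⨯ U) ≫ z) := by
  have : terminal.from (Φ.proj.obj Γ) ≫ isTerminalProj.from (⊤_ Φ.FilterQuotient) =
      Φ.proj.map (terminal.from Γ) := isTerminalProj.hom_ext _ _
  rw [← Category.assoc, this, ← Functor.map_comp, map_eq_repHom hU, ← Category.assoc]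
  congr 2
  exact Subsingleton.elim _ _

variable (hP : IsPropositionalCoherentTheory P)

include hP

lemma projRel_isEqualityPredicate {X : C} {e : P.obj (op (X ⨯ X))}
    (he : IsEqualityPredicate P X e) :
    IsEqualityPredicate (Φ.quotientTheory P) (Φ.proj.obj X) (Φ.projRel e) where
  refl {Γ} t := by
    induction Γ using projInduction with | h Γ
    obtain ⟨U, hU, t, rfl⟩ := exists_repHom t
    rw [reindex_lift_projRel]
    exact (predOf_preserves hP hU).top _ (he.refl t)
  subst {Γ} s t ψ χ h₁ h₂ := by
    induction Γ using projInduction with | h Γ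
    obtain ⟨V, hV, s, t, rfl, rfl⟩ := exists_repHom₂ s t
    obtain ⟨U, hU, u, ψ, rfl⟩ := exists_eq_reindex_prodIso_predOf hV ψ
    rw [← repHom_restrict hV hU u s] at h₁ h₂
    rw [← repHom_restrict hV hU u t] at h₁ ⊢
    generalize prod.map (𝟙 Γ) u ≫ s = s, prod.map (𝟙 Γ) u ≫ t = t at h₁ h₂ ⊢
    rw [reindex_lift_projRel] at h₁
    rw [reindex_lift_prodIso] at h₂ ⊢
    refine predOf_entails hU _ _ _ (fun {W} hW a θ h₁ h₂ => ?_) χ h₁ h₂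
    -- At the stage `W`, substitute in the context `Γ ⨯ W`, which provides the parameter of the
    -- proposition `ψ` on `(Γ ⨯ X) ⨯ U`.
    have key := he.subst (prod.map (𝟙 Γ) a ≫ s) (prod.map (𝟙 Γ) a ≫ t)
      (reindex P (prod.lift (prod.lift (prod.fst ≫ prod.fst) prod.snd)
        (prod.fst ≫ prod.snd ≫ a)) ψ) θ
    have e (r : Γ ⨯ U ⟶ X) :
        reindex P (prod.lift (𝟙 (Γ ⨯ W)) (prod.map (𝟙 Γ) a ≫ r))
          (reindex P (prod.lift (prod.lift (prod.fst ≫ prod.fst) prod.snd)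
            (prod.fst ≫ prod.snd ≫ a)) ψ) =
        reindex P (prod.map (𝟙 Γ) a)
          (reindex P (prod.lift (prod.lift prod.fst r) prod.snd) ψ) := by
      rw [reindex_comp, reindex_comp]
      congr 1
      ext <;> simp
    rw [e, e] at key
    refine key ?_ h₂
    rwa [← prod.comp_lift, ← reindex_comp]

/-- The filter quotient of a propositional coherent theory is one. -/
lemma quotientTheory_isPropositionalCoherentTheory :
    IsPropositionalCoherentTheory (Φ.quotientTheory P) where
  lattice X := quotientTheory_lattice hP X.as
  reindex {X Y} f := quotientTheory_reindex (X := X.as) (Y := Y.as) hP f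
  equality X := by
    induction X using projInduction with | h X
    obtain ⟨e, he⟩ := hP.equality X
    exact ⟨_, projRel_isEqualityPredicate hP he⟩

/-- A strict interval in a theory gives one in its filter quotient. -/
noncomputable def strictInterval (I : StrictInterval P) : StrictInterval (Φ.quotientTheory P) where
  I := Φ.proj.obj I.I
  zero := isTerminalProj.from _ ≫ Φ.proj.map I.zero
  one := isTerminalProj.from _ ≫ Φ.proj.map I.one
  le := Φ.projRel I.le
  eq := Φ.projRel I.eq
  isEqualityPredicate := projRel_isEqualityPredicate hP I.isEqualityPredicate
  refl {Γ} x := by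
    induction Γ using projInduction with | h Γ
    obtain ⟨U, hU, x, rfl⟩ := exists_repHom x
    rw [reindex_lift_projRel]
    exact (predOf_preserves hP hU).top _ (I.refl x)
  trans {Γ} x y z χ := by
    induction Γ using projInduction with | h Γ
    obtain ⟨U, hU, x, y, z, rfl, rfl, rfl⟩ := exists_repHom₃ x y z
    simp only [reindex_lift_projRel]
    refine predOf_entails hU _ _ _ (fun {W} hW a θ => ?_) χ
    simp only [reindex_comp, prod.comp_lift]
    exact I.trans _ _ _ θ
  antisymm {Γ} x y χ := by
    induction Γ using projInduction with | h Γ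
    obtain ⟨U, hU, x, y, rfl, rfl⟩ := exists_repHom₂ x y
    simp only [reindex_lift_projRel]
    refine predOf_entails hU _ _ _ (fun {W} hW a θ => ?_) χ
    simp only [reindex_comp, prod.comp_lift]
    exact I.antisymm _ _ θ
  total {Γ} x y j hj := by
    induction Γ using projInduction with | h Γ
    obtain ⟨U, hU, x, y, rfl, rfl⟩ := exists_repHom₂ x y
    rw [reindex_lift_projRel, reindex_lift_projRel] at hj
    obtain ⟨j₀, hj₀⟩ := (hP.lattice (Γ ⨯ U)).exists_join (reindex P (prod.lift x y) I.le)
      (reindex P (prod.lift y x) I.le)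
    obtain rfl := hj.unique ((predOf_preserves hP hU).join _ _ _ hj₀)
    exact (predOf_preserves hP hU).top _ (I.total x y j₀ hj₀)
  zero_le {Γ} x := by
    induction Γ using projInduction with | h Γ
    obtain ⟨U, hU, x, rfl⟩ := exists_repHom x
    rw [terminal_from_comp_eq_repHom hU, reindex_lift_projRel]
    exact (predOf_preserves hP hU).top _ (I.zero_le x)
  le_one {Γ} x := by
    induction Γ using projInduction with | h Γ
    obtain ⟨U, hU, x, rfl⟩ := exists_repHom x
    rw [terminal_from_comp_eq_repHom hU, reindex_lift_projRel]
    exact (predOf_preserves hP hU).top _ (I.le_one x)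
  zero_ne_one := by
    -- The context `⊤_` of the filter quotient is replaced by the image of the one of `C`.
    have h : IsBot (reindex (Φ.quotientTheory P) (prod.lift (Φ.proj.map I.zero) (Φ.proj.map I.one))
        (Φ.projRel I.eq)) := by
      rw [map_eq_repHom Φ.mem_terminal I.zero, map_eq_repHom Φ.mem_terminal I.one,
        reindex_lift_projRel, ← prod.comp_lift, ← reindex_comp]
      exact (predOf_preserves hP _).bot _ ((hP.reindex _).bot _ I.zero_ne_one)
    rw [← prod.comp_lift, ← reindex_comp]
    exact ((quotientTheory_isPropositionalCoherentTheory hP).reindex _).bot _ h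

end Equality

end SubterminalFilter

/-! ### The induced interpretation of the filter quotient of a theory -/

/-- A functor which preserves pullbacks preserves the intersections of subobjects. -/
lemma isGLB_mapSubobject {C : Type u₁} [Category.{v₁} C] {D : Type u₂} [Category.{v₂} D]
    (F : C ⥤ D) [F.PreservesMonomorphisms] [HasPullbacks C]
    [PreservesLimitsOfShape WalkingCospan F] {X : C} {A B S : Subobject X}
    (h : IsGLB {A, B} S) : IsGLB {mapSubobject F A, mapSubobject F B} (mapSubobject F S) := by
  rw [isGLB_pair_iff] at h
  refine isGLB_pair_iff.2 ⟨mapSubobject_mono F h.1, mapSubobject_mono F h.2.1, fun T hA hB => ?_⟩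
  have sq := IsPullback.of_hasPullback A.arrow B.arrow
  have key : Subobject.mk (pullback.fst A.arrow B.arrow ≫ A.arrow) ≤ S := by
    refine h.2.2 _ (Subobject.mk_le_of_comm _ rfl) (Subobject.mk_le_of_comm _ sq.w.symm)
  refine le_trans ?_ (mapSubobject_mono F key)
  obtain ⟨a, ha⟩ : ∃ a : (T : D) ⟶ F.obj (A : C), a ≫ F.map A.arrow = T.arrow :=
    ⟨Subobject.ofLEMk _ _ hA, Subobject.ofLEMk_comp hA⟩
  obtain ⟨b, hb⟩ : ∃ b : (T : D) ⟶ F.obj (B : C), b ≫ F.map B.arrow = T.arrow :=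
    ⟨Subobject.ofLEMk _ _ hB, Subobject.ofLEMk_comp hB⟩
  rw [mapSubobject_mk]
  refine Subobject.le_mk_of_comm ((sq.map F).lift a b (ha.trans hb.symm)) ?_
  rw [F.map_comp, IsPullback.lift_fst_assoc, ha]

lemma isTop_mapSubobject {C : Type u₁} [Category.{v₁} C] {D : Type u₂} [Category.{v₂} D]
    (F : C ⥤ D) [F.PreservesMonomorphisms] {X : C} {A : Subobject X} (h : IsTop A) :
    IsTop (mapSubobject F A) := by
  have e : mapSubobject F A = ⊤ := by
    rw [h.eq_top, Subobject.top_eq_id, mapSubobject_mk, ← Subobject.isIso_iff_mk_eq_top]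
    infer_instance
  rw [e]
  exact isTop_top

namespace SubterminalFilter

lemma mapSubobject_proj_preserves {D : Type u₂} [Category.{v₂} D] [HasFiniteProducts D]
    [IsCoherentCategory D] {Ψ : SubterminalFilter D} (X : D) :
    PreservesFiniteMeetsAndJoins
      (mapSubobject Ψ.proj : Subobject X → Subobject (Ψ.proj.obj X)) where
  monotone := mapSubobject_mono Ψ.proj
  top _ := isTop_mapSubobject Ψ.proj
  bot _ := isBot_mapSubobject_proj
  meet _ _ _ := isGLB_mapSubobject Ψ.proj
  join _ _ _ := isLUB_mapSubobject_proj_of_coherent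

section Interpretation

variable {C : Type u₁} [Category.{v₁} C] [HasFiniteProducts C] {Φ : SubterminalFilter C}
  {P : Cᵒᵖ ⥤ PartOrd.{w}}
  {D : Type u₂} [Category.{v₂} D] [HasFiniteProducts D] {Ψ : SubterminalFilter D}
  (F : C ⥤ D) [PreservesFiniteProducts F] (hF : ∀ U, Φ.mem U → Ψ.mem (F.obj U))

/-- The isomorphism `F (X ⨯ U) ≅ F X` in the filter quotient. -/
noncomputable def mapFstIso (X : C) {U : C} (hU : Φ.mem U) :
    Ψ.proj.obj (F.obj (X ⨯ U)) ≅ (induced F hF).obj (Φ.proj.obj X) :=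
  (induced F hF).mapIso (fstIso X hU)

lemma mapFstIso_hom (X : C) {U : C} (hU : Φ.mem U) :
    (mapFstIso F hF X hU).hom = Ψ.proj.map (F.map prod.fst) :=
  induced_map_proj_map F hF _

lemma mapFstIso_hom_comp_map_stageHom {X Y U : C} (hU : Φ.mem U) (f : X ⨯ U ⟶ Y ⨯ U) :
    (mapFstIso F hF X hU).hom ≫ (induced F hF).map (stageHom hU f) =
      Ψ.proj.map (F.map f) ≫ (mapFstIso F hF Y hU).hom :=
  ((induced F hF).map_comp _ _).symm.trans
    ((congrArg (induced F hF).map (fst_comp_stageHom hU f)).trans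
      (((induced F hF).map_comp _ _).trans
        (congrArg (· ≫ (mapFstIso F hF Y hU).hom) (induced_map_proj_map F hF f))))

variable [HasPullbacks D]

/-- The pullback of `subMk F hF hU A` to `F (X ⨯ U)` is `A`. -/
lemma pullback_subMk {X U : C} (hU : Φ.mem U) (A : Subobject (F.obj (X ⨯ U))) :
    (Subobject.pullback (Ψ.proj.map (F.map prod.fst))).obj (subMk F hF hU A) =
      mapSubobject Ψ.proj A := by
  have := mono_map_fst F hF X hU
  have e : subMk F hF hU A =
      mapSubobject Ψ.proj ((Subobject.map (F.map (prod.fst : X ⨯ U ⟶ X))).obj A) := by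
    conv_rhs => rw [← Subobject.mk_arrow A, Subobject.map_mk, mapSubobject_mk]
    rfl
  rw [e, ← mapSubobject_pullback, Subobject.pullback_map_self]

variable (m : ∀ X : C, P.obj (op X) → Subobject (F.obj X)) (hm : ∀ X, Monotone (m X))
  (hnat : ∀ {X Y : C} (f : X ⟶ Y) (φ : P.obj (op Y)),
    m X (reindex P f φ) = (Subobject.pullback (F.map f)).obj (m Y φ))

/-- The interpretation `quotientInterp`, as a map between the propositions and the subobjects of
the filter quotients. -/
noncomputable def inducedInterp (X : Φ.FilterQuotient) (φ : (Φ.quotientTheory P).obj (op X)) :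
    Subobject ((induced F hF).obj X) :=
  quotientInterp F hF m hm hnat X.as φ

lemma pullback_inducedInterp_predOf {X U : C} (hU : Φ.mem U) (φ : P.obj (op (X ⨯ U))) :
    pullbackOrderIso (mapFstIso F hF X hU)
        (inducedInterp F hF m hm hnat (Φ.proj.obj X) (predOf hU φ)) =
      mapSubobject Ψ.proj (m _ φ) := by
  rw [pullbackOrderIso_apply, mapFstIso_hom]
  exact pullback_subMk F hF hU (m _ φ)

lemma inducedInterp_projPred {X : C} (φ : P.obj (op X)) :
    inducedInterp F hF m hm hnat (Φ.proj.obj X) (Φ.projPred φ) =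
      mapSubobject Ψ.proj (m X φ) := by
  apply (pullbackOrderIso (mapFstIso F hF X Φ.mem_terminal)).injective
  rw [projPred, pullback_inducedInterp_predOf, hnat, mapSubobject_pullback]
  exact (congrArg (fun k => (Subobject.pullback k).obj (mapSubobject Ψ.proj (m X φ)))
    (mapFstIso_hom F hF X Φ.mem_terminal)).symm

lemma inducedInterp_reindex {X Y : Φ.FilterQuotient} (f : X ⟶ Y)
    (φ : (Φ.quotientTheory P).obj (op Y)) :
    inducedInterp F hF m hm hnat X (reindex (Φ.quotientTheory P) f φ) =
      (Subobject.pullback ((induced F hF).map f)).obj (inducedInterp F hF m hm hnat Y φ) := by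
  induction X using projInduction with | h X
  induction Y using projInduction with | h Y
  obtain ⟨V, hV, f, rfl⟩ := exists_stageHom f
  obtain ⟨U, hU, a, φ, rfl⟩ := exists_predOf hV φ
  rw [← stageHom_restrict hV hU a]
  generalize restrict a f = f
  rw [reindex_stageHom]
  apply (pullbackOrderIso (mapFstIso F hF X hU)).injective
  rw [pullback_inducedInterp_predOf, hnat, mapSubobject_pullback,
    ← pullback_inducedInterp_predOf F hF m hm hnat hU, pullbackOrderIso_apply,
    pullbackOrderIso_apply, ← Subobject.pullback_comp, ← Subobject.pullback_comp,
    mapFstIso_hom_comp_map_stageHom]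

/-- If the equality predicate `e` is interpreted as the diagonal, then so is the equality predicate
of the filter quotient which it induces. -/
lemma inducedInterp_projRel_of_diag {X : C} {e : P.obj (op (X ⨯ X))}
    (he : m _ e = Subobject.mk (F.map (diag X))) :
    inducedInterp F hF m hm hnat (Φ.proj.obj X ⨯ Φ.proj.obj X) (Φ.projRel e) =
      Subobject.mk ((induced F hF).map (diag (Φ.proj.obj X))) := by
  have hd : diag (Φ.proj.obj X) ≫ (prodIso X X).hom = Φ.proj.map (diag X) := by
    apply map_prod_hom_ext Φ.proj
    · rw [Category.assoc, prodIso_hom_fst, ← Functor.map_comp]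
      simp
    · rw [Category.assoc, prodIso_hom_snd, ← Functor.map_comp]
      simp
  have h₁ : inducedInterp F hF m hm hnat (Φ.proj.obj (X ⨯ X)) (Φ.projPred e) =
      (Subobject.map ((induced F hF).map (prodIso X X).hom)).obj
        (Subobject.mk ((induced F hF).map (diag (Φ.proj.obj X)))) := by
    rw [inducedInterp_projPred, he, mapSubobject_mk, Subobject.map_mk]
    refine subobject_mk_congr _ _ ?_
    rw [← Functor.map_comp, hd, induced_map_proj_map]
  rw [projRel, inducedInterp_reindex, h₁, Subobject.pullback_map_self]

/-- The induced interpretation preserves finite meets and joins, because up to isomorphism it is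
the given interpretation at each stage. -/
lemma inducedInterp_preserves {D : Type u₂} [Category.{v₂} D] [HasFiniteProducts D]
    [IsCoherentCategory D] {Ψ : SubterminalFilter D} (F : C ⥤ D) [PreservesFiniteProducts F]
    (hF : ∀ U, Φ.mem U → Ψ.mem (F.obj U)) (m : ∀ X : C, P.obj (op X) → Subobject (F.obj X))
    (hm : ∀ X, Monotone (m X))
    (hnat : ∀ {X Y : C} (f : X ⟶ Y) (φ : P.obj (op Y)),
      m X (reindex P f φ) = (Subobject.pullback (F.map f)).obj (m Y φ))
    (hP : IsPropositionalCoherentTheory P)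
    (hlat : ∀ X, PreservesFiniteMeetsAndJoins (m X)) (X : Φ.FilterQuotient) :
    PreservesFiniteMeetsAndJoins (inducedInterp F hF m hm hnat X) := by
  induction X using projInduction with | h X
  refine preserves_of_predOf hP Φ.mem_terminal _ fun {U} hU _ => ?_
  have : inducedInterp F hF m hm hnat (Φ.proj.obj X) ∘ predOf (P := P) (X := X) hU =
      (pullbackOrderIso (mapFstIso F hF X hU)).symm ∘ mapSubobject Ψ.proj ∘ m (X ⨯ U) := by
    ext1 φ
    exact ((OrderIso.symm_apply_eq _).2
      (pullback_inducedInterp_predOf F hF m hm hnat hU φ).symm).symm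
  rw [this]
  exact (OrderIso.preservesFiniteMeetsAndJoins _).comp
    ((mapSubobject_proj_preserves _).comp (hlat _))

end Interpretation

end SubterminalFilter

namespace SubterminalFilter

/-! ### The model structure on the filter quotient -/

section ModelStructure

open HomotopicalAlgebra

variable {C : Type u₁} [Category.{v₁} C] [HasFiniteProducts C] {Φ : SubterminalFilter C}

lemma productStable_of_isStableUnderBaseChange (S : MorphismProperty C)
    [S.IsStableUnderBaseChange] : Φ.ProductStable S :=
  fun U _ _ _ f hf => S.of_isPullback (isPullback_prod_map_fst f U) hf

lemma isFinitaryModelStructure_quotientClass [∀ X : C, (prod.functor.obj X).IsLeftAdjoint]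
    {fib cof we : MorphismProperty C} (h : IsFinitaryModelStructure fib cof we)
    (hc : Φ.ProductStable cof) (hw : Φ.ProductStable we) :
    IsFinitaryModelStructure (Φ.quotientClass fib) (Φ.quotientClass cof) (Φ.quotientClass we) := by
  obtain ⟨_, rfl, rfl, rfl⟩ := h
  have hf : Φ.ProductStable (fibrations C) := productStable_of_isStableUnderBaseChange _
  have etc : Φ.quotientClass (trivialCofibrations C) =
      Φ.quotientClass (cofibrations C) ⊓ Φ.quotientClass (weakEquivalences C) :=
    quotientClass_inf hc hw
  have etf : Φ.quotientClass (trivialFibrations C) =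
      Φ.quotientClass (fibrations C) ⊓ Φ.quotientClass (weakEquivalences C) :=
    quotientClass_inf hf hw
  let : CategoryWithFibrations Φ.FilterQuotient := ⟨Φ.quotientClass (fibrations C)⟩
  let : CategoryWithCofibrations Φ.FilterQuotient := ⟨Φ.quotientClass (cofibrations C)⟩
  let : CategoryWithWeakEquivalences Φ.FilterQuotient := ⟨Φ.quotientClass (weakEquivalences C)⟩
  have htc : trivialCofibrations Φ.FilterQuotient = Φ.quotientClass (trivialCofibrations C) :=
    etc.symm
  have htf : trivialFibrations Φ.FilterQuotient = Φ.quotientClass (trivialFibrations C) :=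
    etf.symm
  refine ⟨{
    categoryWithFibrations := inferInstance
    categoryWithCofibrations := inferInstance
    categoryWithWeakEquivalences := inferInstance
    cm1a := inferInstance
    cm1b := inferInstance
    cm2 := quotientClass_hasTwoOutOfThreeProperty hw
    cm3a := quotientClass_isStableUnderRetracts hw
    cm3b := quotientClass_isStableUnderRetracts hf
    cm3c := quotientClass_isStableUnderRetracts hc
    cm4a := fun i p _ _ _ => quotientClass_hasLiftingProperty (hc.inf hw) hf
      (fun i p hi hp =>
        MorphismProperty.hasLiftingProperty_of_wfs (W₁ := trivialCofibrations C) i p hi hp) i p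
      (etc ▸ ⟨mem_cofibrations i, mem_weakEquivalences i⟩) (mem_fibrations p)
    cm4b := fun i p _ _ _ => quotientClass_hasLiftingProperty hc (hf.inf hw)
      (fun i p hi hp =>
        MorphismProperty.hasLiftingProperty_of_wfs (W₂ := trivialFibrations C) i p hi hp) i p
      (mem_cofibrations i) (etf ▸ ⟨mem_fibrations p, mem_weakEquivalences p⟩)
    cm5a := htc ▸ quotientClass_hasFactorization (S := trivialCofibrations C) (hc.inf hw) hf
    cm5b := htf ▸ quotientClass_hasFactorization (T := trivialFibrations C) hc (hf.inf hw) },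
    rfl, rfl, rfl⟩

/-- Right properness passes to the filter quotient: a pullback square of the filter quotient is
isomorphic to the image of one at a stage at which the fibration and the weak equivalence are both
represented. -/
lemma quotientClass_of_isPullback [HasPullbacks C] {fib we : MorphismProperty C}
    [fib.RespectsIso] [we.IsStableUnderRetracts] (hf : Φ.ProductStable fib)
    (hw : Φ.ProductStable we)
    (h : ∀ {X' X Y' Y : C} (g' : X' ⟶ X) (f' : X' ⟶ Y') (f : X ⟶ Y) (g : Y' ⟶ Y),
      IsPullback g' f' f g → fib f → we g → we g')
    {X' X Y' Y : Φ.FilterQuotient} {g' : X' ⟶ X} {f' : X' ⟶ Y'} {f : X ⟶ Y} {g : Y' ⟶ Y}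
    (sq : IsPullback g' f' f g) (hfib : Φ.quotientClass fib f) (hwe : Φ.quotientClass we g) :
    Φ.quotientClass we g' := by
  induction X using projInduction with | h X
  induction Y using projInduction with | h Y
  induction Y' using projInduction with | h Y'
  obtain ⟨U, hU, φ, ψ, rfl, rfl, hφ, hψ⟩ := quotientClass_exists₂ hf hw hfib hwe
  have := quotientClass_respectsIso hw
  have sq₀ := IsPullback.of_hasPullback φ ψ
  have sq₁ : IsPullback (Φ.proj.map (pullback.fst φ ψ) ≫ (fstIso X hU).hom)
      (Φ.proj.map (pullback.snd φ ψ) ≫ (fstIso Y' hU).hom) (stageHom hU φ) (stageHom hU ψ) :=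
    (isPullback_proj_map (Φ := Φ) sq₀).of_iso (Iso.refl _) (fstIso X hU) (fstIso Y' hU)
      (fstIso Y hU) (by simp) (by simp) (fst_comp_stageHom hU φ).symm
      (fst_comp_stageHom hU ψ).symm
  rw [← sq.isoIsPullback_hom_fst _ _ sq₁]
  exact (MorphismProperty.cancel_left_of_respectsIso _ _ _).2
    ((MorphismProperty.cancel_right_of_respectsIso _ _ _).2
      (hw.proj_map (h _ _ _ _ sq₀ hφ hψ)))

/-- If a class of morphisms is stable under the product with `A`, then so is the class which it
induces in the filter quotient. -/
lemma quotientClass_prod_map {S : MorphismProperty C} [S.IsStableUnderRetracts]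
    (hS : Φ.ProductStable S) {A : C}
    (h : ∀ {X Y : C} (f : X ⟶ Y), S f → S (prod.map (𝟙 A) f))
    {X Y : Φ.FilterQuotient} (f : X ⟶ Y) (hf : Φ.quotientClass S f) :
    Φ.quotientClass S (prod.map (𝟙 (Φ.proj.obj A)) f) := by
  induction X using projInduction with | h X
  induction Y using projInduction with | h Y
  obtain ⟨U, hU, φ, rfl, hφ⟩ := (quotientClass_iff _).1 hf
  have := quotientClass_respectsIso hS
  have e {Z T : C} (g : Z ⟶ T) : prod.map (𝟙 (Φ.proj.obj A)) (Φ.proj.map g) =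
      (prodIso A Z).hom ≫ Φ.proj.map (prod.map (𝟙 A) g) ≫ (prodIso A T).inv := by
    rw [← Category.assoc, Iso.eq_comp_inv]
    apply map_prod_hom_ext Φ.proj
    · rw [Category.assoc, prodIso_hom_fst, prod.map_fst, Category.assoc, ← Functor.map_comp,
        prod.map_fst, Category.comp_id, Category.comp_id, prodIso_hom_fst]
    · rw [Category.assoc, prodIso_hom_snd, prod.map_snd, Category.assoc, ← Functor.map_comp,
        prod.map_snd, Functor.map_comp, ← Category.assoc, prodIso_hom_snd]
  have key : Φ.quotientClass S (prod.map (𝟙 (Φ.proj.obj A)) (Φ.proj.map φ)) := by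
    rw [e]
    exact (MorphismProperty.cancel_left_of_respectsIso _ _ _).2
      ((MorphismProperty.cancel_right_of_respectsIso _ _ _).2 (hS.proj_map (h _ hφ)))
  refine (MorphismProperty.arrow_mk_iso_iff (Φ.quotientClass S)
    (Arrow.isoMk (prod.mapIso (Iso.refl _) (fstIso X hU)) (prod.mapIso (Iso.refl _) (fstIso Y hU))
      ?_)).1 key
  have := fst_comp_stageHom hU φ
  simp only [Arrow.mk_hom, prod.mapIso_hom, Iso.refl_hom, prod.map_map, Category.comp_id,
    fstIso_hom]
  rw [this]

end ModelStructure

end SubterminalFilter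

namespace ShapeData

/-! ### The filter quotient of a finitary model category with shapes -/

variable {M : Type u₁} [Category.{v₁} M] [HasFiniteProducts M]
  {V : Type u₂} [Category.{v₂} V] [HasFiniteProducts V]
  {T₀ : Type u₃} [Category.{v₃} T₀] [HasFiniteProducts T₀]
  (S : ShapeData.{v₁, v₂, v₃, u₁, u₂, u₃, w} M V T₀)
  (hS : S.IsFinitaryModelCategoryWithShapes) (Φ : S.ModelFilter)

lemma filterQuotient_isFinitaryModelCategoryWithShapes :
    (S.filterQuotient hS Φ).IsFinitaryModelCategoryWithShapes := by
  have := hS.topos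
  have := hS.topos.hasSubobjectClassifier
  have := hS.topos.cartesianClosed
  have := hS.coherentCategory
  have := hS.m₀_products
  have := hS.coherentFunctor.preservesFiniteLimits
  obtain ⟨_, hfib, hcof, hwe⟩ := hS.modelStructure
  have : S.we.IsStableUnderRetracts := hwe ▸ inferInstance
  have : S.cof.IsStableUnderRetracts := hcof ▸ inferInstance
  have : S.fib.IsStableUnderBaseChange := hfib ▸ inferInstance
  have hf : Φ.ΦM.ProductStable S.fib :=
    SubterminalFilter.productStable_of_isStableUnderBaseChange _
  exact {
    topos :=
      { hasSubobjectClassifier := inferInstance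
        cartesianClosed := fun X => inferInstance }
    modelStructure := SubterminalFilter.isFinitaryModelStructure_quotientClass hS.modelStructure
      Φ.cof_stable Φ.we_stable
    rightProper := fun _ _ _ _ sq => SubterminalFilter.quotientClass_of_isPullback hf Φ.we_stable
      hS.rightProper sq
    cof_mono := fun f hf' => by
      have := SubterminalFilter.quotientClass_mono (Φ := Φ.ΦM)
        (show S.cof ≤ MorphismProperty.monomorphisms M from fun _ _ f h => hS.cof_mono f h) f hf'
      rwa [SubterminalFilter.quotientClass_monomorphisms] at this
    theory := SubterminalFilter.quotientTheory_isPropositionalCoherentTheory hS.theory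
    coherentCategory := inferInstance
    m₀_products := SubterminalFilter.induced_preservesFiniteProducts S.m₀ Φ.map_m₀
    m₁_lattice := SubterminalFilter.inducedInterp_preserves S.m₀ Φ.map_m₀ S.m₁
      (fun X => (hS.m₁_lattice X).monotone) hS.m₁_reindex
      hS.theory hS.m₁_lattice
    m₁_reindex := SubterminalFilter.inducedInterp_reindex S.m₀ Φ.map_m₀ S.m₁
      (fun X => (hS.m₁_lattice X).monotone) hS.m₁_reindex
    coherentFunctor := SubterminalFilter.isCoherentFunctor_induced S.ω Φ.map_ω hS.coherentFunctor
    acyclic := fun U {X Y} f hc hw => by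
      have h := SubterminalFilter.quotientClass_prod_map (S := S.cof ⊓ S.we) (Φ := Φ.ΦM)
        (Φ.cof_stable.inf Φ.we_stable) (A := S.ω.obj U.as)
        (fun f hf => hS.acyclic U.as f hf.1 hf.2) f
      rw [SubterminalFilter.quotientClass_inf Φ.cof_stable Φ.we_stable] at h
      exact h ⟨hc, hw⟩ }

lemma filterQuotient_preservesEquality (h : S.PreservesEquality) :
    (S.filterQuotient hS Φ).PreservesEquality := by
  intro X e he
  have := hS.coherentCategory
  have := hS.m₀_products
  obtain ⟨e₀, he₀⟩ := hS.theory.equality X.as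
  obtain rfl := he.unique (SubterminalFilter.projRel_isEqualityPredicate hS.theory he₀)
  exact SubterminalFilter.inducedInterp_projRel_of_diag S.m₀ Φ.map_m₀ S.m₁
    (fun X => (hS.m₁_lattice X).monotone) hS.m₁_reindex (h _ _ he₀)

end ShapeData

theorem mainTheorem3 {M : Type u₁} [Category.{v₁} M] [HasFiniteProducts M]
    {V : Type u₂} [Category.{v₂} V] [HasFiniteProducts V]
    {T₀ : Type u₃} [Category.{v₃} T₀] [HasFiniteProducts T₀]
    (S : ShapeData.{v₁, v₂, v₃, u₁, u₂, u₃, w} M V T₀)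
    (hS : S.IsFinitaryModelCategoryWithShapes) (Φ : S.ModelFilter) :
    (S.filterQuotient hS Φ).IsFinitaryModelCategoryWithShapes ∧
      (HasStrictInterval S.theory → HasStrictInterval (S.filterQuotient hS Φ).theory) ∧
      (S.PreservesEquality → (S.filterQuotient hS Φ).PreservesEquality) ∧
      (S.cof = MorphismProperty.monomorphisms M →
        (S.filterQuotient hS Φ).cof = MorphismProperty.monomorphisms Φ.ΦM.FilterQuotient) := by
  refine ⟨S.filterQuotient_isFinitaryModelCategoryWithShapes hS Φ, fun ⟨I⟩ =>
    ⟨SubterminalFilter.strictInterval hS.theory I⟩, S.filterQuotient_preservesEquality hS Φ,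
    fun h => ?_⟩
  have := hS.topos
  exact (congrArg Φ.ΦM.quotientClass h).trans SubterminalFilter.quotientClass_monomorphisms
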